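/- Let $H_{\mathbf R}$ be an infinite-dimensional real Hilbert space with a strongly continuous one-parameter group $(U_t)_{t\in\mathbf R}$ of orthogonal transformations, let $H=H_{\mathbf R}\otimes_{\mathbf R}\mathbf C$ be its complexification and let $A$ be the generator of the extension of $(U_t)$ to $H$, i.e. the positive nonsingular self-adjoint operator with $A^{it}=U_t$. Put $K_{\mathbf R}=\{(2/(A^{-1}+1))^{1/2}\zeta:\zeta\in H_{\mathbf R}\}\subset H$. On the full Fock space $\mathcal F(H)=\mathbf C\Omega\oplus\bigoplus_{n\ge1}H^{\otimes n}$ let $\ell(\xi)$ be the left creation operators, $s(\xi)=(\ell(\xi)+\ell(\xi)^*)/2$, let $\Gamma=\Gamma(H_{\mathbf R},U_t)$ be the unital $C^*$-algebra generated by $\{s(\xi):\xi\in K_{\mathbf R}\}$ and $\Gamma''$ the von Neumann algebra generated by it. For $e_1,\dots,e_n\in K_{\mathbf R}+iK_{\mathbf R}$ let $W(e_1\otimes\cdots\otimes e_n)$ be the unique element $x$ of $\Gamma''$ with $x\Omega=e_1\otimes\cdots\otimes e_n$ (it lies in $\Gamma$; for $n=0$ it is $1$). Let $\mathcal T$ be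 the Toeplitz algebra, i.e. the $C^*$-algebra generated by the unilateral shift $S$ on $\ell^2(\mathbf N)$. Let $\varphi:\mathbf N\to\mathbf C$ be any function, let $\gamma$ be the functional $\gamma(S^iS^{*j})=\varphi(i+j)$ on $\operatorname{span}\{S^iS^{*j}:i,j\ge0\}$, and let $\mathrm m_\varphi$ be the linear map $W(e_1\otimes\cdots\otimes e_n)\mapsto\varphi(n)W(e_1\otimes\cdots\otimes e_n)$ ($n\ge0$, $e_k\in K_{\mathbf R}+iK_{\mathbf R}$) on the span of these elements. Then the following are equivalent: $\mathrm m_\varphi$ extends to a completely bounded map on $\Gamma$; $\mathrm m_\varphi$ extends to a normal completely bounded map on $\Gamma''$ (that is, $\varphi$ defines a completely bounded radial multiplier on $\Gamma''$); $\gamma$ extends to a bounded functional on $\mathcal T$. In that case $\|\mathrm m_\varphi\|_{\mathrm{cb}}=\|\gamma\|_{\mathcal T^*}$, both for the extension to $\Gamma$ and for the normal extension to $\Gamma''$. -/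

import Mathlib

open scoped TensorProduct InnerProductSpace

noncomputable section

universe u

namespace FreeArakiWoods

set_option linter.unusedSectionVars false

/-! ### The complexification of a real Hilbert space -/

/-- The complexification `E ⊗_ℝ ℂ` of a real inner product space, realised as the Hilbert sum
`E ⊕ E`, where the pair `(x, y)` stands for `x + i y`. -/
def Complexification (E : Type u) : Type u := WithLp 2 (E × E)

namespace Complexification

variable {E : Type u}

/-- The vector `x + i y`. -/
def mk (x y : E) : Complexification E := WithLp.toLp 2 (x, y)

/-- The real part of `x + i y`. -/
def re (z : Complexification E) : E := (WithLp.ofLp z).1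

/-- The imaginary part of `x + i y`. -/
def im (z : Complexification E) : E := (WithLp.ofLp z).2

@[simp] theorem re_mk (x y : E) : (mk x y).re = x := rfl

@[simp] theorem im_mk (x y : E) : (mk x y).im = y := rfl

@[ext] theorem ext {z w : Complexification E} (h₁ : z.re = w.re) (h₂ : z.im = w.im) : z = w :=
  (WithLp.equiv 2 (E × E)).injective (Prod.ext h₁ h₂)

variable [NormedAddCommGroup E] [InnerProductSpace ℝ E]

instance : NormedAddCommGroup (Complexification E) :=
  inferInstanceAs (NormedAddCommGroup (WithLp 2 (E × E)))

instance [CompleteSpace E] : CompleteSpace (Complexification E) :=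
  inferInstanceAs (CompleteSpace (WithLp 2 (E × E)))

@[simp] theorem re_add (z w : Complexification E) : (z + w).re = z.re + w.re := rfl

@[simp] theorem im_add (z w : Complexification E) : (z + w).im = z.im + w.im := rfl

@[simp] theorem re_zero : (0 : Complexification E).re = 0 := rfl

@[simp] theorem im_zero : (0 : Complexification E).im = 0 := rfl

theorem norm_sq (z : Complexification E) : ‖z‖ ^ 2 = ‖z.re‖ ^ 2 + ‖z.im‖ ^ 2 :=
  WithLp.prod_norm_sq_eq_of_L2 (α := E) (β := E) z

instance : SMul ℂ (Complexification E) :=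
  ⟨fun c z => mk (c.re • z.re - c.im • z.im) (c.re • z.im + c.im • z.re)⟩

@[simp] theorem re_smul (c : ℂ) (z : Complexification E) :
    (c • z).re = c.re • z.re - c.im • z.im := rfl

@[simp] theorem im_smul (c : ℂ) (z : Complexification E) :
    (c • z).im = c.re • z.im + c.im • z.re := rfl

instance : Module ℂ (Complexification E) where
  one_smul z := by ext <;> simp
  mul_smul a b z := by
    ext <;> simp only [re_smul, im_smul, Complex.mul_re, Complex.mul_im] <;> module
  smul_zero a := by ext <;> simp
  smul_add a z w := by ext <;> simp only [re_smul, im_smul, re_add, im_add] <;> module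
  add_smul a b z := by
    ext <;> simp only [re_smul, im_smul, re_add, im_add, Complex.add_re, Complex.add_im] <;> module
  zero_smul z := by ext <;> simp

/-- The inner product of `x + i y` and `x' + i y'`, conjugate-linear in the first variable. -/
instance : Inner ℂ (Complexification E) :=
  ⟨fun z w => ⟨⟪z.re, w.re⟫_ℝ + ⟪z.im, w.im⟫_ℝ, ⟪z.re, w.im⟫_ℝ - ⟪z.im, w.re⟫_ℝ⟩⟩

theorem inner_def (z w : Complexification E) :
    inner ℂ z w = ⟨⟪z.re, w.re⟫_ℝ + ⟪z.im, w.im⟫_ℝ, ⟪z.re, w.im⟫_ℝ - ⟪z.im, w.re⟫_ℝ⟩ := rfl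

theorem norm_smul' (c : ℂ) (z : Complexification E) : ‖c • z‖ = ‖c‖ * ‖z‖ := by
  have h : ‖c • z‖ ^ 2 = (‖c‖ * ‖z‖) ^ 2 := by
    rw [mul_pow, norm_sq, norm_sq, Complex.sq_norm, Complex.normSq_apply, re_smul, im_smul,
      norm_sub_sq_real, norm_add_sq_real]
    simp only [norm_smul, mul_pow, Real.norm_eq_abs, sq_abs, real_inner_smul_left,
      real_inner_smul_right]
    rw [real_inner_comm z.re z.im]
    ring
  exact (pow_left_inj₀ (norm_nonneg _) (by positivity) two_ne_zero).1 h

instance : InnerProductSpace ℂ (Complexification E) where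
  norm_smul_le c z := (norm_smul' c z).le
  norm_sq_eq_re_inner z := by
    rw [norm_sq, inner_def]
    simp
  conj_inner_symm z w := by
    apply Complex.ext <;> simp [inner_def, real_inner_comm]
  add_left z w v := by
    apply Complex.ext <;> simp [inner_def, inner_add_left] <;> ring
  smul_left z w c := by
    apply Complex.ext <;>
      simp [inner_def, inner_add_left, inner_sub_left, real_inner_smul_left] <;> ring

/-- The inclusion of the real Hilbert space into its complexification. -/
def ofReal (x : E) : Complexification E := mk x 0

/-- The complex-linear extension `x + i y ↦ V x + i V y` of an orthogonal transformation. -/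
def map (V : E ≃ₗᵢ[ℝ] E) (z : Complexification E) : Complexification E := mk (V z.re) (V z.im)

end Complexification

/-! ### The full Fock space and the creation operators -/

/-- A complex Hilbert space, bundled. -/
structure HilbertSpc : Type (u + 1) where
  carrier : Type u
  [nacg : NormedAddCommGroup carrier]
  [ips : InnerProductSpace ℂ carrier]
  [complete : CompleteSpace carrier]

instance : CoeSort HilbertSpc.{u} (Type u) := ⟨HilbertSpc.carrier⟩

attribute [instance] HilbertSpc.nacg HilbertSpc.ips HilbertSpc.complete

section Fock

variable (H : Type u) [NormedAddCommGroup H] [InnerProductSpace ℂ H]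

/-- The Hilbert space tensor power `H^{⊗ n}`: the zeroth power is the one-dimensional Hilbert
space, and `H^{⊗ (n + 1)}` is the completion of `H ⊗ H^{⊗ n}`. -/
def tensorPow : ℕ → HilbertSpc.{u}
  | 0 => ⟨EuclideanSpace ℂ PUnit.{u + 1}⟩
  | n + 1 => ⟨UniformSpace.Completion (H ⊗[ℂ] (tensorPow n).carrier)⟩

/-- The full Fock space `⊕_{n ≥ 0} H^{⊗ n}` (Hilbert space direct sum). -/
abbrev Fock : Type u := lp (fun n => (tensorPow H n).carrier) 2

variable {H}

/-- The map `x ↦ ξ ⊗ x` from `H^{⊗ n}` to `H^{⊗ (n + 1)}`. -/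
def tensorLeft (ξ : H) (n : ℕ) : tensorPow H n →L[ℂ] tensorPow H (n + 1) :=
  UniformSpace.Completion.toComplL.comp (TensorProduct.mkL ℂ H (tensorPow H n).carrier ξ)

theorem norm_tensorLeft_apply (ξ : H) (n : ℕ) (x : tensorPow H n) :
    ‖tensorLeft ξ n x‖ = ‖ξ‖ * ‖x‖ :=
  (UniformSpace.Completion.norm_coe _).trans (TensorProduct.norm_tmul ξ x)

/-- The vector `e₁ ⊗ ⋯ ⊗ eₙ` of `H^{⊗ n}`. -/
def tensorVec : (n : ℕ) → (Fin n → H) → tensorPow H n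
  | 0, _ => (EuclideanSpace.single PUnit.unit 1 : EuclideanSpace ℂ PUnit.{u + 1})
  | n + 1, e => tensorLeft (e 0) n (tensorVec n (Fin.tail e))

/-- The vector `e₁ ⊗ ⋯ ⊗ eₙ` as an element of the full Fock space. -/
def pureTensor {n : ℕ} (e : Fin n → H) : Fock H := lp.single 2 n (tensorVec n e)

variable (H) in
/-- The vacuum vector `Ω`. -/
def vacuum : Fock H := pureTensor (Fin.elim0 : Fin 0 → H)

end Fock

section Shift

variable {G : ℕ → Type u} [∀ n, NormedAddCommGroup (G n)] [∀ n, InnerProductSpace ℂ (G n)]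

/-- The sequence `(0, T₀ f₀, T₁ f₁, …)`. -/
def shiftFun (T : ∀ n, G n →L[ℂ] G (n + 1)) (f : ∀ n, G n) : ∀ n, G n
  | 0 => 0
  | n + 1 => T n (f n)

theorem shiftFun_aux (T : ∀ n, G n →L[ℂ] G (n + 1)) (C : ℝ) (hC : ∀ n x, ‖T n x‖ ≤ C * ‖x‖)
    (f : lp G 2) : Summable (fun n => ‖shiftFun T f n‖ ^ 2) ∧
      ∑' n, ‖shiftFun T f n‖ ^ 2 ≤ C ^ 2 * ‖f‖ ^ 2 := by
  have hf := lp.hasSum_norm (p := 2) (by norm_num) f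
  simp only [ENNReal.toReal_ofNat, Real.rpow_ofNat] at hf
  have hb : ∀ n, ‖shiftFun T f (n + 1)‖ ^ 2 ≤ C ^ 2 * ‖f n‖ ^ 2 := fun n => by
    rw [← mul_pow]
    exact pow_le_pow_left₀ (norm_nonneg _) (hC n (f n)) 2
  have hs : Summable (fun n => ‖shiftFun T f (n + 1)‖ ^ 2) :=
    Summable.of_nonneg_of_le (fun _ => by positivity) hb (hf.summable.mul_left _)
  have hs' : Summable (fun n => ‖shiftFun T f n‖ ^ 2) := (summable_nat_add_iff 1).1 hs
  refine ⟨hs', ?_⟩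
  rw [hs'.tsum_eq_zero_add, ← hf.tsum_eq, ← tsum_mul_left]
  have h0 : ‖shiftFun T f 0‖ ^ 2 = 0 := by simp [shiftFun]
  rw [h0, zero_add]
  exact hs.tsum_le_tsum hb (hf.summable.mul_left _)

/-- The bounded operator `(f₀, f₁, …) ↦ (0, T₀ f₀, T₁ f₁, …)` on the Hilbert sum of the `G n`,
for uniformly bounded `T n : G n → G (n + 1)`. -/
def shiftOp (T : ∀ n, G n →L[ℂ] G (n + 1)) (C : ℝ) (hC : ∀ n x, ‖T n x‖ ≤ C * ‖x‖) :
    lp G 2 →L[ℂ] lp G 2 :=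
  LinearMap.mkContinuous
    { toFun := fun f => ⟨shiftFun T f, memℓp_gen (by
        simpa using (shiftFun_aux T C hC f).1)⟩
      map_add' := fun f g => by
        ext n
        cases n with
        | zero => exact (add_zero (0 : G 0)).symm
        | succ n => exact map_add (T n) (f n) (g n)
      map_smul' := fun c f => by
        ext n
        cases n with
        | zero => exact (smul_zero c).symm
        | succ n => exact map_smul (T n) c (f n) }
    |C| (fun f => by
      refine abs_le_of_sq_le_sq' ?_ (by positivity) |>.2
      rw [mul_pow, sq_abs]
      refine le_trans (le_of_eq ?_) (shiftFun_aux T C hC f).2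
      have h := lp.norm_rpow_eq_tsum (p := 2) (by norm_num)
        (⟨shiftFun T f, memℓp_gen (by simpa using (shiftFun_aux T C hC f).1)⟩ : lp G 2)
      simpa using h)

end Shift

section Creation

variable {H : Type u} [NormedAddCommGroup H] [InnerProductSpace ℂ H]

/-- The left creation operator `ℓ(ξ)`, sending `e₁ ⊗ ⋯ ⊗ eₙ` to `ξ ⊗ e₁ ⊗ ⋯ ⊗ eₙ`. -/
def creation (ξ : H) : Fock H →L[ℂ] Fock H :=
  shiftOp (tensorLeft ξ) ‖ξ‖ (fun n x => (norm_tensorLeft_apply ξ n x).le)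

theorem creation_pureTensor (ξ : H) {n : ℕ} (e : Fin n → H) :
    creation ξ (pureTensor e) = pureTensor (Fin.cons ξ e : Fin (n + 1) → H) := by
  ext m
  cases m with
  | zero =>
    change (0 : tensorPow H 0) =
      (lp.single 2 (n + 1) (tensorVec (n + 1) (Fin.cons ξ e)) : Fock H) 0
    rw [lp.single_apply_ne 2 (n + 1) _ (by omega)]
  | succ m =>
    change tensorLeft ξ m ((lp.single 2 n (tensorVec n e) : Fock H) m) =
      (lp.single 2 (n + 1) (tensorVec (n + 1) (Fin.cons ξ e)) : Fock H) (m + 1)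
    by_cases h : m = n
    · subst h
      rw [lp.single_apply_self, lp.single_apply_self]
      rfl
    · rw [lp.single_apply_ne 2 n _ h, lp.single_apply_ne 2 (n + 1) _ (by omega), map_zero]

/-- The real part `s(ξ) = (ℓ(ξ) + ℓ(ξ)*) / 2` of the creation operator. -/
def semicircular (ξ : H) : Fock H →L[ℂ] Fock H :=
  (2⁻¹ : ℂ) • (creation ξ + star (creation ξ))

end Creation

/-! ### The Toeplitz algebra -/

/-- The unilateral shift on `ℓ²(ℕ)`. -/
def unilateralShift : lp (fun _ : ℕ => ℂ) 2 →L[ℂ] lp (fun _ : ℕ => ℂ) 2 :=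
  shiftOp (fun _ => ContinuousLinearMap.id ℂ ℂ) 1 (fun _ x => by simp)

/-- The Toeplitz algebra: the C*-algebra generated by the unilateral shift. -/
abbrev toeplitz : StarSubalgebra ℂ (lp (fun _ : ℕ => ℂ) 2 →L[ℂ] lp (fun _ : ℕ => ℂ) 2) :=
  StarAlgebra.elemental ℂ unilateralShift

/-- The shift as an element of the Toeplitz algebra. -/
def toeplitzShift : toeplitz :=
  ⟨unilateralShift, StarAlgebra.elemental.self_mem ℂ unilateralShift⟩

/-- `γ` is the bounded extension to the Toeplitz algebra of the radial functional
`S^i S*^j ↦ φ (i + j)`. -/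
def IsRadialFunctional (φ : ℕ → ℂ) (γ : toeplitz →L[ℂ] ℂ) : Prop :=
  ∀ i j : ℕ, γ (toeplitzShift ^ i * star toeplitzShift ^ j) = φ (i + j)

/-! ### Completely bounded and normal maps between operator algebras -/

section Maps

variable {K : Type u} [NormedAddCommGroup K] [InnerProductSpace ℂ K] [CompleteSpace K]
  {A B : StarSubalgebra ℂ (K →L[ℂ] K)}

/-- All the amplifications `M_n(A) → M_n(B)` of `m` have norm at most `C`, where matrices of
operators carry the C*-norm. -/
def CBBound (m : A →ₗ[ℂ] B) (C : ℝ) : Prop :=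
  ∀ (n : ℕ) (x : Fin n → Fin n → A),
    ‖CStarMatrix.ofMatrix (Matrix.of fun i j => (m (x i j) : K →L[ℂ] K))‖ ≤
      C * ‖CStarMatrix.ofMatrix (Matrix.of fun i j => (x i j : K →L[ℂ] K))‖

/-- Complete boundedness. -/
def IsCompletelyBounded (m : A →ₗ[ℂ] B) : Prop := ∃ C : ℝ, CBBound m C

/-- The completely bounded norm (meaningful for completely bounded maps). -/
def cbNorm (m : A →ₗ[ℂ] B) : ℝ := sInf {C : ℝ | 0 ≤ C ∧ CBBound m C}

/-- A normal (ultraweakly continuous) functional. -/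
def IsNormalFunctional (ω : A →ₗ[ℂ] ℂ) : Prop :=
  ∃ ξ η : ℕ → K, Summable (fun n => ‖ξ n‖ ^ 2) ∧ Summable (fun n => ‖η n‖ ^ 2) ∧
    ∀ x : A, HasSum (fun n => inner ℂ (ξ n) ((x : K →L[ℂ] K) (η n))) (ω x)

/-- A normal (ultraweakly continuous) map: it pulls normal functionals back to normal
functionals. -/
def IsNormalMap (m : A →ₗ[ℂ] B) : Prop :=
  ∀ ω : B →ₗ[ℂ] ℂ, IsNormalFunctional ω → IsNormalFunctional (ω ∘ₗ m)

end Maps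

/-! ### The free Araki–Woods algebras -/

section ArakiWoods

variable {E : Type u} [NormedAddCommGroup E] [InnerProductSpace ℝ E]

/-- The graph of the generator `A` of `(U_t)`, i.e. of the positive nonsingular self-adjoint
operator on the complexification with `A^{it} = U_t`: a vector `ξ` lies in the domain of `A`, with
`A ξ = η`, iff the orbit `t ↦ U_t ξ` extends to a function `F(z) = A^{iz} ξ` that is continuous on
the strip `-1 ≤ Im z ≤ 0` and holomorphic in its interior, and `η = F(-i)`. -/
def IsGeneratorGraph (U : ℝ → E ≃ₗᵢ[ℝ] E) (ξ η : Complexification E) : Prop :=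
  ∃ F : ℂ → Complexification E,
    DiffContOnCl ℂ F (Complex.im ⁻¹' Set.Ioo (-1) 0) ∧
      (∀ t : ℝ, F t = Complexification.map (U t) ξ) ∧ F (-Complex.I) = η

variable [CompleteSpace E]

/-- `R = (2 / (A⁻¹ + 1))^{1/2}`: the positive bounded operator with `(A⁻¹ + 1) R² = 2`, that is,
`A⁻¹ (R² ζ) = 2 ζ - R² ζ` for all `ζ`, which is written as `A (2 ζ - R² ζ) = R² ζ`. -/
def IsEmbeddingOperator (U : ℝ → E ≃ₗᵢ[ℝ] E)
    (R : Complexification E →L[ℂ] Complexification E) : Prop :=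
  R.IsPositive ∧ ∀ ζ, IsGeneratorGraph U ((2 : ℂ) • ζ - R (R ζ)) (R (R ζ))

/-- The real subspace `K_ℝ = j(E)`, where `j ζ = (2 / (A⁻¹ + 1))^{1/2} ζ`. -/
def KR (U : ℝ → E ≃ₗᵢ[ℝ] E) : Set (Complexification E) :=
  {ξ | ∃ R, IsEmbeddingOperator U R ∧ ∃ ζ : E, ξ = R (Complexification.ofReal ζ)}

/-- The set `K_ℝ + i K_ℝ`. -/
def KC (U : ℝ → E ≃ₗᵢ[ℝ] E) : Set (Complexification E) :=
  {e | ∃ h ∈ KR U, ∃ k ∈ KR U, e = h + Complex.I • k}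

/-- The generators `s(ξ)`, `ξ ∈ K_ℝ`. -/
def generators (U : ℝ → E ≃ₗᵢ[ℝ] E) :
    Set (Fock (Complexification E) →L[ℂ] Fock (Complexification E)) :=
  {x | ∃ ξ ∈ KR U, x = semicircular ξ}

/-- The C*-algebra `Γ(H_ℝ, U_t)` generated by the `s(ξ)`, `ξ ∈ K_ℝ`. -/
def Gam (U : ℝ → E ≃ₗᵢ[ℝ] E) :
    StarSubalgebra ℂ (Fock (Complexification E) →L[ℂ] Fock (Complexification E)) :=
  (StarAlgebra.adjoin ℂ (generators U)).topologicalClosure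

/-- The free Araki–Woods von Neumann algebra `Γ(H_ℝ, U_t)'' = {s(ξ) : ξ ∈ K_ℝ}''`. -/
def GamVN (U : ℝ → E ≃ₗᵢ[ℝ] E) : VonNeumannAlgebra (Fock (Complexification E)) where
  toStarSubalgebra := StarSubalgebra.centralizer ℂ
    (StarSubalgebra.centralizer ℂ (generators U) : Set _)
  centralizer_centralizer' := by
    have h := StarSubalgebra.coe_centralizer_centralizer ℂ (generators U)
    exact (congrArg (fun s => Set.centralizer (Set.centralizer s)) h).trans
      ((Set.centralizer_centralizer_centralizer _).trans h.symm)

/-- `m` acts as the radial multiplier with symbol `φ`: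
`m (W(e₁ ⊗ ⋯ ⊗ eₙ)) = φ(n) W(e₁ ⊗ ⋯ ⊗ eₙ)` for all `e₁, …, eₙ ∈ K_ℝ + i K_ℝ`, where `W(ζ)` is the
element `x` of the algebra with `x Ω = ζ`. -/
def IsRadialMap (U : ℝ → E ≃ₗᵢ[ℝ] E)
    {A : StarSubalgebra ℂ (Fock (Complexification E) →L[ℂ] Fock (Complexification E))}
    (φ : ℕ → ℂ) (m : A →ₗ[ℂ] A) : Prop :=
  ∀ (n : ℕ) (e : Fin n → Complexification E), (∀ k, e k ∈ KC U) →
    ∀ x : A, (x : Fock (Complexification E) →L[ℂ] Fock (Complexification E))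
      (vacuum (Complexification E)) = pureTensor e → m x = φ n • x

end ArakiWoods

end FreeArakiWoods

end

noncomputable section


namespace FreeArakiWoods

open ContinuousLinearMap (adjoint)

/-! ### Shifts and diagonal operators on Hilbert sums -/

section HilbertSum

variable {G : ℕ → Type u} [∀ n, NormedAddCommGroup (G n)] [∀ n, InnerProductSpace ℂ (G n)]

/-! The bridge between the two algebras is the Wick formula W(e₁ ⊗ ⋯ ⊗ eₙ) = ∑ₖ ℓ(e₁)⋯ℓ(eₖ)
ℓ(ēₖ₊₁)*⋯ℓ(ēₙ)*. Each summand has n factors, so a linear map that scales every product of i creation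
and j annihilation operators by φ(i+j) is radial with symbol φ (`map_wick`).

From γ to a multiplier: a Hahn–Banach extension of γ to B(ℓ²) is evaluated on rank one operators,
which yields a trace class operator, and what remains is carried by the characters S ↦ ±1. Thus
φ(i+j) = c₁ + c₂(-1)^(i+j) + ∑ₖ ⟨S*^i βₖ, S*^j αₖ⟩, where |c₁| + |c₂| plus the trace norm is at most
‖γ‖ (`exists_radial_decomposition`). For each β in ℓ² there is an operator `coaction β` from F(H) to
a sum of copies of F(H) such that v ⊗ β ↦ `coaction β v` is isometric (`inner_coaction`) and ℓ(ξ)*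
passes through it at the cost of replacing β by S*β (`star_creation_coactionComp`). Columns of these
operators give P and Q with ‖P‖‖Q‖ ≤ ‖γ‖ for which x ↦ P*(x ⊗ 1)Q is radial
(`exists_ampConj_of_radialFunctional`). Such a map is normal and completely bounded by ‖γ‖.

From a multiplier to γ: infinite dimension provides N orthonormal vectors eₖ in K_ℝ. With isometries
aₖ of ℓ² with orthogonal ranges, V = N^(-1/2) ∑ aₖ ⊗ ℓ(eₖ) is a pure isometry, while D = N^(-1/2) ∑
aₖ ⊗ ℓ(eₖ)* has norm at most N^(-1/2). Hence V^i V*^j is within (i+j) N^(-1/2) of an operator whose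
entries are combinations of Wick products of length i+j (`mixedProd`), and the amplified multiplier
scales the latter by φ(i+j). The Wold decomposition bounds combinations of V^i V*^j by the same
combinations of S^i S*^j (`norm_sum_isometry_le`). Testing on η = ∑_{m<M} V^m x₀, for which ⟨η, V^i
V*^j η⟩/M tends to 1, gives |∑ c φ(i+j)| ≤ C ‖∑ c S^i S*^j‖ (`IsRadialMap.norm_sum_le`), that is,
‖γ‖ ≤ C.

Two supporting facts complete the argument. The vacuum is separating (`eq_zero_of_vacuum`), because
right semicircular operators over the conjugate of K_ℝ commute with the generators; this identifies
W(e₁ ⊗ ⋯ ⊗ eₙ) with the Wick product. The span of the Wick products is a dense star algebra, so a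
radial map that is completely bounded on Γ, or normal on Γ'', must be the spatial one. The operator
(2/(A⁻¹+1))^(1/2) is built from entire orbits of the group, and it is the only one satisfying the
defining condition (`isEmbeddingOperator_iff`). -/

theorem shiftOp_apply_zero (T : ∀ n, G n →L[ℂ] G (n + 1)) (C : ℝ) (hC) (f : lp G 2) :
    shiftOp T C hC f 0 = 0 := rfl

theorem shiftOp_apply_succ (T : ∀ n, G n →L[ℂ] G (n + 1)) (C : ℝ) (hC) (f : lp G 2) (n : ℕ) :
    shiftOp T C hC f (n + 1) = T n (f n) := rfl

theorem shiftOp_single (T : ∀ n, G n →L[ℂ] G (n + 1)) (C : ℝ) (hC) (n : ℕ) (x : G n) :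
    shiftOp T C hC (lp.single 2 n x) = lp.single 2 (n + 1) (T n x) := by
  ext m
  cases m with
  | zero =>
    rw [shiftOp_apply_zero, lp.single_apply_ne 2 (n + 1) _ (by omega)]
  | succ m =>
    rw [shiftOp_apply_succ]
    by_cases h : m = n
    · subst h
      rw [lp.single_apply_self, lp.single_apply_self]
    · rw [lp.single_apply_ne 2 n _ h, lp.single_apply_ne 2 (n + 1) _ (by omega), map_zero]

theorem star_shiftOp_apply [∀ n, CompleteSpace (G n)] (T : ∀ n, G n →L[ℂ] G (n + 1)) (C : ℝ) (hC)
    (f : lp G 2) (n : ℕ) :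
    (star (shiftOp T C hC) f) n = adjoint (T n) (f (n + 1)) := by
  refine ext_inner_left ℂ fun v => ?_
  rw [← lp.inner_single_left (𝕜 := ℂ), ContinuousLinearMap.star_eq_adjoint,
    ContinuousLinearMap.adjoint_inner_right,
    shiftOp_single, lp.inner_single_left, ContinuousLinearMap.adjoint_inner_right]

theorem lp_norm_sq {ι : Type*} {X : ι → Type*} [∀ i, NormedAddCommGroup (X i)] (f : lp X 2) :
    ‖f‖ ^ 2 = ∑' n, ‖f n‖ ^ 2 := by
  simpa using lp.norm_rpow_eq_tsum (p := 2) (by norm_num) f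

theorem lp_summable_norm_sq {ι : Type*} {X : ι → Type*} [∀ i, NormedAddCommGroup (X i)]
    (f : lp X 2) : Summable fun n => ‖f n‖ ^ 2 := by
  simpa using (lp.memℓp f).summable (by norm_num)

/-- The diagonal operator `v ↦ (f n • v n)ₙ` with bounded symbol `f`. -/
def diagOp (f : ℕ → ℂ) (C : ℝ) (hf : ∀ n, ‖f n‖ ≤ C) : lp G 2 →L[ℂ] lp G 2 :=
  lp.mapCLM 2 (fun n => f n • ContinuousLinearMap.id ℂ (G n)) ((norm_nonneg _).trans (hf 0))
    (fun n => ContinuousLinearMap.opNorm_le_bound _ ((norm_nonneg _).trans (hf 0)) fun x => by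
      change ‖f n • x‖ ≤ _
      rw [norm_smul]
      gcongr
      exact hf n)

theorem diagOp_apply (f : ℕ → ℂ) (C : ℝ) (hf) (v : lp G 2) (n : ℕ) :
    diagOp f C hf v n = f n • v n := rfl

/-- Lowering the degree by one shifts the diagonal symbol by one. This is how the backward shift on
ℓ² comes to act on Fock space. -/
theorem star_shiftOp_diagOp [∀ n, CompleteSpace (G n)] (T : ∀ n, G n →L[ℂ] G (n + 1)) (C : ℝ) (hC)
    (f : ℕ → ℂ) (C' : ℝ) (hf) (v : lp G 2) :
    star (shiftOp T C hC) (diagOp f C' hf v) =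
      diagOp (fun n => f (n + 1)) C' (fun n => hf (n + 1)) (star (shiftOp T C hC) v) := by
  ext n
  rw [star_shiftOp_apply, diagOp_apply, diagOp_apply, star_shiftOp_apply, map_smul]

end HilbertSum

/-! ### Right creation operators -/

section TensorRight

variable {H : Type u} [NormedAddCommGroup H] [InnerProductSpace ℂ H]

theorem norm_lTensor_of_norm_eq {X Y : Type*} [NormedAddCommGroup X] [InnerProductSpace ℂ X]
    [NormedAddCommGroup Y] [InnerProductSpace ℂ Y] (B : X →ₗ[ℂ] Y) (c : ℝ) (hc : 0 ≤ c)
    (hB : ∀ x, ‖B x‖ = c * ‖x‖) (z : H ⊗[ℂ] X) : ‖B.lTensor H z‖ = c * ‖z‖ := by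
  rcases hc.eq_or_lt with rfl | hc
  · have : B = 0 := by
      ext x
      simpa using hB x
    simp [this]
  · let V : X →ₗᵢ[ℂ] Y := ⟨((c : ℂ)⁻¹) • B, fun x => by
      simp [norm_smul, hB, abs_of_pos hc]
      field_simp⟩
    have h : B = (c : ℂ) • V.toLinearMap := by
      have : (c : ℂ) ≠ 0 := by exact_mod_cast hc.ne'
      ext x
      simp [V, this]
    have h2 := (V.lTensor H).norm_map z
    rw [LinearIsometry.lTensor_apply] at h2
    rw [h, LinearMap.lTensor_smul, LinearMap.smul_apply, norm_smul, h2]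
    simp [abs_of_pos hc]

/-- Right tensoring with `η` as a scaled isometry `H^{⊗ n} → H^{⊗ (n + 1)}`. -/
def tensorRightAux (η : H) : (n : ℕ) →
    {B : tensorPow H n →L[ℂ] tensorPow H (n + 1) // ∀ x, ‖B x‖ = ‖η‖ * ‖x‖}
  | 0 => ⟨tensorLeft η 0, norm_tensorLeft_apply η 0⟩
  | n + 1 =>
    let B := tensorRightAux η n
    have hB := norm_lTensor_of_norm_eq (H := H) B.1.toLinearMap ‖η‖ (norm_nonneg _) B.2
    let L : (H ⊗[ℂ] tensorPow H n) →L[ℂ] (H ⊗[ℂ] tensorPow H (n + 1)) :=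
      (B.1.toLinearMap.lTensor H).mkContinuous ‖η‖ (fun z => (hB z).le)
    ⟨L.completion, fun x => by
      induction x using UniformSpace.Completion.induction_on with
      | hp => exact isClosed_eq (by fun_prop) (by fun_prop)
      | ih a =>
        have h1 : L.completion (a : UniformSpace.Completion (H ⊗[ℂ] tensorPow H n)) = (L a :) := by
          exact UniformSpace.Completion.map_coe L.uniformContinuous a
        refine (congrArg _ h1).trans ?_
        refine (UniformSpace.Completion.norm_coe _).trans ?_
        refine (hB a).trans ?_
        congr 1
        exact (UniformSpace.Completion.norm_coe a).symm⟩

/-- The map `x ↦ x ⊗ η` from `H^{⊗ n}` to `H^{⊗ (n + 1)}`. -/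
def tensorRight (η : H) (n : ℕ) : tensorPow H n →L[ℂ] tensorPow H (n + 1) :=
  (tensorRightAux η n).1

theorem norm_tensorRight_apply (η : H) (n : ℕ) (x : tensorPow H n) :
    ‖tensorRight η n x‖ = ‖η‖ * ‖x‖ := (tensorRightAux η n).2 x

/-- Associativity of the tensor product; the recursion defining `tensorRight` acts under the
leftmost factor, so it holds by construction on elementary tensors. -/
theorem tensorRight_tensorLeft (η ξ : H) (n : ℕ) (x : tensorPow H n) :
    tensorRight η (n + 1) (tensorLeft ξ n x) = tensorLeft ξ (n + 1) (tensorRight η n x) := by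
  refine UniformSpace.Completion.map_coe (ContinuousLinearMap.uniformContinuous _) _ |>.trans ?_
  rfl

theorem mem_of_tensorLeft_mem {n : ℕ} (Z : Submodule ℂ (tensorPow H (n + 1)))
    (hZ : IsClosed (Z : Set (tensorPow H (n + 1)))) (h : ∀ ξ x, tensorLeft ξ n x ∈ Z)
    (y : tensorPow H (n + 1)) : y ∈ Z := by
  refine UniformSpace.Completion.induction_on
    (p := fun y : UniformSpace.Completion (H ⊗[ℂ] tensorPow H n) =>
      (show tensorPow H (n + 1) from y) ∈ Z) y hZ fun z => ?_
  induction z using TensorProduct.induction_on with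
  | zero => exact Z.zero_mem
  | tmul ξ x => exact h ξ x
  | add a b ha hb =>
    exact (congrArg (fun t : tensorPow H (n + 1) => t ∈ Z)
      (UniformSpace.Completion.coe_add a b)).mpr (Z.add_mem ha hb)

theorem tensorPow_succ_hom_ext {X : Type*} [NormedAddCommGroup X] [NormedSpace ℂ X] {n : ℕ}
    {f g : tensorPow H (n + 1) →L[ℂ] X}
    (h : ∀ ξ x, f (tensorLeft ξ n x) = g (tensorLeft ξ n x)) : f = g :=
  ContinuousLinearMap.ext fun y =>
    mem_of_tensorLeft_mem (LinearMap.eqLocus f.toLinearMap g.toLinearMap)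
      (isClosed_eq f.continuous g.continuous) h y

theorem inner_tensorLeft (ξ ξ' : H) (n : ℕ) (x x' : tensorPow H n) :
    inner ℂ (tensorLeft ξ n x) (tensorLeft ξ' n x') = inner ℂ ξ ξ' * inner ℂ x x' :=
  (UniformSpace.Completion.inner_coe _ _).trans (TensorProduct.inner_tmul ..)

theorem adjoint_tensorLeft (ξ ξ' : H) (n : ℕ) (x : tensorPow H n) :
    adjoint (tensorLeft ξ n) (tensorLeft ξ' n x) = inner ℂ ξ ξ' • x := by
  refine ext_inner_left ℂ fun y => ?_
  rw [ContinuousLinearMap.adjoint_inner_right, inner_tensorLeft, inner_smul_right]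

theorem tensorLeft_add (ξ ξ' : H) (n : ℕ) :
    tensorLeft (ξ + ξ') n = tensorLeft ξ n + tensorLeft ξ' n := by
  simp only [tensorLeft, map_add, ContinuousLinearMap.comp_add]
  rfl

theorem tensorLeft_smul (c : ℂ) (ξ : H) (n : ℕ) :
    tensorLeft (c • ξ) n = c • tensorLeft ξ n := by
  simp only [tensorLeft, map_smul, ContinuousLinearMap.comp_smul]
  rfl

/-- Removing the first letter commutes with appending a last one as soon as these letters are
distinct, hence the degree at least one. In degree zero they are the same letter, which is the
source of the vacuum term in `star_creation_mul_rightCreation`. -/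
theorem adjoint_tensorLeft_tensorRight (ξ η : H) (n : ℕ) (y : tensorPow H (n + 1)) :
    adjoint (tensorLeft ξ (n + 1)) (tensorRight η (n + 1) y) =
      tensorRight η n (adjoint (tensorLeft ξ n) y) := by
  have : adjoint (tensorLeft ξ (n + 1)) ∘L tensorRight η (n + 1) =
      tensorRight η n ∘L adjoint (tensorLeft ξ n) := by
    refine tensorPow_succ_hom_ext fun ξ' x => ?_
    simp [tensorRight_tensorLeft, adjoint_tensorLeft]
  exact congrArg (fun f => f y) this

theorem tensorRight_add (η η' : H) (n : ℕ) :
    tensorRight (η + η') n = tensorRight η n + tensorRight η' n := by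
  induction n with
  | zero => exact tensorLeft_add η η' 0
  | succ n ih =>
    refine tensorPow_succ_hom_ext fun ξ x => ?_
    simp [tensorRight_tensorLeft, ih]

theorem tensorRight_smul (c : ℂ) (η : H) (n : ℕ) :
    tensorRight (c • η) n = c • tensorRight η n := by
  induction n with
  | zero => exact tensorLeft_smul c η 0
  | succ n ih =>
    refine tensorPow_succ_hom_ext fun ξ x => ?_
    simp [tensorRight_tensorLeft, ih]

theorem adjoint_tensorRight (η η' : H) (n : ℕ) (x : tensorPow H n) :
    adjoint (tensorRight η n) (tensorRight η' n x) = inner ℂ η η' • x := by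
  induction n with
  | zero => exact adjoint_tensorLeft η η' 0 x
  | succ n ih =>
    have : adjoint (tensorRight η (n + 1)) ∘L tensorRight η' (n + 1) =
        inner ℂ η η' • ContinuousLinearMap.id ℂ _ := by
      refine tensorPow_succ_hom_ext fun ξ x => ?_
      refine ext_inner_left ℂ fun y => ?_
      simp only [ContinuousLinearMap.comp_apply, _root_.smul_apply,
        ContinuousLinearMap.id_apply]
      rw [ContinuousLinearMap.adjoint_inner_right, tensorRight_tensorLeft,
        ← ContinuousLinearMap.adjoint_inner_left, adjoint_tensorLeft_tensorRight,
        ← ContinuousLinearMap.adjoint_inner_right, ih, inner_smul_right, inner_smul_right,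
        ContinuousLinearMap.adjoint_inner_left]
    exact congrArg (fun f => f x) this

theorem mem_of_tensorRight_mem {n : ℕ} (Z : Submodule ℂ (tensorPow H (n + 1)))
    (hZ : IsClosed (Z : Set (tensorPow H (n + 1)))) (h : ∀ η x, tensorRight η n x ∈ Z)
    (y : tensorPow H (n + 1)) : y ∈ Z := by
  induction n with
  | zero => exact mem_of_tensorLeft_mem Z hZ h y
  | succ n ih =>
    refine mem_of_tensorLeft_mem Z hZ (fun ξ x => ?_) y
    -- The induction hypothesis applies to the preimage of Z under left tensoring, since left and
    -- right tensoring commute.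
    refine ih (Z.comap (tensorLeft ξ (n + 1)).toLinearMap)
      (hZ.preimage (tensorLeft ξ (n + 1)).continuous) (fun η x => ?_) x
    change tensorLeft ξ (n + 1) (tensorRight η n x) ∈ Z
    rw [← tensorRight_tensorLeft]
    exact h _ _

/-- The right creation operator, sending `e₁ ⊗ ⋯ ⊗ eₙ` to `e₁ ⊗ ⋯ ⊗ eₙ ⊗ η`. -/
def rightCreation (η : H) : Fock H →L[ℂ] Fock H :=
  shiftOp (tensorRight η) ‖η‖ (fun n x => (norm_tensorRight_apply η n x).le)

theorem rightCreation_single (η : H) (n : ℕ) (x : tensorPow H n) :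
    rightCreation η (lp.single 2 n x) = lp.single 2 (n + 1) (tensorRight η n x) :=
  shiftOp_single _ _ _ _ _

theorem star_creation_apply (ξ : H) (v : Fock H) (n : ℕ) :
    star (creation ξ) v n = adjoint (tensorLeft ξ n) (v (n + 1)) :=
  star_shiftOp_apply _ _ _ _ _

theorem star_rightCreation_apply (η : H) (v : Fock H) (n : ℕ) :
    star (rightCreation η) v n = adjoint (tensorRight η n) (v (n + 1)) :=
  star_shiftOp_apply _ _ _ _ _

theorem star_creation_mul_creation (ξ ξ' : H) :
    star (creation ξ) * creation ξ' = inner ℂ ξ ξ' • (1 : Fock H →L[ℂ] Fock H) := by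
  ext v n
  change star (creation ξ) (creation ξ' v) n = inner ℂ ξ ξ' • v n
  rw [star_creation_apply]
  exact adjoint_tensorLeft ξ ξ' n (v n)

theorem creation_mul_rightCreation (ξ η : H) :
    creation ξ * rightCreation η = rightCreation η * creation ξ := by
  ext v n
  match n with
  | 0 => rfl
  | 1 =>
    change tensorLeft ξ 0 0 = tensorRight η 0 0
    simp
  | n + 2 => exact (tensorRight_tensorLeft η ξ n (v n)).symm

theorem creation_add (ξ ξ' : H) : creation (ξ + ξ') = creation ξ + creation ξ' := by
  ext v n
  cases n with
  | zero => exact (add_zero (0 : tensorPow H 0)).symm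
  | succ n => exact congrArg (fun f => f (v n)) (tensorLeft_add ξ ξ' n)

theorem creation_smul (c : ℂ) (ξ : H) : creation (c • ξ) = c • creation ξ := by
  ext v n
  cases n with
  | zero => exact (smul_zero c).symm
  | succ n => exact congrArg (fun f => f (v n)) (tensorLeft_smul c ξ n)

/-- The orthogonal projection onto the line spanned by the vacuum vector. -/
def vacuumProj : Fock H →L[ℂ] Fock H :=
  diagOp (fun n => if n = 0 then 1 else 0) 1 (fun n => by split_ifs <;> simp)

theorem star_creation_mul_rightCreation (ξ η : H) :
    star (creation ξ) * rightCreation η =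
      rightCreation η * star (creation ξ) + inner ℂ ξ η • vacuumProj := by
  ext v n
  change star (creation ξ) (rightCreation η v) n =
    rightCreation η (star (creation ξ) v) n +
      inner ℂ ξ η • ((if n = 0 then 1 else 0 : ℂ) • v n)
  rw [star_creation_apply]
  cases n with
  | zero =>
    refine (adjoint_tensorLeft ξ η 0 (v 0)).trans ?_
    rw [if_pos rfl, one_smul]
    exact (zero_add (inner ℂ ξ η • v 0)).symm
  | succ n =>
    rw [if_neg (by omega), zero_smul, smul_zero, add_zero]
    refine (adjoint_tensorLeft_tensorRight ξ η n (v (n + 1))).trans ?_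
    rw [← star_creation_apply]
    rfl

theorem isSelfAdjoint_vacuumProj : star (vacuumProj : Fock H →L[ℂ] Fock H) = vacuumProj := by
  rw [ContinuousLinearMap.star_eq_adjoint]
  refine ((ContinuousLinearMap.eq_adjoint_iff _ _).2 fun v w => ?_).symm
  rw [lp.inner_eq_tsum, lp.inner_eq_tsum]
  congr 1
  ext n
  simp only [vacuumProj, diagOp_apply]
  split_ifs <;> simp

end TensorRight

end FreeArakiWoods

end

noncomputable section


namespace FreeArakiWoods

open ContinuousLinearMap (adjoint)

/-! ### Parseval's identity for removing letters on the right -/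

section Parseval

variable {H : Type u} [NormedAddCommGroup H] [InnerProductSpace ℂ H]

/-- `tensorRight` as a continuous linear map in the appended vector. -/
def tensorRightL (n : ℕ) (x : tensorPow H n) : H →L[ℂ] tensorPow H (n + 1) :=
  LinearMap.mkContinuous
    { toFun := fun η => tensorRight η n x
      map_add' := fun η η' => by rw [tensorRight_add]; rfl
      map_smul' := fun c η => by rw [tensorRight_smul]; rfl }
    ‖x‖ (fun η => ((norm_tensorRight_apply η n x).trans (mul_comm _ _)).le)

theorem mem_of_mem_dense_submodule {X : Type*} [NormedAddCommGroup X] [NormedSpace ℂ X]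
    {s : Set H} (hs : Dense (Submodule.span ℂ s : Set H))
    (f : H →L[ℂ] X) (Z : Submodule ℂ X) (hZ : IsClosed (Z : Set X)) (h : ∀ η ∈ s, f η ∈ Z) (η : H) :
    f η ∈ Z := by
  have h1 : Submodule.span ℂ s ≤ Z.comap f.toLinearMap := Submodule.span_le.2 h
  have h2 : IsClosed ((Z.comap f.toLinearMap : Submodule ℂ H) : Set H) :=
    hZ.preimage f.continuous
  exact (h2.closure_subset_iff.2 h1) (hs η)

variable {ι : Type*} (b : HilbertBasis ι ℂ H)

/-- H^{⊗(n+1)} is the Hilbert sum of the ranges of the isometries x ↦ x ⊗ bᵢ, and their adjoints are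
the coordinate maps. -/
theorem hasSum_norm_sq_adjoint_tensorRight (n : ℕ) (v : tensorPow H (n + 1)) :
    HasSum (fun i => ‖adjoint (tensorRight (b i) n) v‖ ^ 2) (‖v‖ ^ 2) := by
  classical
  let V : ι → tensorPow H n →ₗᵢ[ℂ] tensorPow H (n + 1) := fun i =>
    ⟨(tensorRight (b i) n).toLinearMap, fun x => by
      have := norm_tensorRight_apply (b i) n x
      rw [b.orthonormal.1 i, one_mul] at this
      exact this⟩
  have hV : IsHilbertSum ℂ (fun _ : ι => tensorPow H n) V := by
    refine IsHilbertSum.mk ?_ ?_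
    · intro i j hij x y
      change inner ℂ (tensorRight (b i) n x) (tensorRight (b j) n y) = 0
      rw [← ContinuousLinearMap.adjoint_inner_right, adjoint_tensorRight, b.orthonormal.2 hij]
      simp
    · intro y _
      refine mem_of_tensorRight_mem _ (Submodule.isClosed_topologicalClosure _) (fun η x => ?_) y
      refine mem_of_mem_dense_submodule (s := Set.range b) ?_ (tensorRightL n x) _
        (Submodule.isClosed_topologicalClosure _) ?_ η
      · exact Submodule.dense_iff_topologicalClosure_eq_top.2 b.dense_span
      · rintro _ ⟨i, rfl⟩
        refine Submodule.le_topologicalClosure _ ?_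
        exact Submodule.mem_iSup_of_mem i ⟨x, rfl⟩
  have h1 : ∀ i, hV.linearIsometryEquiv v i = adjoint (tensorRight (b i) n) v := fun i => by
    refine ext_inner_left ℂ fun x => ?_
    refine (lp.inner_single_left (𝕜 := ℂ) (G := fun _ : ι => tensorPow H n) i x
      (hV.linearIsometryEquiv v)).symm.trans ?_
    rw [ContinuousLinearMap.adjoint_inner_right,
      ← hV.linearIsometryEquiv.symm.inner_map_map, LinearIsometryEquiv.symm_apply_apply,
      hV.linearIsometryEquiv_symm_apply_single]
    rfl
  have h2 := lp.hasSum_norm (p := 2) (by norm_num) (hV.linearIsometryEquiv v)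
  simpa [h1] using h2

theorem tsum_enorm_sq_adjoint_tensorRight (n : ℕ) (v : tensorPow H (n + 1)) :
    ∑' i, ‖adjoint (tensorRight (b i) n) v‖ₑ ^ 2 = ‖v‖ₑ ^ 2 := by
  have h := hasSum_norm_sq_adjoint_tensorRight b n v
  have h2 := ENNReal.ofReal_tsum_of_nonneg (fun i => by positivity) h.summable
  rw [h.tsum_eq] at h2
  simpa [ENNReal.ofReal_pow, ofReal_norm] using h2.symm

/-- The adjoint of right multiplication by a word in the basis vectors. -/
def wordAnn : {d : ℕ} → (Fin d → ι) → Fock H →L[ℂ] Fock H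
  | 0, _ => 1
  | _ + 1, I => wordAnn (Fin.tail I) * star (rightCreation (b (I 0)))

theorem tsum_enorm_sq_wordAnn (d n : ℕ) (v : Fock H) :
    ∑' I : Fin d → ι, ‖wordAnn b I v n‖ₑ ^ 2 = ‖v (n + d)‖ₑ ^ 2 := by
  induction d generalizing v with
  | zero =>
    rw [tsum_fintype]
    simp [wordAnn]
  | succ d ih =>
    rw [← (Fin.consEquiv (fun _ : Fin (d + 1) => ι)).tsum_eq, ENNReal.tsum_prod']
    have h : ∀ (i : ι) (I : Fin d → ι),
        wordAnn b (Fin.consEquiv (fun _ : Fin (d + 1) => ι) (i, I)) v =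
          wordAnn b I (star (rightCreation (b i)) v) := fun i I => rfl
    simp_rw [h, ih, star_rightCreation_apply]
    exact tsum_enorm_sq_adjoint_tensorRight b (n + d) (v (n + d + 1))

end Parseval

/-! ### Square-summable families of operators as columns -/

section LpENorm

theorem lp_enorm_sq {ι : Type*} {X : ι → Type*} [∀ i, NormedAddCommGroup (X i)] (f : lp X 2) :
    ‖f‖ₑ ^ 2 = ∑' i, ‖f i‖ₑ ^ 2 := by
  have h := ENNReal.ofReal_tsum_of_nonneg (fun i => by positivity) (lp_summable_norm_sq f)
  rw [← lp_norm_sq] at h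
  simpa [ENNReal.ofReal_pow, ofReal_norm] using h

theorem lp_norm_le_of_tsum_enorm_sq_le {ι : Type*} {X : ι → Type*} [∀ i, NormedAddCommGroup (X i)]
    (f : lp X 2) {D : ℝ} (hD : 0 ≤ D) (h : ∑' i, ‖f i‖ₑ ^ 2 ≤ ENNReal.ofReal D ^ 2) :
    ‖f‖ ≤ D := by
  rw [← lp_enorm_sq, ← ofReal_norm] at h
  have h2 := (ENNReal.pow_right_strictMono two_ne_zero).le_iff_le.1 h
  exact (ENNReal.ofReal_le_ofReal_iff hD).1 h2

theorem memℓp_two_of_tsum_enorm_ne_top {ι : Type*} {X : ι → Type*} [∀ i, NormedAddCommGroup (X i)]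
    (f : ∀ i, X i) (h : ∑' i, ‖f i‖ₑ ^ 2 ≠ ⊤) : Memℓp f 2 := by
  refine memℓp_gen ?_
  have := ENNReal.summable_toReal h
  simpa using this

variable {ι : Type*} {X Y : Type*} [NormedAddCommGroup X] [NormedSpace ℂ X]
  [NormedAddCommGroup Y] [NormedSpace ℂ Y]

/-- The column operator `v ↦ (A i v)ᵢ` of a square-summable family of operators. -/
def columnOp (A : ι → X →L[ℂ] Y) (C : ℝ) (hC : 0 ≤ C)
    (hA : ∀ v, ∑' i, ‖A i v‖ₑ ^ 2 ≤ ENNReal.ofReal C ^ 2 * ‖v‖ₑ ^ 2) :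
    X →L[ℂ] lp (fun _ : ι => Y) 2 :=
  LinearMap.mkContinuous
    { toFun := fun v => ⟨fun i => A i v, memℓp_two_of_tsum_enorm_ne_top _
        (ne_top_of_le_ne_top (ENNReal.mul_ne_top (by simp) (by simp)) (hA v))⟩
      map_add' := fun v w => by
        ext i
        exact map_add (A i) v w
      map_smul' := fun c v => by
        ext i
        exact map_smul (A i) c v } C (fun v => by
      refine lp_norm_le_of_tsum_enorm_sq_le _ (by positivity) ((hA v).trans_eq ?_)
      rw [ENNReal.ofReal_mul hC, mul_pow, ofReal_norm])

theorem norm_columnOp_le (A : ι → X →L[ℂ] Y) (C : ℝ) (hC) (hA) : ‖columnOp A C hC hA‖ ≤ C :=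
  LinearMap.mkContinuous_norm_le _ hC _

end LpENorm

/-! ### Spatial realisation of the Toeplitz coaction on the Fock space -/

section Coaction

variable {H : Type u} [NormedAddCommGroup H] [InnerProductSpace ℂ H]
  {ι : Type*} (b : HilbertBasis ι ℂ H)

/-- The pairs (n, m) are split into n ≤ m, with d = m - n, and n > m, with c = n - m - 1. The two
kinds of components of the coaction correspond to these regions. -/
theorem tsum_add_tsum_triangle (x y : ℕ → ENNReal) :
    (∑' d, ∑' n, x n * y (n + d)) + ∑' c, ∑' n, x (n + (c + 1)) * y n =
      (∑' n, x n) * ∑' n, y n := by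
  let e : (ℕ × ℕ) ⊕ (ℕ × ℕ) ≃ ℕ × ℕ :=
    { toFun := Sum.elim (fun p => (p.2, p.2 + p.1)) (fun p => (p.2 + (p.1 + 1), p.2))
      invFun := fun q => if q.1 ≤ q.2 then Sum.inl (q.2 - q.1, q.1) else
        Sum.inr (q.1 - q.2 - 1, q.2)
      left_inv := by
        rintro (⟨d, n⟩ | ⟨d, n⟩)
        · simp
        · simp
      right_inv := by
        rintro ⟨n, m⟩
        by_cases h : n ≤ m
        · simp [h]
        · simp [h]
          omega }
  calc _ = ∑' p : (ℕ × ℕ) ⊕ (ℕ × ℕ), x (e p).1 * y (e p).2 := by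
        rw [Summable.tsum_sum ENNReal.summable ENNReal.summable, ENNReal.tsum_prod',
          ENNReal.tsum_prod']
        rfl
    _ = ∑' q : ℕ × ℕ, x q.1 * y q.2 := e.tsum_eq (fun q : ℕ × ℕ => x q.1 * y q.2)
    _ = _ := by
        rw [ENNReal.tsum_prod']
        simp_rw [ENNReal.tsum_mul_left, ENNReal.tsum_mul_right]

/-- The square-summable sequences. -/
abbrev ellTwo : Type := lp (fun _ : ℕ => ℂ) 2

theorem ellTwo_norm_apply_le (β : ellTwo) (n : ℕ) : ‖β n‖ ≤ ‖β‖ :=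
  lp.norm_apply_le_norm (by norm_num) β n

theorem star_unilateralShift_apply (β : ellTwo) (n : ℕ) :
    star unilateralShift β n = β (n + 1) := by
  refine (star_shiftOp_apply _ _ _ β n).trans ?_
  rw [← ContinuousLinearMap.star_eq_adjoint]
  exact congrArg (fun f : ℂ →L[ℂ] ℂ => f (β (n + 1))) (star_one (ℂ →L[ℂ] ℂ))

/-- The components of the isometry `F(H) ⊗ ℓ² → ⨁ F(H)` that turns `ℓ(e) ⊗ S` into a multiple of
`ℓ(e)`, with the second tensor factor fixed to be `β`. -/
def coactionComp (β : ellTwo) : (Σ d, (Fin d → ι)) ⊕ ℕ → Fock H →L[ℂ] Fock H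
  | Sum.inl I => diagOp β ‖β‖ (ellTwo_norm_apply_le β) * wordAnn b I.2
  | Sum.inr c => diagOp (fun n => β (n + (c + 1))) ‖β‖ (fun _ => ellTwo_norm_apply_le β _)

/-- The pair of degrees (n, m) contributes |βₙ|²‖v_m‖². For n ≤ m it arises by removing the last m -
n letters of v_m in all possible ways, by Parseval; for n > m it comes from the diagonal component
with c = n - m - 1. -/
theorem tsum_enorm_sq_coactionComp (β : ellTwo) (v : Fock H) :
    ∑' i, ‖coactionComp b β i v‖ₑ ^ 2 = ‖β‖ₑ ^ 2 * ‖v‖ₑ ^ 2 := by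
  rw [Summable.tsum_sum ENNReal.summable ENNReal.summable, lp_enorm_sq β, lp_enorm_sq v,
    ← tsum_add_tsum_triangle, ENNReal.tsum_sigma']
  congr 1
  · congr 1
    ext d
    simp_rw [lp_enorm_sq]
    rw [ENNReal.tsum_comm]
    congr 1
    ext n
    rw [← tsum_enorm_sq_wordAnn b, ← ENNReal.tsum_mul_left]
    congr 1
    ext I
    change ‖β n • wordAnn b I v n‖ₑ ^ 2 = _
    rw [enorm_smul, mul_pow]
  · congr 1
    ext c
    rw [lp_enorm_sq]
    congr 1
    ext n
    change ‖β (n + (c + 1)) • v n‖ₑ ^ 2 = _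
    rw [enorm_smul, mul_pow]

theorem star_creation_mul_wordAnn (ξ : H) {d : ℕ} (I : Fin d → ι) :
    star (creation ξ) * wordAnn b I = wordAnn b I * star (creation ξ) := by
  induction d with
  | zero => simp [wordAnn]
  | succ d ih =>
    have h := congrArg star (creation_mul_rightCreation ξ (b (I 0)))
    rw [star_mul, star_mul] at h
    rw [wordAnn, ← mul_assoc, ih, mul_assoc, ← h, mul_assoc]

/-- Annihilation acts on the first letter and commutes with removing last letters, while the
diagonal weight depends on the degree and is therefore shifted. -/
theorem star_creation_coactionComp (ξ : H) (β : ellTwo) (i) (v : Fock H) :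
    star (creation ξ) (coactionComp b β i v) =
      coactionComp b (star unilateralShift β) i (star (creation ξ) v) := by
  rcases i with ⟨d, I⟩ | c
  · have h := congrArg (fun f => f v) (star_creation_mul_wordAnn b ξ I)
    change star (creation ξ) (wordAnn b I v) = wordAnn b I (star (creation ξ) v) at h
    ext n
    change star (creation ξ) (diagOp β ‖β‖ (ellTwo_norm_apply_le β) (wordAnn b I v)) n =
      star unilateralShift β n • wordAnn b I (star (creation ξ) v) n
    rw [star_unilateralShift_apply, ← h]
    exact congrArg (fun w : Fock H => w n) (star_shiftOp_diagOp _ _ _ _ _ _ (wordAnn b I v))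
  · ext n
    change star (creation ξ) (diagOp (fun n => β (n + (c + 1))) ‖β‖
      (fun _ => ellTwo_norm_apply_le β _) v) n =
      star unilateralShift β (n + (c + 1)) • star (creation ξ) v n
    rw [star_unilateralShift_apply, add_right_comm n (c + 1) 1]
    exact congrArg (fun w : Fock H => w n) (star_shiftOp_diagOp _ _ _ _ _ _ v)

/-- The isometry `F(H) ⊗ ℓ² → ⨁ F(H)` that turns `ℓ(e) ⊗ S` into a multiple of `ℓ(e)`, applied to
`v ⊗ β`. -/
def coaction (β : ellTwo) :
    Fock H →L[ℂ] lp (fun _ : (Σ d, (Fin d → ι)) ⊕ ℕ => Fock H) 2 :=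
  columnOp (coactionComp b β) ‖β‖ (norm_nonneg _) (fun v => by
    rw [tsum_enorm_sq_coactionComp, ofReal_norm])

/-- Polarisation: the values at x + y and x + iy determine s(x, y). -/
theorem eq_zero_of_sesq_diag {X : Type*} [AddCommGroup X] [Module ℂ X]
    (s : X →ₗ⋆[ℂ] X →ₗ[ℂ] ℂ) (h : ∀ x, s x x = 0) (x y : X) : s x y = 0 := by
  have h1 := h (x + y)
  have h2 := h (x + Complex.I • y)
  simp [h] at h1 h2
  have h3 : Complex.I * (s x y - s y x) = 0 := by linear_combination h2
  have h4 := (mul_eq_zero.1 h3).resolve_left Complex.I_ne_zero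
  linear_combination (h1 + h4) / 2

theorem inner_coaction_same (β : ellTwo) (v w : Fock H) :
    inner ℂ (coaction b β w) (coaction b β v) = inner ℂ β β * inner ℂ w v := by
  have key : ∀ x : Fock H, ‖coaction b β x‖ = ‖β‖ * ‖x‖ := fun x => by
    have h := lp_enorm_sq (coaction b β x)
    have h' : ∑' i, ‖coaction b β x i‖ₑ ^ 2 = ‖β‖ₑ ^ 2 * ‖x‖ₑ ^ 2 :=
      tsum_enorm_sq_coactionComp b β x
    rw [h', ← mul_pow] at h
    have h2 := (ENNReal.pow_right_strictMono two_ne_zero).injective h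
    have h3 := congrArg ENNReal.toReal h2
    simpa using h3
  have := eq_zero_of_sesq_diag
    (((innerₛₗ ℂ).comp (coaction b β).toLinearMap).compl₂ (coaction b β).toLinearMap -
      (inner ℂ β β : ℂ) • innerₛₗ ℂ) (fun x => by
      simp [inner_self_eq_norm_sq_to_K, key, mul_pow]) w v
  simpa [sub_eq_zero] using this

theorem coactionComp_add (β β' : ellTwo) (i) (v : Fock H) :
    coactionComp b (β + β') i v = coactionComp b β i v + coactionComp b β' i v := by
  rcases i with ⟨d, I⟩ | c
  · ext n
    exact add_smul (β n) (β' n) (wordAnn b I v n)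
  · ext n
    exact add_smul (β _) (β' _) (v n)

theorem coactionComp_smul (a : ℂ) (β : ellTwo) (i) (v : Fock H) :
    coactionComp b (a • β) i v = a • coactionComp b β i v := by
  rcases i with ⟨d, I⟩ | c
  · ext n
    exact mul_smul a (β n) (wordAnn b I v n)
  · ext n
    exact mul_smul a (β _) (v n)

/-- A second polarisation, in the ℓ² variable; `inner_coaction_same` has already polarised the norm
identity in the Fock space variable. -/
theorem inner_coaction (α β : ellTwo) (v w : Fock H) :
    inner ℂ (coaction b α w) (coaction b β v) = inner ℂ α β * inner ℂ w v := by
  let C : Fock H → ellTwo →ₗ[ℂ] lp (fun _ : (Σ d, (Fin d → ι)) ⊕ ℕ => Fock H) 2 := fun v =>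
    { toFun := fun β => coaction b β v
      map_add' := fun β β' => by
        ext i : 2
        exact coactionComp_add b β β' i v
      map_smul' := fun a β => by
        ext i : 2
        exact coactionComp_smul b a β i v }
  have := eq_zero_of_sesq_diag
    (((innerₛₗ ℂ).comp (C w)).compl₂ (C v) - (inner ℂ w v : ℂ) • innerₛₗ ℂ) (fun β => by
      have := inner_coaction_same b β v w
      simp [C, this, mul_comm]) α β
  simpa [sub_eq_zero, C, mul_comm] using this

theorem hasSum_inner_coactionComp (α β : ellTwo) (v w : Fock H) :
    HasSum (fun i => inner ℂ (coactionComp b α i w) (coactionComp b β i v))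
      (inner ℂ α β * inner ℂ w v) := by
  rw [← inner_coaction b]
  exact lp.hasSum_inner _ _

end Coaction

end FreeArakiWoods

end

noncomputable section


namespace FreeArakiWoods

set_option linter.unusedSectionVars false

open ContinuousLinearMap (adjoint)

/-! ### Matrices of operators -/

section MatrixNorm

variable {K : Type*} [NormedAddCommGroup K] [InnerProductSpace ℂ K] [CompleteSpace K]
  {n : Type*} [Fintype n]

/-- The operator on `K^n` given by a matrix of operators. -/
def matrixOp (M : CStarMatrix n n (K →L[ℂ] K)) :
    PiLp 2 (fun _ : n => K) →L[ℂ] PiLp 2 (fun _ : n => K) :=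
  (PiLp.continuousLinearEquiv 2 ℂ (fun _ : n => K)).symm.toContinuousLinearMap ∘L
    ContinuousLinearMap.pi fun i => ∑ j, M i j ∘L PiLp.proj 2 (fun _ : n => K) j

theorem matrixOp_apply (M : CStarMatrix n n (K →L[ℂ] K)) (f : PiLp 2 (fun _ : n => K)) (i : n) :
    matrixOp M f i = ∑ j, M i j (f j) := by
  change (∑ j, M i j ∘L PiLp.proj 2 (fun _ : n => K) j) f = _
  simp

theorem inner_matrixOp (M : CStarMatrix n n (K →L[ℂ] K)) (f g : PiLp 2 (fun _ : n => K)) :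
    inner ℂ g (matrixOp M f) = ∑ i, ∑ j, inner ℂ (g i) (M i j (f j)) := by
  simp [PiLp.inner_apply, matrixOp_apply, inner_sum]

/-- The action of matrices of operators as a star homomorphism. -/
def matrixHom : CStarMatrix n n (K →L[ℂ] K) →⋆ₙₐ[ℂ]
    (PiLp 2 (fun _ : n => K) →L[ℂ] PiLp 2 (fun _ : n => K)) where
  toFun := matrixOp
  map_smul' c M := by
    ext f i
    change matrixOp (c • M) f i = c • matrixOp M f i
    simp [matrixOp_apply, Finset.smul_sum]
  map_zero' := by
    ext f i
    change matrixOp 0 f i = 0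
    simp [matrixOp_apply]
  map_add' M N := by
    ext f i
    change matrixOp (M + N) f i = matrixOp M f i + matrixOp N f i
    simp [matrixOp_apply, Finset.sum_add_distrib]
  map_mul' M N := by
    ext f i
    change matrixOp (M * N) f i = matrixOp M (matrixOp N f) i
    simp only [matrixOp_apply, CStarMatrix.mul_apply, _root_.sum_apply, map_sum]
    rw [Finset.sum_comm]
    rfl
  map_star' M := by
    rw [ContinuousLinearMap.star_eq_adjoint]
    refine (ContinuousLinearMap.eq_adjoint_iff _ _).2 fun f g => ?_
    rw [← inner_conj_symm, inner_matrixOp, inner_matrixOp, map_sum, Finset.sum_comm]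
    refine Finset.sum_congr rfl fun i _ => ?_
    rw [map_sum]
    refine Finset.sum_congr rfl fun j _ => ?_
    rw [CStarMatrix.star_apply, ContinuousLinearMap.star_eq_adjoint,
      ContinuousLinearMap.adjoint_inner_right, inner_conj_symm]

/-- An injective star homomorphism between C*-algebras is isometric, and a matrix is recovered from
its action on vectors supported at one index. -/
theorem norm_matrixOp (M : CStarMatrix n n (K →L[ℂ] K)) : ‖matrixOp M‖ = ‖M‖ := by
  classical
  refine NonUnitalStarAlgHom.norm_map (matrixHom (K := K) (n := n)) (fun M N h => ?_) M
  ext i j v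
  have := congrArg (fun T => T (PiLp.single 2 j v) i) h
  change matrixOp M (PiLp.single 2 j v) i = matrixOp N (PiLp.single 2 j v) i at this
  simpa [matrixOp_apply, PiLp.single_apply, apply_ite, Finset.sum_ite_eq] using this

theorem norm_inner_matrixOp_le (M : CStarMatrix n n (K →L[ℂ] K)) (f g : PiLp 2 (fun _ : n => K)) :
    ‖inner ℂ g (matrixOp M f)‖ ≤ ‖M‖ * ‖g‖ * ‖f‖ := by
  refine (norm_inner_le_norm _ _).trans ?_
  rw [← norm_matrixOp, mul_comm ‖matrixOp M‖, mul_assoc]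
  gcongr
  exact (matrixOp M).le_opNorm f

theorem norm_le_of_inner_matrixOp_le (M : CStarMatrix n n (K →L[ℂ] K)) {C : ℝ} (hC : 0 ≤ C)
    (h : ∀ f g : PiLp 2 (fun _ : n => K), ‖inner ℂ g (matrixOp M f)‖ ≤ C * ‖g‖ * ‖f‖) :
    ‖M‖ ≤ C := by
  rw [← norm_matrixOp]
  refine ContinuousLinearMap.opNorm_le_bound _ hC fun f => ?_
  have h1 := h f (matrixOp M f)
  rw [inner_self_eq_norm_sq_to_K] at h1
  rcases (norm_nonneg (matrixOp M f)).eq_or_lt with h0 | h0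
  · rw [← h0]
    positivity
  · refine le_of_mul_le_mul_left ?_ h0
    simp only [Complex.coe_algebraMap, norm_pow, Complex.norm_real, norm_norm] at h1
    linarith

end MatrixNorm

/-! ### Amplifications -/

section Amplification

variable {K : Type*} [NormedAddCommGroup K] [InnerProductSpace ℂ K] [CompleteSpace K]
  (κ : Type*)

/-- The amplification of an operator to a Hilbert sum of copies of the space. -/
def amp (x : K →L[ℂ] K) : lp (fun _ : κ => K) 2 →L[ℂ] lp (fun _ : κ => K) 2 :=
  lp.mapCLM 2 (fun _ => x) (norm_nonneg x) (fun _ => le_rfl)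

variable {κ}

theorem amp_apply (x : K →L[ℂ] K) (f : lp (fun _ : κ => K) 2) (i : κ) : amp κ x f i = x (f i) := rfl

theorem amp_star (x : K →L[ℂ] K) : amp κ (star x) = star (amp κ x) := by
  rw [ContinuousLinearMap.star_eq_adjoint]
  refine (ContinuousLinearMap.eq_adjoint_iff _ _).2 fun f g => ?_
  rw [lp.inner_eq_tsum, lp.inner_eq_tsum]
  refine tsum_congr fun i => ?_
  change inner ℂ (star x (f i)) (g i) = inner ℂ (f i) (x (g i))
  rw [ContinuousLinearMap.star_eq_adjoint, ContinuousLinearMap.adjoint_inner_left]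

variable (κ) in
/-- The amplification as a star homomorphism. -/
def ampHom : (K →L[ℂ] K) →⋆ₙₐ[ℂ] (lp (fun _ : κ => K) 2 →L[ℂ] lp (fun _ : κ => K) 2) where
  toFun := amp κ
  map_smul' c x := by
    ext f i
    rfl
  map_zero' := by
    ext f i
    rfl
  map_add' x y := by
    ext f i
    rfl
  map_mul' x y := by
    ext f i
    rfl
  map_star' := amp_star

/-- The map `x ↦ P* (x ⊗ 1) Q`. -/
def ampConj (P Q : K →L[ℂ] lp (fun _ : κ => K) 2) : (K →L[ℂ] K) →ₗ[ℂ] (K →L[ℂ] K) where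
  toFun x := adjoint P ∘L amp κ x ∘L Q
  map_add' x y := by
    ext v
    exact map_add (adjoint P) (amp κ x (Q v)) (amp κ y (Q v))
  map_smul' c x := by
    ext v
    exact map_smul (adjoint P) c (amp κ x (Q v))

theorem ampConj_apply (P Q : K →L[ℂ] lp (fun _ : κ => K) 2) (x : K →L[ℂ] K) (v : K) :
    ampConj P Q x v = adjoint P (amp κ x (Q v)) := rfl

theorem inner_ampConj (P Q : K →L[ℂ] lp (fun _ : κ => K) 2) (x : K →L[ℂ] K) (v w : K) :
    inner ℂ w (ampConj P Q x v) = inner ℂ (P w) (amp κ x (Q v)) := by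
  rw [ampConj_apply, ContinuousLinearMap.adjoint_inner_right]

theorem hasSum_inner_ampConj (P Q : K →L[ℂ] lp (fun _ : κ => K) 2) (x : K →L[ℂ] K) (v w : K) :
    HasSum (fun i => inner ℂ (P w i) (x (Q v i))) (inner ℂ w (ampConj P Q x v)) := by
  rw [inner_ampConj]
  exact lp.hasSum_inner _ _

theorem norm_ampConj_le (P Q : K →L[ℂ] lp (fun _ : κ => K) 2) (x : K →L[ℂ] K) :
    ‖ampConj P Q x‖ ≤ ‖P‖ * ‖Q‖ * ‖x‖ := by
  have h1 : ‖amp κ x‖ ≤ ‖x‖ := NonUnitalStarAlgHom.norm_apply_le (ampHom (K := K) κ) x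
  calc ‖adjoint P ∘L amp κ x ∘L Q‖ ≤ ‖adjoint P‖ * (‖amp κ x‖ * ‖Q‖) :=
        (ContinuousLinearMap.opNorm_comp_le _ _).trans
          (by gcongr; exact ContinuousLinearMap.opNorm_comp_le _ _)
    _ ≤ ‖P‖ * (‖x‖ * ‖Q‖) := by
        rw [LinearIsometryEquiv.norm_map]
        gcongr
    _ = _ := by ring

/-- Amplification is a star homomorphism, hence contractive at every matrix level; P and Q act
diagonally on the vectors of K^n. -/
theorem norm_matrix_ampConj_le (P Q : K →L[ℂ] lp (fun _ : κ => K) 2) {n : Type*} [Fintype n]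
    (M : CStarMatrix n n (K →L[ℂ] K)) :
    ‖CStarMatrix.ofMatrix (Matrix.of fun i j => ampConj P Q (M i j))‖ ≤ ‖P‖ * ‖Q‖ * ‖M‖ := by
  classical
  refine norm_le_of_inner_matrixOp_le _ (by positivity) fun f g => ?_
  let N : CStarMatrix n n (lp (fun _ : κ => K) 2 →L[ℂ] lp (fun _ : κ => K) 2) :=
    CStarMatrix.mapₙₐ (ampHom (K := K) κ) M
  have hN : ‖N‖ ≤ ‖M‖ :=
    NonUnitalStarAlgHom.norm_apply_le (CStarMatrix.mapₙₐ (n := n) (ampHom (K := K) κ)) M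
  have key : ∀ (R : K →L[ℂ] lp (fun _ : κ => K) 2) (f : PiLp 2 (fun _ : n => K)),
      ‖WithLp.toLp 2 (fun i => R (f i))‖ ≤ ‖R‖ * ‖f‖ := fun R f => by
    refine abs_le_of_sq_le_sq' ?_ (by positivity) |>.2
    rw [mul_pow, PiLp.norm_sq_eq_of_L2, PiLp.norm_sq_eq_of_L2, Finset.mul_sum]
    refine Finset.sum_le_sum fun i _ => ?_
    rw [← mul_pow]
    exact pow_le_pow_left₀ (norm_nonneg _) (R.le_opNorm _) 2
  have h : inner ℂ g (matrixOp
      (CStarMatrix.ofMatrix (Matrix.of fun i j => ampConj P Q (M i j))) f) =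
      inner ℂ (WithLp.toLp 2 (fun i => P (g i))) (matrixOp N (WithLp.toLp 2 (fun i => Q (f i)))) := by
    rw [inner_matrixOp, inner_matrixOp]
    refine Finset.sum_congr rfl fun i _ => Finset.sum_congr rfl fun j _ => ?_
    exact inner_ampConj P Q (M i j) (f j) (g i)
  rw [h]
  refine (norm_inner_matrixOp_le _ _ _).trans ?_
  calc _ ≤ ‖M‖ * (‖P‖ * ‖g‖) * (‖Q‖ * ‖f‖) := by
        gcongr
        · exact key P g
        · exact key Q f
    _ = _ := by ring

end Amplification

/-! ### Spatially implemented maps: complete bounds, normality, density -/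

section Maps

variable {K : Type u} [NormedAddCommGroup K] [InnerProductSpace ℂ K] [CompleteSpace K]
  {A B : StarSubalgebra ℂ (K →L[ℂ] K)} {κ : Type*}

theorem cbBound_of_eq_ampConj (m : A →ₗ[ℂ] B) (P Q : K →L[ℂ] lp (fun _ : κ => K) 2)
    (h : ∀ x : A, (m x : K →L[ℂ] K) = ampConj P Q x) : CBBound m (‖P‖ * ‖Q‖) := by
  intro n x
  simp_rw [h]
  exact norm_matrix_ampConj_le P Q
    (CStarMatrix.ofMatrix (Matrix.of fun i j => (x i j : K →L[ℂ] K)))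

theorem isNormalFunctional_of_hasSum {ι : Type*} (ω : A →ₗ[ℂ] ℂ) (ξ η : ι → K)
    (hξ : Summable fun i => ‖ξ i‖ ^ 2) (hη : Summable fun i => ‖η i‖ ^ 2)
    (h : ∀ x : A, HasSum (fun i => inner ℂ (ξ i) ((x : K →L[ℂ] K) (η i))) (ω x)) :
    IsNormalFunctional ω := by
  -- A square-summable family has countable support, so it can be enumerated by ℕ and padded with
  -- zeros; this removes any restriction on the index type.
  let s : Set ι := Function.support fun i => ‖ξ i‖ ^ 2
  have hs : s.Countable := hξ.countable_support
  have := hs.to_subtype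
  obtain ⟨e, he'⟩ := exists_injective_nat s
  refine ⟨Function.extend e (fun i => ξ i) 0,
    Function.extend e (fun i => η i) 0, ?_, ?_, fun x => ?_⟩
  · rw [← he'.summable_iff]
    · simp only [Function.comp_def, he'.extend_apply]
      exact hξ.subtype s
    · intro n hn
      rw [Function.extend_apply' _ _ _ (by simpa using hn)]
      simp
  · rw [← he'.summable_iff]
    · simp only [Function.comp_def, he'.extend_apply]
      exact hη.subtype s
    · intro n hn
      rw [Function.extend_apply' _ _ _ (by simpa using hn)]
      simp
  · rw [← he'.hasSum_iff]
    · simp only [Function.comp_def, he'.extend_apply]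
      refine (hasSum_subtype_iff_of_support_subset (s := s) ?_).2 (h x)
      intro i hi
      contrapose! hi
      have : ξ i = 0 := by simpa [s] using hi
      simp [this]
    · intro n hn
      rw [Function.extend_apply' _ _ _ (by simpa using hn)]
      simp

/-- The functional given by (ξₙ), (ηₙ) pulls back to the one given by all components of P ξₙ and Q
ηₙ, and these doubly indexed families are again square summable. -/
theorem isNormalMap_of_eq_ampConj (m : A →ₗ[ℂ] B) (P Q : K →L[ℂ] lp (fun _ : κ => K) 2)
    (h : ∀ x : A, (m x : K →L[ℂ] K) = ampConj P Q x) : IsNormalMap m := by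
  rintro ω ⟨ξ, η, hξ, hη, hω⟩
  have key : ∀ (R : K →L[ℂ] lp (fun _ : κ => K) 2) (ξ : ℕ → K), Summable (fun n => ‖ξ n‖ ^ 2) →
      Summable fun p : ℕ × κ => ‖R (ξ p.1) p.2‖ ^ 2 := fun R ξ hξ => by
    refine (summable_prod_of_nonneg fun p => by positivity).2
      ⟨fun n => lp_summable_norm_sq (R (ξ n)), ?_⟩
    refine Summable.of_nonneg_of_le (fun n => tsum_nonneg fun i => by positivity) (fun n => ?_)
      (hξ.mul_left (‖R‖ ^ 2))
    refine (lp_norm_sq (R (ξ n))).symm.trans_le ?_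
    rw [← mul_pow]
    exact pow_le_pow_left₀ (norm_nonneg _) (R.le_opNorm _) 2
  refine isNormalFunctional_of_hasSum (ι := ℕ × κ) _ (fun p => P (ξ p.1) p.2)
    (fun p => Q (η p.1) p.2) (key P ξ hξ) (key Q η hη) fun x => ?_
  have hs : Summable fun p : ℕ × κ =>
      inner ℂ (P (ξ p.1) p.2) ((x : K →L[ℂ] K) (Q (η p.1) p.2)) := by
    refine Summable.of_norm_bounded (((key P ξ hξ).add (key Q η hη)).mul_left ‖(x : K →L[ℂ] K)‖)
      fun p => (norm_inner_le_norm _ _).trans ?_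
    have h1 := (x : K →L[ℂ] K).le_opNorm (Q (η p.1) p.2)
    have h2 := two_mul_le_add_sq ‖P (ξ p.1) p.2‖ ‖Q (η p.1) p.2‖
    calc _ ≤ ‖P (ξ p.1) p.2‖ * (‖(x : K →L[ℂ] K)‖ * ‖Q (η p.1) p.2‖) := by gcongr
      _ = ‖(x : K →L[ℂ] K)‖ * (‖P (ξ p.1) p.2‖ * ‖Q (η p.1) p.2‖) := by ring
      _ ≤ _ := by
        gcongr
        nlinarith [norm_nonneg (P (ξ p.1) p.2), norm_nonneg (Q (η p.1) p.2),
          mul_nonneg (norm_nonneg (P (ξ p.1) p.2)) (norm_nonneg (Q (η p.1) p.2))]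
  have h1 := hs.hasSum.prod_fiberwise fun n => hasSum_inner_ampConj P Q x (η n) (ξ n)
  have h2 := hω (m x)
  simp_rw [h] at h2
  rw [LinearMap.comp_apply, h2.unique h1]
  exact hs.hasSum

/-! ### Density of an operator algebra in its bicommutant -/

/-- Von Neumann's density argument in the amplified space: the projection onto the closure of D f
commutes with D ⊗ 1, so its matrix entries lie in the commutant of D, and x ⊗ 1 commutes with it as
well. -/
theorem amp_mem_closure (D : StarSubalgebra ℂ (K →L[ℂ] K)) (x : K →L[ℂ] K)
    (hx : ∀ p : K →L[ℂ] K, (∀ y ∈ D, y * p = p * y) → x * p = p * x) (f : lp (fun _ : κ => K) 2) :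
    amp κ x f ∈ closure {g | ∃ y ∈ D, g = amp κ y f} := by
  classical
  let Z₀ : Submodule ℂ (lp (fun _ : κ => K) 2) :=
    D.toSubalgebra.toSubmodule.map
      ((ContinuousLinearMap.apply ℂ (lp (fun _ : κ => K) 2) f).toLinearMap ∘ₗ
        (ampHom (K := K) κ : (K →L[ℂ] K) →ₗ[ℂ] _))
  have hZ₀ : (Z₀ : Set (lp (fun _ : κ => K) 2)) = {g | ∃ y ∈ D, g = amp κ y f} := by
    ext g
    constructor
    · rintro ⟨y, hy, rfl⟩
      exact ⟨y, hy, rfl⟩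
    · rintro ⟨y, hy, rfl⟩
      exact ⟨y, hy, rfl⟩
  rw [← hZ₀]
  let Z := Z₀.topologicalClosure
  change amp κ x f ∈ Z
  have hinv₀ : ∀ y ∈ D, ∀ g ∈ Z₀, amp κ y g ∈ Z₀ := by
    rintro y hy _ ⟨z, hz, rfl⟩
    exact ⟨y * z, D.mul_mem hy hz, rfl⟩
  have hinv : ∀ y ∈ D, ∀ g ∈ Z, amp κ y g ∈ Z := fun y hy g hg =>
    map_mem_closure (amp κ y).continuous hg (hinv₀ y hy)
  have : CompleteSpace Z := (Submodule.isClosed_topologicalClosure Z₀).completeSpace_coe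
  let p : lp (fun _ : κ => K) 2 →L[ℂ] lp (fun _ : κ => K) 2 := Z.starProjection
  have hcomm : ∀ y ∈ D, ∀ g, amp κ y (p g) = p (amp κ y g) := by
    intro y hy g
    have h1 : amp κ y (p g) ∈ Z := hinv y hy _ (Z.starProjection_apply_mem g)
    -- Since D is closed under adjoints, the orthogonal complement of Z is invariant too.
    have h2 : amp κ y (g - p g) ∈ Zᗮ := by
      rw [Submodule.mem_orthogonal]
      intro z hz
      have h3 : inner ℂ (amp κ (star y) z) (g - p g) = 0 :=
        Submodule.inner_right_of_mem_orthogonal (hinv _ (star_mem hy) z hz)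
          (Z.sub_starProjection_mem_orthogonal g)
      rwa [amp_star, ContinuousLinearMap.star_eq_adjoint,
        ContinuousLinearMap.adjoint_inner_left] at h3
    rw [map_sub] at h2
    exact (Submodule.eq_starProjection_of_mem_of_inner_eq_zero h1 (fun z hz => by
      exact Submodule.inner_left_of_mem_orthogonal hz h2)).symm
  have hxp : ∀ g, amp κ x (p g) = p (amp κ x g) := by
    have hsing : ∀ (j : κ) (v : K), amp κ x (p (lp.single 2 j v)) = p (amp κ x (lp.single 2 j v)) := by
      intro j v
      have hampsingle : ∀ (y : K →L[ℂ] K) (v : K),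
          amp κ y (lp.single 2 j v) = lp.single 2 j (y v) := fun y v => by
        ext i
        rw [amp_apply]
        by_cases hij : i = j
        · subst hij
          rw [lp.single_apply_self, lp.single_apply_self]
        · rw [lp.single_apply_ne 2 j _ hij, lp.single_apply_ne 2 j _ hij, map_zero]
      ext i
      let q : K →L[ℂ] K := (lp.evalCLM ℂ (fun _ : κ => K) 2 i) ∘L p ∘L
        (lp.singleContinuousLinearMap ℂ (fun _ : κ => K) 2 j)
      have hq : ∀ v, q v = p (lp.single 2 j v) i := fun v => rfl
      have := hx q fun y hy => by
        ext v
        change y (q v) = q (y v)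
        rw [hq, hq, ← hampsingle, ← hcomm y hy]
        rfl
      have := congrArg (fun T => T v) this
      change x (q v) = q (x v) at this
      rw [hampsingle, ← hq, ← this]
      rfl
    intro g
    have hg := lp.hasSum_single (p := 2) (by norm_num) g
    have h1 := (hg.mapL p).mapL (amp κ x)
    have h2 := (hg.mapL (amp κ x)).mapL p
    simp_rw [hsing] at h1
    exact h1.unique h2
  -- The vector f itself lies in Z because D contains the identity.
  have hf : p f = f := by
    refine Submodule.starProjection_eq_self_iff.2 (Submodule.le_topologicalClosure _ ?_)
    refine ⟨1, D.one_mem, ?_⟩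
    rfl
  rw [← hf, hxp]
  exact Z.starProjection_apply_mem _

/-- A normal functional is a single inner product in the amplified space, where `amp_mem_closure`
provides approximation in norm. -/
theorem eq_zero_of_hasSum_of_bicommutant (D : StarSubalgebra ℂ (K →L[ℂ] K)) (ξ η : κ → K)
    (hξ : Summable fun i => ‖ξ i‖ ^ 2) (hη : Summable fun i => ‖η i‖ ^ 2)
    (h : ∀ y ∈ D, HasSum (fun i => inner ℂ (ξ i) (y (η i))) 0) (x : K →L[ℂ] K)
    (hx : ∀ p : K →L[ℂ] K, (∀ y ∈ D, y * p = p * y) → x * p = p * x) :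
    HasSum (fun i => inner ℂ (ξ i) (x (η i))) 0 := by
  let ξ' : lp (fun _ : κ => K) 2 := ⟨ξ, memℓp_gen (by simpa using hξ)⟩
  let η' : lp (fun _ : κ => K) 2 := ⟨η, memℓp_gen (by simpa using hη)⟩
  have h1 : ∀ y : K →L[ℂ] K, HasSum (fun i => inner ℂ (ξ i) (y (η i))) (inner ℂ ξ' (amp κ y η')) :=
    fun y => lp.hasSum_inner _ _
  have h2 : inner ℂ ξ' (amp κ x η') = 0 := by
    have hc : IsClosed {g : lp (fun _ : κ => K) 2 | inner ℂ ξ' g = 0} :=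
      isClosed_eq (by fun_prop) continuous_const
    refine hc.closure_subset_iff.2 ?_ (amp_mem_closure D x hx η')
    rintro _ ⟨y, hy, rfl⟩
    exact (h1 y).unique (h y hy)
  rw [← h2]
  exact h1 x

end Maps

end FreeArakiWoods

end

noncomputable section


namespace FreeArakiWoods

set_option linter.unusedSectionVars false

open ContinuousLinearMap (adjoint)
open Filter Topology

/-! ### Polar decomposition -/

section Polar

variable {K : Type*} [NormedAddCommGroup K] [InnerProductSpace ℂ K] [CompleteSpace K]

/-- A polar decomposition `h = W |h|` with a contraction `W` such that `W* h = |h|`. -/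
theorem exists_polar (h : K →L[ℂ] K) : ∃ W p : K →L[ℂ] K, (∀ x, ‖W x‖ ≤ ‖x‖) ∧ 0 ≤ p ∧
    W * p = h ∧ ∀ x y, inner ℂ (W y) (h x) = inner ℂ y (p x) := by
  let p := CFC.abs h
  have hp0 : 0 ≤ p := CFC.abs_nonneg h
  have hpsa : adjoint p = p := by
    rw [← ContinuousLinearMap.star_eq_adjoint]
    exact (IsSelfAdjoint.of_nonneg hp0)
  have hin : ∀ x y, inner ℂ (h y) (h x) = inner ℂ (p y) (p x) := fun x y => by
    have h1 : p * p = star h * h := CFC.abs_mul_abs h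
    have h2 := congrArg (fun T => inner ℂ y (T x)) h1
    change inner ℂ y (p (p x)) = inner ℂ y (star h (h x)) at h2
    rw [ContinuousLinearMap.star_eq_adjoint, ContinuousLinearMap.adjoint_inner_right,
      ← ContinuousLinearMap.adjoint_inner_left, hpsa] at h2
    exact h2.symm
  have hnorm : ∀ x, ‖h x‖ = ‖p x‖ := fun x => by
    have := hin x x
    rw [inner_self_eq_norm_sq_to_K, inner_self_eq_norm_sq_to_K] at this
    have h2 : ‖h x‖ ^ 2 = ‖p x‖ ^ 2 := by exact_mod_cast this
    exact (pow_left_inj₀ (norm_nonneg _) (norm_nonneg _) two_ne_zero).1 h2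
  -- As ‖h x‖ = ‖p x‖, the map p x ↦ h x extends to an isometry on Z; preceded by the projection
  -- onto Z it becomes the contraction W.
  let Z := (LinearMap.range p.toLinearMap).topologicalClosure
  have : CompleteSpace Z := (Submodule.isClosed_topologicalClosure _).completeSpace_coe
  let e : K →ₗ[ℂ] Z := p.toLinearMap.codRestrict Z
    (fun x => Submodule.le_topologicalClosure _ ⟨x, rfl⟩)
  have he : DenseRange e := by
    intro z
    rw [Metric.mem_closure_iff]
    intro ε hε
    obtain ⟨_, ⟨x, rfl⟩, hx⟩ := Metric.mem_closure_iff.1 z.2 ε hε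
    exact ⟨e x, ⟨x, rfl⟩, hx⟩
  have hb : ∀ x, ‖h.toLinearMap x‖ ≤ 1 * ‖e x‖ := fun x => by
    rw [one_mul]
    exact (hnorm x).le
  let W₀ : Z →L[ℂ] K := h.toLinearMap.extendOfNorm e
  have hW₀ : ∀ x, W₀ (e x) = h x := LinearMap.extendOfNorm_eq he ⟨1, hb⟩
  have hW₀n : ∀ z, ‖W₀ z‖ ≤ ‖z‖ := fun z => by
    simpa using LinearMap.norm_extendOfNorm_apply_le he 1 hb z
  have hpZ : ∀ x, p x ∈ Z := fun x => Submodule.le_topologicalClosure _ ⟨x, rfl⟩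
  have hpe : ∀ x, Z.orthogonalProjectionOnto (p x) = e x := fun x =>
    Submodule.orthogonalProjectionOnto_mem_subspace_eq_self (⟨p x, hpZ x⟩ : Z)
  refine ⟨W₀ ∘L Z.orthogonalProjectionOnto, p, fun x => ?_, hp0, ?_, fun x y => ?_⟩
  · exact (hW₀n _).trans (Z.norm_orthogonalProjectionOnto_apply_le x)
  · ext x
    change W₀ (Z.orthogonalProjectionOnto (p x)) = h x
    rw [hpe, hW₀]
  · change inner ℂ (W₀ (Z.orthogonalProjectionOnto y)) (h x) = inner ℂ y (p x)
    have h1 : ∀ z : Z, inner ℂ (W₀ z) (h x) = inner ℂ (z : K) (p x) := fun z => by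
      refine he.induction_on (p := fun z : Z => inner ℂ (W₀ z) (h x) = inner ℂ (z : K) (p x)) z
        (isClosed_eq (by fun_prop) (by fun_prop)) fun t => ?_
      rw [hW₀, hin]
      rfl
    rw [h1]
    change inner ℂ (Z.starProjection y) (p x) = inner ℂ y (p x)
    rw [Submodule.inner_starProjection_left_eq_right,
      Submodule.starProjection_eq_self_iff.2 (hpZ x)]

theorem exists_polar_sqrt (h : K →L[ℂ] K) : ∃ W q : K →L[ℂ] K, (∀ x, ‖W x‖ ≤ ‖x‖) ∧
    (∀ x y, inner ℂ (q x) y = inner ℂ x (q y)) ∧ (∀ x, h x = W (q (q x))) ∧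
    ∀ x y, inner ℂ (W y) (h x) = inner ℂ y (q (q x)) := by
  obtain ⟨W, p, hW, hp, hWp, hWh⟩ := exists_polar h
  have hqq : CFC.sqrt p * CFC.sqrt p = p := CFC.sqrt_mul_sqrt_self p hp
  have hqsa : adjoint (CFC.sqrt p) = CFC.sqrt p := by
    rw [← ContinuousLinearMap.star_eq_adjoint]
    exact IsSelfAdjoint.of_nonneg (CFC.sqrt_nonneg p)
  refine ⟨W, CFC.sqrt p, hW, fun x y => ?_, fun x => ?_, fun x y => ?_⟩
  · conv_rhs => rw [← hqsa, ContinuousLinearMap.adjoint_inner_right]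
  · rw [← hWp]
    conv_lhs => rw [← hqq]
    rfl
  · rw [hWh]
    conv_lhs => rw [← hqq]
    rfl

end Polar

/-! ### Functionals on the Toeplitz algebra -/

section Toeplitz

local notation "𝔖" => unilateralShift

theorem star_shift_mul_shift : star 𝔖 * 𝔖 = 1 := by
  ext β n
  exact star_unilateralShift_apply _ n

theorem star_shift_pow_apply (m : ℕ) (β : ellTwo) (n : ℕ) : (star 𝔖 ^ m) β n = β (n + m) := by
  induction m generalizing n with
  | zero => rfl
  | succ m ih =>
    rw [pow_succ']
    change star 𝔖 ((star 𝔖 ^ m) β) n = _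
    rw [star_unilateralShift_apply, ih, add_right_comm, add_assoc]

theorem star_shift_pow_mul_shift_pow (m : ℕ) : star 𝔖 ^ m * 𝔖 ^ m = 1 := by
  induction m with
  | zero => simp
  | succ m ih =>
    rw [pow_succ, pow_succ', mul_assoc, ← mul_assoc (star 𝔖) 𝔖, star_shift_mul_shift, one_mul, ih]

/-- The standard basis of `ℓ²`. -/
def stdVec (k : ℕ) : ellTwo := lp.single 2 k 1

theorem inner_stdVec_left (k : ℕ) (f : ellTwo) : inner ℂ (stdVec k) f = f k := by
  rw [stdVec, lp.inner_single_left]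
  simp

theorem inner_stdVec_right (k : ℕ) (f : ellTwo) : inner ℂ f (stdVec k) = star (f k) := by
  rw [← inner_conj_symm, inner_stdVec_left]
  rfl

theorem shift_stdVec (k : ℕ) : 𝔖 (stdVec k) = stdVec (k + 1) := shiftOp_single _ _ _ _ _

theorem shift_pow_stdVec (m k : ℕ) : (𝔖 ^ m) (stdVec k) = stdVec (k + m) := by
  induction m with
  | zero => rfl
  | succ m ih =>
    rw [pow_succ']
    change 𝔖 ((𝔖 ^ m) (stdVec k)) = _
    rw [ih, shift_stdVec]
    rfl

theorem inner_star_shift_pow (i : ℕ) (f g : ellTwo) :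
    inner ℂ ((star 𝔖 ^ i) f) g = inner ℂ f ((𝔖 ^ i) g) := by
  rw [← star_pow, ContinuousLinearMap.star_eq_adjoint, ContinuousLinearMap.adjoint_inner_left]

/-- Conjugation of the rank one projection 1 - SS* by powers of the shift. It lets the values φ(i+j)
- φ(i+j+2) be read off from rank one operators. -/
theorem shift_pow_sub_eq_rankOne (i j : ℕ) :
    𝔖 ^ i * star 𝔖 ^ j - 𝔖 ^ (i + 1) * star 𝔖 ^ (j + 1) =
      InnerProductSpace.rankOne ℂ (stdVec i) (stdVec j) := by
  have h0 : 1 - 𝔖 * star 𝔖 = InnerProductSpace.rankOne ℂ (stdVec 0) (stdVec 0) := by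
    ext f n
    rw [InnerProductSpace.rankOne_apply, inner_stdVec_left]
    cases n with
    | zero =>
      change f 0 - 0 = f 0 * stdVec 0 0
      rw [stdVec, lp.single_apply_self, sub_zero, mul_one]
    | succ n =>
      change f (n + 1) - star 𝔖 f n = f 0 * stdVec 0 (n + 1)
      rw [stdVec, lp.single_apply_ne 2 0 _ (by omega), star_unilateralShift_apply, sub_self,
        mul_zero]
  have h1 : 𝔖 ^ i * star 𝔖 ^ j - 𝔖 ^ (i + 1) * star 𝔖 ^ (j + 1) =
      𝔖 ^ i * (1 - 𝔖 * star 𝔖) * star 𝔖 ^ j := by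
    rw [pow_succ 𝔖, pow_succ' (star 𝔖)]
    noncomm_ring
  rw [h1, h0]
  ext1 f
  change (𝔖 ^ i) (inner ℂ (stdVec 0) ((star 𝔖 ^ j) f) • stdVec 0) = inner ℂ (stdVec j) f • stdVec i
  rw [map_smul, shift_pow_stdVec, inner_stdVec_left, inner_stdVec_left, star_shift_pow_apply]
  simp

theorem norm_shift_apply (f : ellTwo) : ‖𝔖 f‖ = ‖f‖ := by
  have h : inner ℂ (𝔖 f) (𝔖 f) = inner ℂ f f := by
    rw [← ContinuousLinearMap.adjoint_inner_right, ← ContinuousLinearMap.star_eq_adjoint]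
    exact congrArg (fun T => inner ℂ f (T f)) star_shift_mul_shift
  rw [inner_self_eq_norm_sq_to_K, inner_self_eq_norm_sq_to_K] at h
  have h2 : ‖𝔖 f‖ ^ 2 = ‖f‖ ^ 2 := by exact_mod_cast h
  exact (pow_left_inj₀ (norm_nonneg _) (norm_nonneg _) two_ne_zero).1 h2

theorem norm_shift_pow_apply (m : ℕ) (f : ellTwo) : ‖(𝔖 ^ m) f‖ = ‖f‖ := by
  induction m with
  | zero => rfl
  | succ m ih =>
    rw [pow_succ']
    exact (norm_shift_apply _).trans ih

theorem norm_star_shift_pow_apply_le (m : ℕ) (f : ellTwo) : ‖(star 𝔖 ^ m) f‖ ≤ ‖f‖ := by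
  have h1 : ‖star 𝔖 ^ m‖ ≤ 1 := by
    rw [← star_pow, ContinuousLinearMap.star_eq_adjoint, LinearIsometryEquiv.norm_map]
    exact ContinuousLinearMap.opNorm_le_bound _ zero_le_one fun f => by
      rw [norm_shift_pow_apply, one_mul]
  simpa using (star 𝔖 ^ m).le_of_opNorm_le h1 f

theorem tendsto_star_shift_pow (f : ellTwo) : Tendsto (fun m => (star 𝔖 ^ m) f) atTop (𝓝 0) := by
  rw [tendsto_zero_iff_norm_tendsto_zero]
  have h1 : ∀ m, ‖(star 𝔖 ^ m) f‖ ^ 2 = ∑' n, ‖f (n + m)‖ ^ 2 := fun m => by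
    rw [lp_norm_sq]
    simp_rw [star_shift_pow_apply]
  have h2 : Tendsto (fun m => ‖(star 𝔖 ^ m) f‖ ^ 2) atTop (𝓝 0) := by
    simp_rw [h1]
    exact tendsto_sum_nat_add (fun n => ‖f n‖ ^ 2)
  have h3 := h2.sqrt
  simpa using h3

/-- The truncation of a sequence to its first `N` entries. -/
def truncate (N : ℕ) : ellTwo →L[ℂ] ellTwo := 1 - 𝔖 ^ N * star 𝔖 ^ N

theorem truncate_apply (N : ℕ) (f : ellTwo) : truncate N f = f - (𝔖 ^ N) ((star 𝔖 ^ N) f) := rfl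

theorem tendsto_truncate (f : ellTwo) : Tendsto (fun N => truncate N f) atTop (𝓝 f) := by
  simp_rw [truncate_apply]
  have : Tendsto (fun N => (𝔖 ^ N) ((star 𝔖 ^ N) f)) atTop (𝓝 0) := by
    rw [tendsto_zero_iff_norm_tendsto_zero]
    simp_rw [norm_shift_pow_apply]
    exact tendsto_zero_iff_norm_tendsto_zero.1 (tendsto_star_shift_pow f)
  simpa using tendsto_const_nhds.sub this

theorem star_shift_pow_truncate (N : ℕ) (f : ellTwo) : (star 𝔖 ^ N) (truncate N f) = 0 := by
  have := congrArg (fun T => T ((star 𝔖 ^ N) f)) (star_shift_pow_mul_shift_pow N)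
  change (star 𝔖 ^ N) ((𝔖 ^ N) ((star 𝔖 ^ N) f)) = (star 𝔖 ^ N) f at this
  rw [truncate_apply, map_sub, this, sub_self]

theorem norm_add_shift_pow_sq {N : ℕ} {g : ellTwo} (hg : (star 𝔖 ^ N) g = 0) (f : ellTwo) :
    ‖g + (𝔖 ^ N) f‖ ^ 2 = ‖g‖ ^ 2 + ‖f‖ ^ 2 := by
  rw [norm_add_sq (𝕜 := ℂ), ← inner_star_shift_pow, hg, norm_shift_pow_apply]
  simp

theorem norm_truncate_sq_add (N : ℕ) (f : ellTwo) :
    ‖truncate N f‖ ^ 2 + ‖(star 𝔖 ^ N) f‖ ^ 2 = ‖f‖ ^ 2 := by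
  rw [← norm_add_shift_pow_sq (star_shift_pow_truncate N f), truncate_apply, sub_add_cancel]

theorem inner_truncate (N : ℕ) (f g : ellTwo) :
    inner ℂ (truncate N f) g = inner ℂ f (truncate N g) := by
  rw [truncate_apply, truncate_apply, inner_sub_left, inner_sub_right, ← inner_star_shift_pow,
    ← inner_conj_symm ((𝔖 ^ N) _), ← inner_star_shift_pow, inner_conj_symm]

/-- A polynomial of degree two in the shift that interpolates `s₁` at `1` and `s₂` at `-1`. -/
def interpolant (s₁ s₂ : ℂ) : ellTwo →L[ℂ] ellTwo :=
  (4⁻¹ * s₁ : ℂ) • ((1 + 𝔖) * (1 + 𝔖)) + (4⁻¹ * s₂ : ℂ) • ((1 - 𝔖) * (1 - 𝔖))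

/-- The symbol s₁(1+z)²/4 + s₂(1-z)²/4 has modulus at most (|1+z|² + |1-z|²)/4 = 1 on the circle.
The parallelogram law for f and Sf is the operator form of that identity. -/
theorem norm_interpolant_apply_le (s₁ s₂ : ℂ) (h₁ : ‖s₁‖ ≤ 1) (h₂ : ‖s₂‖ ≤ 1) (f : ellTwo) :
    ‖interpolant s₁ s₂ f‖ ≤ ‖f‖ := by
  have hpar : ∀ g : ellTwo, ‖g + 𝔖 g‖ ^ 2 + ‖g - 𝔖 g‖ ^ 2 = 4 * ‖g‖ ^ 2 := fun g => by
    have := parallelogram_law_with_norm ℂ g (𝔖 g)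
    rw [norm_shift_apply] at this
    nlinarith
  have hpar' : ∀ g : ellTwo, ‖g + star 𝔖 g‖ ^ 2 + ‖g - star 𝔖 g‖ ^ 2 ≤ 4 * ‖g‖ ^ 2 := fun g => by
    have h1 := parallelogram_law_with_norm ℂ g (star 𝔖 g)
    have h2 : ‖star 𝔖 g‖ ≤ ‖g‖ := by simpa using norm_star_shift_pow_apply_le 1 g
    nlinarith [norm_nonneg (star 𝔖 g)]
  set z := interpolant s₁ s₂ f with hz
  -- One factor 1 ± S of each square is moved to the left-hand vector, which leaves a form suited to
  -- Cauchy–Schwarz.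
  have hin : inner ℂ z z = 4⁻¹ * s₁ * inner ℂ (z + star 𝔖 z) (f + 𝔖 f) +
      4⁻¹ * s₂ * inner ℂ (z - star 𝔖 z) (f - 𝔖 f) := by
    have h1 : z = (4⁻¹ * s₁) • ((f + 𝔖 f) + 𝔖 (f + 𝔖 f)) +
        (4⁻¹ * s₂) • ((f - 𝔖 f) - 𝔖 (f - 𝔖 f)) := rfl
    have h2 : ∀ g, inner ℂ (star 𝔖 z) g = inner ℂ z (𝔖 g) := fun g => by
      simpa using inner_star_shift_pow 1 z g
    rw [inner_add_left, inner_sub_left, h2, h2, ← inner_add_right, ← inner_sub_right,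
      ← inner_smul_right, ← inner_smul_right, ← inner_add_right, ← h1]
  have hn : ‖z‖ ^ 2 ≤ 4⁻¹ * (‖z + star 𝔖 z‖ * ‖f + 𝔖 f‖) +
      4⁻¹ * (‖z - star 𝔖 z‖ * ‖f - 𝔖 f‖) := by
    have h3 : ‖z‖ ^ 2 = ‖inner ℂ z z‖ := by
      rw [inner_self_eq_norm_sq_to_K]
      simp
    rw [h3, hin]
    refine (norm_add_le _ _).trans ?_
    rw [norm_mul, norm_mul, norm_mul, norm_mul]
    have h5 : ‖(4⁻¹ : ℂ)‖ = 4⁻¹ := by simp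
    rw [h5]
    refine add_le_add ?_ ?_
    · calc 4⁻¹ * ‖s₁‖ * _ ≤ 4⁻¹ * 1 * (‖z + star 𝔖 z‖ * ‖f + 𝔖 f‖) := by
            gcongr
            exact norm_inner_le_norm _ _
        _ = _ := by ring
    · calc 4⁻¹ * ‖s₂‖ * _ ≤ 4⁻¹ * 1 * (‖z - star 𝔖 z‖ * ‖f - 𝔖 f‖) := by
            gcongr
            exact norm_inner_le_norm _ _
        _ = _ := by ring
  have hz2 := hpar' z
  have hf2 := hpar f
  set a := ‖z + star 𝔖 z‖
  set b := ‖z - star 𝔖 z‖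
  set c := ‖f + 𝔖 f‖
  set d := ‖f - 𝔖 f‖
  have hcs : (a * c + b * d) ^ 2 ≤ (4 * ‖z‖ * ‖f‖) ^ 2 := by
    calc (a * c + b * d) ^ 2 ≤ (a ^ 2 + b ^ 2) * (c ^ 2 + d ^ 2) := by
          nlinarith [sq_nonneg (a * d - b * c)]
      _ ≤ (4 * ‖z‖ ^ 2) * (4 * ‖f‖ ^ 2) := by
          rw [hf2]
          gcongr
      _ = _ := by ring
  have h6 := abs_le_of_sq_le_sq' hcs (by positivity) |>.2
  rcases (norm_nonneg z).eq_or_lt with h0 | h0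
  · rw [← h0]
    positivity
  · refine le_of_mul_le_mul_left ?_ h0
    nlinarith

/-- The operator `h` on `ℓ²` that represents a functional on the rank one operators:
`⟪g, h f⟫ = γ (|f⟩⟨g|)`. -/
theorem exists_rankOne_symbol (γ : (ellTwo →L[ℂ] ellTwo) →L[ℂ] ℂ) :
    ∃ h : ellTwo →L[ℂ] ellTwo, ∀ f g, inner ℂ g (h f) = γ (InnerProductSpace.rankOne ℂ f g) := by
  let B : ellTwo →L⋆[ℂ] ellTwo →L[ℂ] ℂ := LinearMap.mkContinuous₂
    (LinearMap.mk₂'ₛₗ (starRingEnd ℂ) (RingHom.id ℂ)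
      (fun g f => γ (InnerProductSpace.rankOne ℂ f g)) (by simp) (by simp) (by simp) (by simp))
    ‖γ‖ (fun g f => by
      refine (γ.le_opNorm _).trans ?_
      rw [InnerProductSpace.norm_rankOne]
      exact le_of_eq (by ring))
  refine ⟨adjoint (InnerProductSpace.continuousLinearMapOfBilin B), fun f g => ?_⟩
  rw [ContinuousLinearMap.adjoint_inner_right,
    InnerProductSpace.continuousLinearMapOfBilin_apply]
  rfl

/-- The functional is tested on the sum of a truncated partial sum of the polar part and the
interpolant shifted by N. For n ≤ N the two pieces have orthogonal supports and orthogonal ranges,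
so their sum is still a contraction; this is what makes the normal and the character parts of γ add
up in norm. -/
theorem norm_symbol_trace_add_le (γ : (ellTwo →L[ℂ] ellTwo) →L[ℂ] ℂ) {h W : ellTwo →L[ℂ] ellTwo}
    (hh : ∀ f g, inner ℂ g (h f) = γ (InnerProductSpace.rankOne ℂ f g)) (hW : ∀ x, ‖W x‖ ≤ ‖x‖)
    {n N : ℕ} (hnN : n ≤ N) {s₁ s₂ : ℂ} (h₁ : ‖s₁‖ ≤ 1) (h₂ : ‖s₂‖ ≤ 1) :
    ‖∑ k ∈ Finset.range n, inner ℂ (truncate N (W (stdVec k))) (h (stdVec k)) +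
      γ (𝔖 ^ N * interpolant s₁ s₂ * star 𝔖 ^ N)‖ ≤ ‖γ‖ := by
  let X : ellTwo →L[ℂ] ellTwo := ∑ k ∈ Finset.range n,
    InnerProductSpace.rankOne ℂ (stdVec k) (truncate N (W (stdVec k))) +
      𝔖 ^ N * interpolant s₁ s₂ * star 𝔖 ^ N
  have hX : ‖X‖ ≤ 1 := by
    refine ContinuousLinearMap.opNorm_le_bound _ zero_le_one fun x => ?_
    rw [one_mul]
    refine abs_le_of_sq_le_sq' ?_ (norm_nonneg _) |>.2
    let u := adjoint W (truncate N x)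
    let y : ellTwo := ∑ k ∈ Finset.range n, lp.single 2 k (u k)
    have hXx : X x = y + (𝔖 ^ N) (interpolant s₁ s₂ ((star 𝔖 ^ N) x)) := by
      have hy : (∑ k ∈ Finset.range n,
          InnerProductSpace.rankOne ℂ (stdVec k) (truncate N (W (stdVec k)))) x = y := by
        rw [_root_.sum_apply]
        refine Finset.sum_congr rfl fun k _ => ?_
        rw [InnerProductSpace.rankOne_apply, inner_truncate,
          ← ContinuousLinearMap.adjoint_inner_right, inner_stdVec_left, stdVec, ← lp.single_smul]
        simp [u]
      rw [← hy]
      rfl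
    have hy0 : (star 𝔖 ^ N) y = 0 := by
      rw [map_sum]
      refine Finset.sum_eq_zero fun k hk => ?_
      ext m
      rw [star_shift_pow_apply, lp.single_apply_ne 2 k _ (by
        have := Finset.mem_range.1 hk
        omega)]
      rfl
    have hyn : ‖y‖ ^ 2 ≤ ‖truncate N x‖ ^ 2 := by
      have e1 := lp.norm_sum_single (p := 2) (by norm_num) (fun k => u k) (Finset.range n)
      have e2 := lp.sum_rpow_le_norm_rpow (p := 2) (by norm_num) u (Finset.range n)
      simp only [ENNReal.toReal_ofNat, Real.rpow_ofNat] at e1 e2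
      have e3 : ‖u‖ ≤ ‖truncate N x‖ := by
        have hW' : ‖adjoint W‖ ≤ 1 := by
          rw [LinearIsometryEquiv.norm_map]
          exact ContinuousLinearMap.opNorm_le_bound _ zero_le_one fun x => by
            rw [one_mul]
            exact hW x
        simpa using (adjoint W).le_of_opNorm_le hW' (truncate N x)
      exact (e1.trans_le e2).trans (pow_le_pow_left₀ (norm_nonneg _) e3 2)
    have h3 := norm_interpolant_apply_le s₁ s₂ h₁ h₂ ((star 𝔖 ^ N) x)
    rw [hXx, norm_add_shift_pow_sq hy0, ← norm_truncate_sq_add N x]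
    gcongr
  have hγX : γ X = ∑ k ∈ Finset.range n, inner ℂ (truncate N (W (stdVec k))) (h (stdVec k)) +
      γ (𝔖 ^ N * interpolant s₁ s₂ * star 𝔖 ^ N) := by
    rw [map_add, map_sum]
    simp_rw [hh]
  rw [← hγX]
  simpa using γ.le_of_opNorm_le_of_le le_rfl hX

theorem radial_interpolant {φ : ℕ → ℂ} {γ : (ellTwo →L[ℂ] ellTwo) →L[ℂ] ℂ}
    (hγ : ∀ i j, γ (𝔖 ^ i * star 𝔖 ^ j) = φ (i + j)) (s₁ s₂ : ℂ) (N : ℕ) :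
    γ (𝔖 ^ N * interpolant s₁ s₂ * star 𝔖 ^ N) =
      4⁻¹ * s₁ * (φ (2 * N) + 2 * φ (2 * N + 1) + φ (2 * (N + 1))) +
      4⁻¹ * s₂ * (φ (2 * N) - 2 * φ (2 * N + 1) + φ (2 * (N + 1))) := by
  have h : 𝔖 ^ N * interpolant s₁ s₂ * star 𝔖 ^ N =
      (4⁻¹ * s₁) • (𝔖 ^ N * star 𝔖 ^ N + (2 : ℂ) • (𝔖 ^ (N + 1) * star 𝔖 ^ N) +
        𝔖 ^ (N + 2) * star 𝔖 ^ N) +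
      (4⁻¹ * s₂) • (𝔖 ^ N * star 𝔖 ^ N - (2 : ℂ) • (𝔖 ^ (N + 1) * star 𝔖 ^ N) +
        𝔖 ^ (N + 2) * star 𝔖 ^ N) := by
    have e : interpolant s₁ s₂ = (4⁻¹ * s₁) • (1 + (2 : ℂ) • 𝔖 + 𝔖 ^ 2) +
        (4⁻¹ * s₂) • (1 - (2 : ℂ) • 𝔖 + 𝔖 ^ 2) := by
      rw [interpolant, two_smul]
      congr 2 <;> noncomm_ring
    rw [e, pow_succ 𝔖 N, pow_add 𝔖 N 2]
    simp only [mul_add, add_mul, mul_sub, sub_mul, mul_smul_comm, smul_mul_assoc, mul_one]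
  rw [h]
  simp only [map_add, map_sub, map_smul, hγ, smul_eq_mul]
  rw [show N + N = 2 * N by ring, show N + 1 + N = 2 * N + 1 by ring,
    show N + 2 + N = 2 * (N + 1) by ring]

theorem exists_unit_mul_eq_norm (c : ℂ) : ∃ s : ℂ, ‖s‖ ≤ 1 ∧ s * c = ‖c‖ := by
  refine ⟨star c / ‖c‖, ?_, ?_⟩
  · rw [norm_div, norm_star]
    simpa using div_self_le_one ‖c‖
  · rcases eq_or_ne c 0 with rfl | hc
    · simp
    · have : (‖c‖ : ℂ) ≠ 0 := by simpa using hc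
      field_simp
      exact RCLike.conj_mul c

/-- A bounded radial functional on the Toeplitz algebra is the sum of multiples of the two
characters `S ↦ ± 1` and a normal functional, and its norm is at least the sum of the norms. -/
theorem exists_radial_decomposition {φ : ℕ → ℂ} {γ : (ellTwo →L[ℂ] ellTwo) →L[ℂ] ℂ}
    (hγ : ∀ i j, γ (𝔖 ^ i * star 𝔖 ^ j) = φ (i + j)) :
    ∃ (c₁ c₂ : ℂ) (α β : ℕ → ellTwo) (τ : ℝ), 0 ≤ τ ∧
      Summable (fun k => ‖α k‖ ^ 2) ∧ Summable (fun k => ‖β k‖ ^ 2) ∧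
      ∑' k, ‖α k‖ ^ 2 ≤ τ ∧ ∑' k, ‖β k‖ ^ 2 ≤ τ ∧ ‖c₁‖ + ‖c₂‖ + τ ≤ ‖γ‖ ∧
      ∀ i j, HasSum (fun k => inner ℂ ((star 𝔖 ^ i) (β k)) ((star 𝔖 ^ j) (α k)))
        (φ (i + j) - (c₁ + c₂ * (-1) ^ (i + j))) := by
  obtain ⟨h, hh⟩ := exists_rankOne_symbol γ
  obtain ⟨W, q, hW, hqin, hWq, hWh⟩ := exists_polar_sqrt h
  have htr : ∀ k, inner ℂ (W (stdVec k)) (h (stdVec k)) = ((‖q (stdVec k)‖ ^ 2 : ℝ) : ℂ) :=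
    fun k => by
      rw [hWh, ← hqin, inner_self_eq_norm_sq_to_K]
      simp
  have hlim : ∀ n, Tendsto (fun N => ∑ k ∈ Finset.range n,
      inner ℂ (truncate N (W (stdVec k))) (h (stdVec k))) atTop
      (𝓝 ((∑ k ∈ Finset.range n, ‖q (stdVec k)‖ ^ 2 : ℝ) : ℂ)) := fun n => by
    rw [Complex.ofReal_sum]
    simp_rw [← htr]
    exact tendsto_finsetSum _ fun k _ => (tendsto_truncate _).inner tendsto_const_nhds
  have hbound : ∀ n, ∑ k ∈ Finset.range n, ‖q (stdVec k)‖ ^ 2 ≤ ‖γ‖ := fun n => by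
    have h1 := (hlim n).norm
    have h2 : ‖((∑ k ∈ Finset.range n, ‖q (stdVec k)‖ ^ 2 : ℝ) : ℂ)‖ ≤ ‖γ‖ := by
      refine le_of_tendsto h1 (eventually_atTop.2 ⟨n, fun N hN => ?_⟩)
      -- With s₁ = s₂ = 0 the shifted block disappears and only the trace remains.
      simpa [interpolant] using norm_symbol_trace_add_le γ hh hW hN
        (s₁ := 0) (s₂ := 0) (by simp) (by simp)
    exact (le_abs_self _).trans (by rwa [Complex.norm_real] at h2)
  -- From h = W q q, the pair β = q eₖ, α = W q eₖ shares the weight evenly: both square sums are at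
  -- most the trace of q².
  let β : ℕ → ellTwo := fun k => q (stdVec k)
  let α : ℕ → ellTwo := fun k => W (β k)
  have hβ : Summable fun k => ‖β k‖ ^ 2 :=
    summable_of_sum_range_le (fun k => by positivity) hbound
  have hαβ : ∀ k, ‖α k‖ ^ 2 ≤ ‖β k‖ ^ 2 := fun k => pow_le_pow_left₀ (norm_nonneg _) (hW _) 2
  have hα : Summable fun k => ‖α k‖ ^ 2 :=
    Summable.of_nonneg_of_le (fun k => by positivity) hαβ hβ
  have hdom : ∀ i j k, ‖inner ℂ ((star 𝔖 ^ i) (β k)) ((star 𝔖 ^ j) (α k))‖ ≤ ‖β k‖ ^ 2 :=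
    fun i j k => by
      refine (norm_inner_le_norm _ _).trans ?_
      rw [sq]
      exact mul_le_mul (norm_star_shift_pow_apply_le _ _)
        ((norm_star_shift_pow_apply_le _ _).trans (hW _)) (norm_nonneg _) (norm_nonneg _)
  have hsum : ∀ i j, Summable fun k => inner ℂ ((star 𝔖 ^ i) (β k)) ((star 𝔖 ^ j) (α k)) :=
    fun i j => Summable.of_norm_bounded hβ (hdom i j)
  let ν : ℕ → ℕ → ℂ := fun i j => ∑' k, inner ℂ ((star 𝔖 ^ i) (β k)) ((star 𝔖 ^ j) (α k))
  -- Powers of S* tend strongly to zero, and ‖βₖ‖² dominates the summands.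
  have hν0 : ∀ i j, Tendsto (fun m => ν (i + m) (j + m)) atTop (𝓝 0) := fun i j => by
    have h1 : Tendsto (fun m => ν (i + m) (j + m)) atTop (𝓝 (∑' _ : ℕ, (0 : ℂ))) := by
      refine tendsto_tsum_of_dominated_convergence hβ (fun k => ?_)
        (Eventually.of_forall fun m k => hdom _ _ k)
      have t1 := (tendsto_star_shift_pow (β k)).comp (tendsto_add_atTop_nat i)
      have t2 := (tendsto_star_shift_pow (α k)).comp (tendsto_add_atTop_nat j)
      have t3 := Filter.Tendsto.inner (𝕜 := ℂ) t1 t2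
      simpa [Function.comp_def, add_comm] using t3
    simpa using h1
  have hbasis : ∀ f g : ellTwo, HasSum (fun k => star (f k) * g k) (inner ℂ f g) := fun f g => by
    have h1 := lp.hasSum_inner (𝕜 := ℂ) f g
    rwa [show (fun k => inner ℂ (f k) (g k)) = fun k => star (f k) * g k from
      funext fun k => mul_comm (g k) (star (f k))] at h1
  -- Both ν(i, j) and φ(i+j) change by the value of γ on the same rank one operator when i and j are
  -- increased by one, so their difference is constant along diagonals.
  have hνstep : ∀ i j, ν i j - ν (i + 1) (j + 1) = φ (i + j) - φ (i + j + 2) := fun i j => by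
    have h1 : ∀ k, inner ℂ ((star 𝔖 ^ i) (β k)) ((star 𝔖 ^ j) (α k)) -
        inner ℂ ((star 𝔖 ^ (i + 1)) (β k)) ((star 𝔖 ^ (j + 1)) (α k)) =
        star (β k i) * α k j := fun k => by
      rw [inner_star_shift_pow, inner_star_shift_pow, ← inner_sub_right]
      have := congrArg (fun T => inner ℂ (β k) (T (α k))) (shift_pow_sub_eq_rankOne i j)
      refine this.trans ?_
      rw [InnerProductSpace.rankOne_apply, inner_smul_right, inner_stdVec_left,
        inner_stdVec_right, mul_comm]
    have h2 : ν i j - ν (i + 1) (j + 1) = ∑' k, star (β k i) * α k j := by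
      rw [← (hsum i j).tsum_sub (hsum (i + 1) (j + 1))]
      exact tsum_congr h1
    have h3 : inner ℂ (stdVec j) (h (stdVec i)) = ∑' k, star (β k i) * α k j := by
      rw [hWq, ← ContinuousLinearMap.adjoint_inner_left, ← hqin, ← (hbasis _ _).tsum_eq]
      refine tsum_congr fun k => ?_
      rw [← inner_stdVec_right, hqin, ContinuousLinearMap.adjoint_inner_left, inner_stdVec_left,
        ← inner_stdVec_left k, ← hqin, inner_stdVec_right, mul_comm]
    rw [h2, ← h3, hh, ← shift_pow_sub_eq_rankOne, map_sub, hγ, hγ]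
    congr 2
    ring
  have hconst : ∀ i j m, φ (i + j) - ν i j = φ (i + j + 2 * m) - ν (i + m) (j + m) :=
    fun i j m => by
      induction m with
      | zero => simp
      | succ m ih =>
        have := hνstep (i + m) (j + m)
        rw [ih]
        rw [show i + m + (j + m) = i + j + 2 * m by ring] at this
        rw [show i + j + 2 * (m + 1) = i + j + 2 * m + 2 by ring,
          ← add_assoc, ← add_assoc]
        linear_combination -this
  have hφlim : ∀ i j, Tendsto (fun m => φ (i + j + 2 * m)) atTop (𝓝 (φ (i + j) - ν i j)) :=
    fun i j => by
      have h1 : ∀ m, φ (i + j + 2 * m) = φ (i + j) - ν i j + ν (i + m) (j + m) := fun m => by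
        rw [hconst i j m]
        ring
      simp_rw [h1]
      simpa using tendsto_const_nhds.add (hν0 i j)
  -- L n is the limit of φ(n + 2m), hence has period two and is a combination of 1 and (-1)ⁿ.
  let L : ℕ → ℂ := fun n => φ n - ν n 0
  have hL : ∀ n, Tendsto (fun m => φ (n + 2 * m)) atTop (𝓝 (L n)) := fun n => hφlim n 0
  have hL2 : ∀ n, L (n + 2) = L n := fun n => by
    refine tendsto_nhds_unique (hL (n + 2)) ?_
    have := (hL n).comp (tendsto_add_atTop_nat 1)
    refine this.congr fun m => ?_
    simp only [Function.comp_apply]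
    congr 1
    ring
  let c₁ : ℂ := (L 0 + L 1) / 2
  let c₂ : ℂ := (L 0 - L 1) / 2
  have hLc : ∀ n, L n = c₁ + c₂ * (-1) ^ n := fun n => by
    induction n using Nat.twoStepInduction with
    | zero => simp only [c₁, c₂]; ring
    | one => simp only [c₁, c₂]; ring
    | more n ih _ => rw [hL2, ih, pow_add]; norm_num
  have hνL : ∀ i j, φ (i + j) - ν i j = L (i + j) := fun i j =>
    tendsto_nhds_unique (hφlim i j) (hL (i + j))
  obtain ⟨s₁, hs₁, hsc₁⟩ := exists_unit_mul_eq_norm c₁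
  obtain ⟨s₂, hs₂, hsc₂⟩ := exists_unit_mul_eq_norm c₂
  -- The phases s₁, s₂ rotate c₁, c₂ to their absolute values. As N grows, the interpolant
  -- contributes s₁c₁ + s₂c₂, because L 0 ± L 1 equals 2c₁ and 2c₂.
  have hfinal : ∀ n, ‖c₁‖ + ‖c₂‖ + ∑ k ∈ Finset.range n, ‖β k‖ ^ 2 ≤ ‖γ‖ := fun n => by
    have e0 : Tendsto (fun N => φ (2 * N)) atTop (𝓝 (L 0)) := by simpa using hL 0
    have e1 : Tendsto (fun N => φ (2 * N + 1)) atTop (𝓝 (L 1)) := by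
      simpa [add_comm] using hL 1
    have e2 : Tendsto (fun N => φ (2 * (N + 1))) atTop (𝓝 (L 0)) :=
      e0.comp (tendsto_add_atTop_nat 1)
    have h1 : Tendsto (fun N => γ (𝔖 ^ N * interpolant s₁ s₂ * star 𝔖 ^ N)) atTop
        (𝓝 (‖c₁‖ + ‖c₂‖ : ℂ)) := by
      simp_rw [radial_interpolant hγ]
      have := (((e0.add (e1.const_mul 2)).add e2).const_mul (4⁻¹ * s₁)).add
        (((e0.sub (e1.const_mul 2)).add e2).const_mul (4⁻¹ * s₂))
      convert this using 2
      rw [← hsc₁, ← hsc₂]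
      simp only [c₁, c₂]
      ring
    have h2 := ((hlim n).add h1).norm
    have h3 := le_of_tendsto h2 (eventually_atTop.2 ⟨n, fun N hN =>
      norm_symbol_trace_add_le γ hh hW hN hs₁ hs₂⟩)
    refine le_trans ?_ h3
    rw [← Complex.ofReal_add, ← Complex.ofReal_add, Complex.norm_real]
    refine le_trans (le_of_eq ?_) (le_abs_self _)
    ring
  refine ⟨c₁, c₂, α, β, ∑' k, ‖β k‖ ^ 2, tsum_nonneg fun k => by positivity, hα, hβ,
    hα.tsum_le_tsum hαβ hβ, le_rfl, ?_, fun i j => ?_⟩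
  · have h1 := hβ.hasSum.tendsto_sum_nat.const_add (‖c₁‖ + ‖c₂‖)
    exact le_of_tendsto h1 (Eventually.of_forall hfinal)
  · rw [← hLc, ← hνL, sub_sub_cancel]
    exact (hsum i j).hasSum

end Toeplitz

end FreeArakiWoods

end

noncomputable section


namespace FreeArakiWoods

open ContinuousLinearMap (adjoint)

/-! ### Uniqueness theorems for holomorphic functions -/

section EntireFunctions

open Complex Filter Topology

/-- Two entire functions that agree on the real line are equal. -/
theorem eq_of_eqOn_real {X : Type*} [NormedAddCommGroup X] [NormedSpace ℂ X] [CompleteSpace X]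
    {f g : ℂ → X} (hf : Differentiable ℂ f) (hg : Differentiable ℂ g)
    (h : ∀ t : ℝ, f t = g t) : f = g := by
  refine AnalyticOnNhd.eq_of_frequently_eq (z₀ := 0)
    (hf.differentiableOn.analyticOnNhd isOpen_univ) (hg.differentiableOn.analyticOnNhd isOpen_univ) ?_
  have ht : Tendsto (fun t : ℝ => (t : ℂ)) (𝓝[≠] 0) (𝓝[≠] 0) := by
    refine tendsto_nhdsWithin_iff.2 ⟨?_, ?_⟩
    · exact (continuous_ofReal.tendsto' 0 0 (by simp)).mono_left nhdsWithin_le_nhds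
    · filter_upwards [self_mem_nhdsWithin] with t ht
      simpa using ht
  exact ht.frequently (Frequently.of_forall h)

/-- If `g` is entire and bounded on horizontal strips and `g (z + i) = - g z`, then `g = 0`. -/
theorem eq_zero_of_antiperiodic {g : ℂ → ℂ} (hg : Differentiable ℂ g)
    (hb : ∃ C, ∀ z : ℂ, 0 ≤ z.im → z.im ≤ 1 → ‖g z‖ ≤ C) (ha : ∀ z, g (z + I) = - g z) (z : ℂ) :
    g z = 0 := by
  obtain ⟨C, hC⟩ := hb
  have hp : ∀ z, ‖g (z + I)‖ = ‖g z‖ := fun z => by rw [ha, norm_neg]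
  have hn : ∀ (n : ℕ) z, ‖g (z + n * I)‖ = ‖g z‖ := by
    intro n
    induction n with
    | zero => simp
    | succ n ih =>
      intro z
      rw [Nat.cast_succ, add_mul, one_mul, ← add_assoc, hp, ih]
  have hz : ∀ (n : ℤ) z, ‖g (z + n * I)‖ = ‖g z‖ := by
    intro n z
    obtain ⟨n, rfl | rfl⟩ := n.eq_nat_or_neg
    · exact_mod_cast hn n z
    · rw [← hn n (z + ((-n : ℤ) : ℂ) * I)]
      congr 2
      push_cast
      ring
  -- |g| has period i, so its bound on one strip is global; Liouville makes g constant, and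
  -- antiperiodicity then forces the constant to be zero.
  have hbd : Bornology.IsBounded (Set.range g) := by
    refine isBounded_iff_forall_norm_le.2 ⟨C, ?_⟩
    rintro _ ⟨z, rfl⟩
    rw [← hz (-⌊z.im⌋) z]
    refine hC _ ?_ ?_
    · simpa using Int.floor_le z.im
    · have := (Int.lt_floor_add_one z.im).le
      simp
      linarith
  have h := hg.apply_eq_apply_of_bounded hbd (z + I) z
  rw [ha] at h
  exact self_eq_neg.1 h.symm

theorem isOpen_strip (a b : ℝ) : IsOpen (im ⁻¹' Set.Ioo a b) := isOpen_Ioo.preimage continuous_im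

/-- A function holomorphic in the strip `-1 < Im z < 0` with boundary values `0` on the real line
vanishes. -/
theorem eq_zero_of_boundary_zero {f : ℂ → ℂ} (hf : DiffContOnCl ℂ f (im ⁻¹' Set.Ioo (-1) 0))
    (h0 : ∀ t : ℝ, f t = 0) : f (-I) = 0 := by
  have hzero : ∀ p : ℂ, -(1 / 2) < p.im → p.im < 0 → f p = 0 := by
    intro p hp1 hp2
    set h : ℝ := -p.im with hh
    -- The square centred at p with half side h = -Im p has its upper side on the real line. The
    -- product of the four copies of f rotated about p by multiples of a right angle vanishes on
    -- every side, so the maximum principle gives f(p)⁴ = 0. The restriction Im p > -1/2 keeps the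
    -- square inside the strip.
    set Q : Set ℂ := Set.Ioo (-h) h ×ℂ Set.Ioo (-h) h with hQ
    have hpos : 0 < h := by rw [hh]; linarith
    have hcomp : ∀ c : ℂ, (c = 1 ∨ c = I ∨ c = -1 ∨ c = -I) →
        DiffContOnCl ℂ (fun w => f (p + c * w)) Q := by
      intro c hc
      have hd : Differentiable ℂ fun w : ℂ => p + c * w := by fun_prop
      refine hf.comp hd.diffContOnCl ?_
      intro w hw
      rw [hQ, mem_reProdIm, Set.mem_Ioo, Set.mem_Ioo] at hw
      rw [Set.mem_preimage, Set.mem_Ioo]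
      rcases hc with rfl | rfl | rfl | rfl <;> simp <;> constructor <;> linarith
    have hg : DiffContOnCl ℂ (fun w => (f (p + 1 * w) * f (p + I * w)) *
        (f (p + (-1) * w) * f (p + (-I) * w))) Q :=
      ((hcomp 1 (by simp)).smul (hcomp I (by simp))).smul
        ((hcomp (-1) (by simp)).smul (hcomp (-I) (by simp)))
    have hbQ : Bornology.IsBounded Q := (Metric.isBounded_Ioo _ _).reProdIm (Metric.isBounded_Ioo _ _)
    have hreal : ∀ z : ℂ, z.im = 0 → f z = 0 := fun z hz => by
      rw [← h0 z.re]
      congr 1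
      exact Complex.ext (by simp) (by simp [hz])
    have hfr : ∀ z ∈ frontier Q, ‖(f (p + 1 * z) * f (p + I * z)) *
        (f (p + (-1) * z) * f (p + (-I) * z))‖ ≤ 0 := by
      intro z hz
      rw [hQ, frontier_reProdIm, frontier_Ioo (by linarith)] at hz
      have hcases : z.im = h ∨ z.im = -h ∨ z.re = h ∨ z.re = -h := by
        rcases hz with hz | hz <;> simp only [mem_reProdIm, Set.mem_insert_iff,
          Set.mem_singleton_iff] at hz <;> tauto
      rcases hcases with hz | hz | hz | hz
      · rw [hreal (p + 1 * z) (by simp [hz, hh])]; simp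
      · rw [hreal (p + (-1) * z) (by simp [hz, hh])]; simp
      · rw [hreal (p + I * z) (by simp [hz, hh])]; simp
      · rw [hreal (p + (-I) * z) (by simp [hz, hh])]; simp
    have h00 : (0 : ℂ) ∈ closure Q := subset_closure (by
      rw [hQ, mem_reProdIm]; simp [hpos])
    have := norm_le_of_forall_mem_frontier_norm_le hbQ hg hfr h00
    have h4 := norm_le_zero_iff.1 this
    simpa using h4
  -- The upper half of the strip is open, so the identity theorem carries the vanishing to the rest.
  have hin : Set.EqOn f 0 (im ⁻¹' Set.Ioo (-1) 0) := by
    have hconv : IsPreconnected (im ⁻¹' Set.Ioo (-1 : ℝ) 0) :=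
      ((convex_Ioo _ _).linear_preimage imLm).isPreconnected
    refine (hf.differentiableOn.analyticOnNhd (isOpen_strip _ _)).eqOn_zero_of_preconnected_of_eventuallyEq_zero
      hconv (z₀ := -(1 / 4) * I) (by simp; norm_num) ?_
    have : im ⁻¹' Set.Ioo (-(1 / 2) : ℝ) 0 ∈ 𝓝 (-(1 / 4) * I) :=
      (isOpen_strip _ _).mem_nhds (by simp; norm_num)
    filter_upwards [this] with z hz
    exact hzero z hz.1 hz.2
  have hcl : Set.EqOn f 0 (closure (im ⁻¹' Set.Ioo (-1) 0)) :=
    hin.of_subset_closure hf.continuousOn continuousOn_const subset_closure le_rfl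
  refine hcl ?_
  rw [closure_preimage_im, closure_Ioo (by norm_num)]
  simp

end EntireFunctions

/-! ### Entire orbits of a unitary group -/

section Orbits

open Complex Filter Topology MeasureTheory

variable {H : Type u} [NormedAddCommGroup H] [InnerProductSpace ℂ H]

/-- A strongly continuous one-parameter group of isometries of a Hilbert space. -/
structure IsUnitaryGroup (V : ℝ → H →ₗᵢ[ℂ] H) : Prop where
  zero_apply : ∀ x, V 0 x = x
  add_apply : ∀ s t x, V (s + t) x = V s (V t x)
  continuous_apply : ∀ x, Continuous fun t => V t x

/-- The space of entire orbits of a one-parameter group: the entire functions `F` with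
`F (z + t) = V_t (F z)`. -/
def entireOrbits (V : ℝ → H →ₗᵢ[ℂ] H) : Submodule ℂ (ℂ → H) where
  carrier := {F | Differentiable ℂ F ∧ ∀ (z : ℂ) (t : ℝ), F (z + t) = V t (F z)}
  add_mem' := fun {F G} hF hG => ⟨hF.1.add hG.1, fun z t => by
    simp [hF.2 z t, hG.2 z t]⟩
  zero_mem' := ⟨differentiable_const 0, fun z t => by simp⟩
  smul_mem' := fun c F hF => ⟨hF.1.const_smul c, fun z t => by simp [hF.2 z t]⟩

variable {V : ℝ → H →ₗᵢ[ℂ] H}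

theorem IsUnitaryGroup.inner_neg (hV : IsUnitaryGroup V) (t : ℝ) (x y : H) :
    inner ℂ (V (-t) x) y = inner ℂ x (V t y) := by
  rw [← (V t).inner_map_map (V (-t) x) y, ← hV.add_apply, add_neg_cancel, hV.zero_apply]

theorem entireOrbits.comp_add {F : ℂ → H} (hF : F ∈ entireOrbits V) (w : ℂ) :
    (fun z => F (z + w)) ∈ entireOrbits V := by
  refine ⟨hF.1.comp (differentiable_id.add_const w), fun z t => ?_⟩
  rw [← hF.2, add_right_comm]

theorem entireOrbits.norm_eq {F : ℂ → H} (hF : F ∈ entireOrbits V) (z : ℂ) :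
    ‖F z‖ = ‖F (z.im * I)‖ := by
  conv_lhs => rw [← re_add_im z, add_comm, hF.2, LinearIsometry.norm_map]

theorem entireOrbits.exists_bound {F : ℂ → H} (hF : F ∈ entireOrbits V) :
    ∃ C, ∀ z : ℂ, 0 ≤ z.im → z.im ≤ 1 → ‖F z‖ ≤ C := by
  obtain ⟨C, hC⟩ := (isCompact_Icc (a := (0 : ℝ)) (b := 1)).exists_bound_of_continuousOn
    (f := fun s : ℝ => F (s * I))
    ((hF.1.continuous.comp (by fun_prop : Continuous fun s : ℝ => (s : ℂ) * I)).continuousOn)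
  exact ⟨C, fun z h0 h1 => (entireOrbits.norm_eq hF z).trans_le (hC z.im ⟨h0, h1⟩)⟩

theorem differentiable_inner_const_left {F : ℂ → H} (hF : Differentiable ℂ F) (η : H) :
    Differentiable ℂ fun z => inner ℂ η (F z) :=
  (innerSL ℂ η).differentiable.comp hF

open ComplexConjugate in
theorem differentiable_inner_conj {F : ℂ → H} (hF : Differentiable ℂ F) (η : H) :
    Differentiable ℂ fun z => inner ℂ (F (conj z)) η := by
  intro z
  have h := ((differentiable_inner_const_left hF η) (conj z)).conj_conj
  rw [conj_conj] at h
  refine h.congr_of_eventuallyEq (Eventually.of_forall fun w => ?_)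
  simp

open ComplexConjugate in
/-- The sesquilinear form of two entire orbits is invariant under complex translations. -/
theorem IsUnitaryGroup.inner_orbit (hV : IsUnitaryGroup V) {F G : ℂ → H} (hF : F ∈ entireOrbits V)
    (hG : G ∈ entireOrbits V) (z w : ℂ) :
    inner ℂ (F (conj w)) (G z) = inner ℂ (F 0) (G (z - w)) := by
  -- Both sides are entire in w, and for real w the identity is unitarity of the group.
  have h := eq_of_eqOn_real (differentiable_inner_conj hF.1 (G z))
    ((differentiable_inner_const_left hG.1 (F 0)).comp
      ((differentiable_const z).sub differentiable_id)) (fun t => ?_)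
  · exact congrFun h w
  · have h1 := hF.2 0 t
    have h2 := hG.2 z (-t)
    simp only [conj_ofReal, Function.comp_apply, id_eq, zero_add, Pi.sub_apply] at h1 ⊢
    rw [h1, sub_eq_add_neg, ← ofReal_neg, h2, ← hV.inner_neg, neg_neg]

/-- With F z = A^{iz} ξ this says ⟨ξ, A⁻¹ξ⟩ = ‖A^{-1/2} ξ‖²: half of the translation is moved to the
other side. It supplies the positivity of A⁻¹ without a spectral theorem. -/
theorem IsUnitaryGroup.inner_zero_I (hV : IsUnitaryGroup V) {F : ℂ → H}
    (hF : F ∈ entireOrbits V) :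
    inner ℂ (F 0) (F I) = ((‖F (I / 2)‖ ^ 2 : ℝ) : ℂ) := by
  have h := hV.inner_orbit hF hF (I / 2) (-(I / 2))
  rw [sub_neg_eq_add, add_halves] at h
  rw [← h]
  have : (starRingEnd ℂ) (-(I / 2)) = I / 2 := by
    rw [map_neg, map_div₀, conj_I, map_ofNat, neg_div, neg_neg]
  rw [this, inner_self_eq_norm_sq_to_K]
  push_cast
  rfl

theorem IsUnitaryGroup.norm_sq_le_norm_add_sq (hV : IsUnitaryGroup V) {F : ℂ → H}
    (hF : F ∈ entireOrbits V) : ‖F 0‖ ^ 2 + ‖F I‖ ^ 2 ≤ ‖F 0 + F I‖ ^ 2 := by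
  have h := norm_add_sq (𝕜 := ℂ) (F 0) (F I)
  rw [hV.inner_zero_I hF] at h
  have : RCLike.re ((‖F (I / 2)‖ ^ 2 : ℝ) : ℂ) = ‖F (I / 2)‖ ^ 2 := Complex.ofReal_re _
  rw [this] at h
  nlinarith [sq_nonneg ‖F (I / 2)‖]

/-- An entire orbit is bounded on the strip `0 ≤ Im z ≤ 1` by the norm of `F 0 + F i`. -/
theorem IsUnitaryGroup.norm_orbit_le (hV : IsUnitaryGroup V) {F : ℂ → H}
    (hF : F ∈ entireOrbits V) {z : ℂ} (h0 : 0 ≤ z.im) (h1 : z.im ≤ 1) : ‖F z‖ ≤ ‖F 0 + F I‖ := by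
  have hsq := hV.norm_sq_le_norm_add_sq hF
  have hA : ‖F 0‖ ≤ ‖F 0 + F I‖ :=
    abs_le_of_sq_le_sq' (by nlinarith [sq_nonneg ‖F I‖]) (norm_nonneg _) |>.2
  have hB : ‖F I‖ ≤ ‖F 0 + F I‖ :=
    abs_le_of_sq_le_sq' (by nlinarith [sq_nonneg ‖F 0‖]) (norm_nonneg _) |>.2
  refine PhragmenLindelof.horizontal_strip (a := 0) (b := 1) hF.1.diffContOnCl ?_ ?_ ?_ h0 h1
  -- Orbits are bounded on the strip, so the growth condition of Phragmén–Lindelöf holds with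
  -- exponent zero.
  · refine ⟨0, by simp [Real.pi_pos], 0, ?_⟩
    obtain ⟨C, hC⟩ := entireOrbits.exists_bound hF
    refine Asymptotics.IsBigO.of_bound C ?_
    refine eventually_inf_principal.2 (Eventually.of_forall fun z hz => ?_)
    simpa using hC z hz.1.le hz.2.le
  · intro z hz
    rw [entireOrbits.norm_eq hF, hz]
    simpa using hA
  · intro z hz
    rw [entireOrbits.norm_eq hF, hz]
    simpa using hB

end Orbits

/-! ### Gaussian regularisation and totality of entire orbits -/

section Gaussian

open Complex Filter Topology MeasureTheory

variable {H : Type u} [NormedAddCommGroup H] [InnerProductSpace ℂ H]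
  {V : ℝ → H →ₗᵢ[ℂ] H}

/-- The Gaussian regularisation of an orbit. -/
def gaussianOrbit (V : ℝ → H →ₗᵢ[ℂ] H) (a : ℝ) (ξ : H) (z : ℂ) : H :=
  ∫ s : ℝ, Complex.exp (-a * (s - z) ^ 2) • V s ξ

/-- The real part of (s-z)² is (s - Re z)² - (Im z)², and (s - Re z)² ≥ s²/2 - (Re z)² follows from
(s - 2 Re z)² ≥ 0. The resulting bound is uniform for z in a ball, as differentiation under the
integral requires. -/
theorem norm_exp_gaussian_le {a : ℝ} (ha : 0 < a) (s : ℝ) {z : ℂ} {R : ℝ} (hz : ‖z‖ ≤ R) :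
    ‖Complex.exp (-a * (s - z) ^ 2)‖ ≤ Real.exp (a * R ^ 2) * Real.exp (-(a / 2) * s ^ 2) := by
  rw [Complex.norm_exp, ← Real.exp_add]
  refine Real.exp_le_exp.2 ?_
  have hre : (-(a : ℂ) * (s - z) ^ 2).re = -a * ((s - z.re) ^ 2 - z.im ^ 2) := by
    simp [pow_two]
  rw [hre]
  have hn : z.re ^ 2 + z.im ^ 2 ≤ R ^ 2 := by
    have h := Complex.sq_norm z
    rw [Complex.normSq_apply] at h
    have : ‖z‖ ^ 2 ≤ R ^ 2 := pow_le_pow_left₀ (norm_nonneg _) hz 2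
    nlinarith
  nlinarith [mul_nonneg ha.le (sq_nonneg (s - 2 * z.re)), mul_le_mul_of_nonneg_left hn ha.le]

theorem hasDerivAt_gaussianOrbit (hV : IsUnitaryGroup V) {a : ℝ} (ha : 0 < a) (ξ : H) (z₀ : ℂ) :
    Integrable (fun s : ℝ => Complex.exp (-a * (s - z₀) ^ 2) • V s ξ) ∧
      DifferentiableAt ℂ (gaussianOrbit V a ξ) z₀ := by
  set R : ℝ := ‖z₀‖ + 1
  have hR : ∀ z ∈ Metric.ball z₀ 1, ‖z‖ ≤ R := fun z hz => by
    have := norm_le_norm_add_norm_sub' z z₀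
    rw [mem_ball_iff_norm] at hz
    change ‖z‖ ≤ ‖z₀‖ + 1
    linarith
  have hcont := hV.continuous_apply ξ
  have hI0 : Integrable fun s : ℝ => Real.exp (-(a / 2) * s ^ 2) :=
    integrable_exp_neg_mul_sq (by positivity)
  have hI1 : Integrable fun s : ℝ => ‖s * Real.exp (-(a / 2) * s ^ 2)‖ :=
    (integrable_mul_exp_neg_mul_sq (by positivity)).norm
  have hint : Integrable (fun s : ℝ => Complex.exp (-a * (s - z₀) ^ 2) • V s ξ) := by
    refine Integrable.mono' ((hI0.const_mul (Real.exp (a * R ^ 2))).mul_const ‖ξ‖)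
      (Continuous.aestronglyMeasurable (by fun_prop)) (Eventually.of_forall fun s => ?_)
    rw [norm_smul, LinearIsometry.norm_map]
    exact mul_le_mul_of_nonneg_right
      (norm_exp_gaussian_le ha s (hR z₀ (Metric.mem_ball_self one_pos))) (norm_nonneg _)
  refine ⟨hint, ?_⟩
  refine (hasDerivAt_integral_of_dominated_loc_of_deriv_le (𝕜 := ℂ) (μ := volume)
    (F := fun (z : ℂ) (s : ℝ) => Complex.exp (-a * (s - z) ^ 2) • V s ξ)
    (F' := fun (z : ℂ) (s : ℝ) =>
      (Complex.exp (-a * (s - z) ^ 2) * (2 * a * (s - z))) • V s ξ)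
    (bound := fun s : ℝ => (Real.exp (a * R ^ 2) * (2 * a) * ‖ξ‖) *
      (‖s * Real.exp (-(a / 2) * s ^ 2)‖ + R * Real.exp (-(a / 2) * s ^ 2)))
    (Metric.ball_mem_nhds z₀ one_pos) (Eventually.of_forall fun z =>
      Continuous.aestronglyMeasurable (by fun_prop)) hint
    (Continuous.aestronglyMeasurable (by fun_prop)) (Eventually.of_forall fun s z hz => ?_)
    ((hI1.add (hI0.const_mul R)).const_mul _)
    (Eventually.of_forall fun s z hz => ?_)).2.differentiableAt
  · have h1 := norm_exp_gaussian_le ha s (hR z hz)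
    have h2 : ‖(2 * a * (s - z) : ℂ)‖ ≤ 2 * a * (|s| + R) := by
      rw [norm_mul, norm_mul, Complex.norm_real, Real.norm_of_nonneg ha.le]
      have := norm_sub_le (s : ℂ) z
      rw [Complex.norm_real, Real.norm_eq_abs] at this
      have h3 := hR z hz
      simp only [Complex.norm_ofNat]
      gcongr
      linarith
    rw [norm_smul, LinearIsometry.norm_map, norm_mul, norm_mul s, Real.norm_eq_abs s,
      Real.norm_of_nonneg (Real.exp_pos _).le]
    calc _ ≤ (Real.exp (a * R ^ 2) * Real.exp (-(a / 2) * s ^ 2)) * (2 * a * (|s| + R)) * ‖ξ‖ := by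
          gcongr
      _ = _ := by ring
  · have h : HasDerivAt (fun z : ℂ => -(a : ℂ) * (s - z) ^ 2) (2 * a * (s - z)) z := by
      have := (((hasDerivAt_id z).const_sub (s : ℂ)).pow 2).const_mul (-(a : ℂ))
      refine this.congr_deriv ?_
      norm_num
      ring
    exact h.cexp.smul_const (V s ξ)

variable [CompleteSpace H]

theorem gaussianOrbit_mem (hV : IsUnitaryGroup V) {a : ℝ} (ha : 0 < a) (ξ : H) :
    gaussianOrbit V a ξ ∈ entireOrbits V := by
  refine ⟨fun z => (hasDerivAt_gaussianOrbit hV ha ξ z).2, fun z t => ?_⟩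
  unfold gaussianOrbit
  rw [← LinearIsometry.integral_comp_comm,
    ← integral_add_right_eq_self (fun s : ℝ => Complex.exp (-a * (s - (z + t)) ^ 2) • V s ξ) t]
  refine integral_congr_ae (Eventually.of_forall fun s => ?_)
  simp only
  rw [map_smul, ← hV.add_apply, add_comm t s]
  congr 3
  push_cast
  ring

/-- The values of the entire orbits at `0` form a total set. -/
theorem IsUnitaryGroup.eq_zero_of_inner_orbit (hV : IsUnitaryGroup V) {η : H}
    (h : ∀ F ∈ entireOrbits V, inner ℂ η (F 0) = 0) : η = 0 := by
  refine ext_inner_right ℂ fun ξ => ?_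
  rw [inner_zero_left]
  -- The width a = (n+1)² and the substitution s ↦ s/(n+1) give a fixed Gaussian weight, while the
  -- group parameter is contracted to 0. The limit isolates ⟨η, ξ⟩.
  have hint : ∀ n : ℕ, ∫ s : ℝ, Real.exp (-s ^ 2) • inner ℂ η (V (((n : ℝ) + 1)⁻¹ * s) ξ) = 0 := by
    intro n
    have hpos : (0 : ℝ) < (n : ℝ) + 1 := by positivity
    have h1 := h _ (gaussianOrbit_mem hV (a := ((n : ℝ) + 1) ^ 2) (by positivity) ξ)
    unfold gaussianOrbit at h1
    rw [← integral_inner (hasDerivAt_gaussianOrbit hV (by positivity) ξ 0).1] at h1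
    have h2 := Measure.integral_comp_mul_left
      (fun s : ℝ => Real.exp (-s ^ 2) • inner ℂ η (V (((n : ℝ) + 1)⁻¹ * s) ξ)) ((n : ℝ) + 1)
    refine (smul_eq_zero.1 (h2.symm.trans ?_)).resolve_left (abs_pos.2 (inv_pos.2 hpos).ne').ne'
    rw [← h1]
    refine integral_congr_ae (Eventually.of_forall fun s => ?_)
    simp only
    rw [inv_mul_cancel_left₀ hpos.ne', inner_smul_right, Complex.real_smul]
    congr 1
    push_cast
    congr 1
    ring
  have hlim : Tendsto
      (fun n : ℕ => ∫ s : ℝ, Real.exp (-s ^ 2) • inner ℂ η (V (((n : ℝ) + 1)⁻¹ * s) ξ)) atTop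
      (𝓝 (∫ s : ℝ, Real.exp (-s ^ 2) • inner ℂ η ξ)) := by
    have hI : Integrable fun s : ℝ => Real.exp (-s ^ 2) := by
      simpa using integrable_exp_neg_mul_sq (b := 1) one_pos
    have hcont := hV.continuous_apply ξ
    refine tendsto_integral_of_dominated_convergence
      (fun s => Real.exp (-s ^ 2) * (‖η‖ * ‖ξ‖)) (fun n => ?_) (hI.mul_const _) (fun n => ?_) ?_
    · have : Continuous fun s : ℝ => V (((n : ℝ) + 1)⁻¹ * s) ξ := hcont.comp (by fun_prop)
      exact Continuous.aestronglyMeasurable (by fun_prop)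
    · refine Eventually.of_forall fun s => ?_
      rw [norm_smul, Real.norm_of_nonneg (Real.exp_pos _).le]
      gcongr
      refine (norm_inner_le_norm _ _).trans_eq ?_
      rw [LinearIsometry.norm_map]
    · refine Eventually.of_forall fun s => Tendsto.const_smul ?_ _
      refine tendsto_const_nhds.inner ?_
      have hk : Tendsto (fun n : ℕ => ((n : ℝ) + 1)⁻¹ * s) atTop (𝓝 0) := by
        simpa using (tendsto_one_div_add_atTop_nhds_zero_nat (𝕜 := ℝ)).mul_const s
      have := (hcont.tendsto 0).comp hk
      rwa [hV.zero_apply] at this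
  have hz := tendsto_nhds_unique hlim (by simp only [hint]; exact tendsto_const_nhds)
  rw [integral_smul_const] at hz
  refine (smul_eq_zero.1 hz).resolve_left ?_
  have := integral_gaussian 1
  simp only [neg_mul, one_mul, div_one] at this
  rw [this]
  positivity

/-- The vectors `F 0 + F i` are total. -/
theorem IsUnitaryGroup.eq_zero_of_inner_add (hV : IsUnitaryGroup V) {η : H}
    (h : ∀ F ∈ entireOrbits V, inner ℂ η (F 0 + F I) = 0) : η = 0 := by
  refine hV.eq_zero_of_inner_orbit fun F hF => ?_
  -- Translates of entire orbits are entire orbits, so the hypothesis gives g(z) + g(z+i) = 0 for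
  -- every z.
  refine eq_zero_of_antiperiodic (g := fun z => inner ℂ η (F z))
    (differentiable_inner_const_left hF.1 η) ?_ (fun z => ?_) 0
  · obtain ⟨C, hC⟩ := entireOrbits.exists_bound hF
    refine ⟨‖η‖ * C, fun z h0 h1 => (norm_inner_le_norm _ _).trans ?_⟩
    gcongr
    exact hC z h0 h1
  · have := h _ (entireOrbits.comp_add hF z)
    rw [inner_add_right, zero_add, add_comm I z] at this
    exact eq_neg_of_add_eq_zero_right this

end Gaussian

end FreeArakiWoods

end

noncomputable section


namespace FreeArakiWoods

set_option linter.unusedSectionVars false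

open ContinuousLinearMap (adjoint)

/-! ### The operator 2(A⁻¹ + 1)⁻¹ from entire orbits -/

section Resolvent

open Complex Filter Topology

variable {H : Type u} [NormedAddCommGroup H] [InnerProductSpace ℂ H]

/-- The map `F ↦ F 0 + F i` on entire orbits. -/
def orbitSum (V : ℝ → H →ₗᵢ[ℂ] H) : entireOrbits V →ₗ[ℂ] H where
  toFun F := F.1 0 + F.1 I
  map_add' F G := by
    change (F.1 0 + G.1 0) + (F.1 I + G.1 I) = _
    abel
  map_smul' c F := by
    change c • F.1 0 + c • F.1 I = _
    rw [← smul_add]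
    rfl

/-- Evaluation of entire orbits. -/
def orbitEval (V : ℝ → H →ₗᵢ[ℂ] H) (z : ℂ) : entireOrbits V →ₗ[ℂ] H where
  toFun F := F.1 z
  map_add' _ _ := rfl
  map_smul' _ _ := rfl

/-- The pair `(χ, η)` lies in the graph of the analytic generator of `V`. -/
def IsAnalyticPair (V : ℝ → H →ₗᵢ[ℂ] H) (χ η : H) : Prop :=
  ∃ F : ℂ → H, DiffContOnCl ℂ F (im ⁻¹' Set.Ioo (-1) 0) ∧ (∀ t : ℝ, F t = V t χ) ∧ F (-I) = η

variable {V : ℝ → H →ₗᵢ[ℂ] H} [CompleteSpace H]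

theorem IsUnitaryGroup.denseRange_orbitSum (hV : IsUnitaryGroup V) : DenseRange (orbitSum V) := by
  have h : (LinearMap.range (orbitSum V))ᗮ = ⊥ := by
    refine (Submodule.eq_bot_iff _).2 fun η hη => hV.eq_zero_of_inner_add fun F hF => ?_
    exact (Submodule.mem_orthogonal' _ _).1 hη _ ⟨⟨F, hF⟩, rfl⟩
  have := Submodule.dense_iff_topologicalClosure_eq_top.2
    (Submodule.topologicalClosure_eq_top_iff.2 h)
  rwa [LinearMap.coe_range] at this

/-- The bounded operator `F 0 + F i ↦ F z`, for `0 ≤ Im z ≤ 1`. -/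
def stripOp (V : ℝ → H →ₗᵢ[ℂ] H) (z : ℂ) : H →L[ℂ] H := (orbitEval V z).extendOfNorm (orbitSum V)

theorem IsUnitaryGroup.stripOp_orbitSum (hV : IsUnitaryGroup V) {z : ℂ} (h0 : 0 ≤ z.im)
    (h1 : z.im ≤ 1) (F : entireOrbits V) : stripOp V z (orbitSum V F) = F.1 z :=
  LinearMap.extendOfNorm_eq hV.denseRange_orbitSum
    ⟨1, fun F => by rw [one_mul]; exact hV.norm_orbit_le F.2 h0 h1⟩ F

theorem IsUnitaryGroup.norm_stripOp_le (hV : IsUnitaryGroup V) {z : ℂ} (h0 : 0 ≤ z.im)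
    (h1 : z.im ≤ 1) (ζ : H) : ‖stripOp V z ζ‖ ≤ ‖ζ‖ := by
  have := LinearMap.norm_extendOfNorm_apply_le (f := orbitEval V z) hV.denseRange_orbitSum 1
    (fun F => by rw [one_mul]; exact hV.norm_orbit_le F.2 h0 h1) ζ
  rwa [one_mul] at this

/-- The bounded operator `2 (A⁻¹ + 1)⁻¹`, sending `F 0 + F i` to `2 F 0`. -/
def resolventOp (V : ℝ → H →ₗᵢ[ℂ] H) : H →L[ℂ] H := (2 : ℂ) • stripOp V 0

theorem IsUnitaryGroup.resolventOp_orbitSum (hV : IsUnitaryGroup V) (F : entireOrbits V) :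
    resolventOp V (orbitSum V F) = (2 : ℂ) • F.1 0 :=
  congrArg (fun x => (2 : ℂ) • x) (hV.stripOp_orbitSum (by simp) (by simp) F)

/-- On the dense set of vectors F 0 + F i the quadratic form equals 2(‖F 0‖² + ‖F(i/2)‖²). -/
theorem IsUnitaryGroup.isPositive_resolventOp (hV : IsUnitaryGroup V) :
    (resolventOp V).IsPositive := by
  refine (ContinuousLinearMap.isPositive_iff_complex _).2 ?_
  have key : ∀ x, (inner ℂ (resolventOp V x) x).im = 0 ∧ 0 ≤ (inner ℂ (resolventOp V x) x).re := by
    intro x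
    have hc : Continuous fun x => inner ℂ (resolventOp V x) x := by fun_prop
    refine hV.denseRange_orbitSum.induction_on x ?_ fun F => ?_
    · exact (isClosed_eq (continuous_im.comp hc) continuous_const).inter
        (isClosed_le continuous_const (continuous_re.comp hc))
    · have h : inner ℂ (resolventOp V (orbitSum V F)) (orbitSum V F) =
          ((2 * (‖F.1 0‖ ^ 2 + ‖F.1 (I / 2)‖ ^ 2) : ℝ) : ℂ) := by
        rw [hV.resolventOp_orbitSum]
        change inner ℂ ((2 : ℂ) • F.1 0) (F.1 0 + F.1 I) = _
        rw [inner_smul_left, inner_add_right, hV.inner_zero_I F.2, inner_self_eq_norm_sq_to_K,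
          map_ofNat]
        push_cast
        rfl
      rw [h]
      refine ⟨ofReal_im _, ?_⟩
      rw [ofReal_re]
      positivity
  exact fun x => ⟨Complex.ext rfl (by simpa using (key x).1.symm), (key x).2⟩

theorem IsUnitaryGroup.isAnalyticPair_resolventOp (hV : IsUnitaryGroup V) (ζ : H) :
    IsAnalyticPair V ((2 : ℂ) • ζ - resolventOp V ζ) (resolventOp V ζ) := by
  -- If ζ = F 0 + F i, then 2ζ minus its image is 2F(i), whose orbit is z ↦ 2F(z+i), with value
  -- 2F(0) at -i. For general ζ the orbit is a uniform limit of such ones, since the strip operators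
  -- are contractions.
  refine ⟨fun z => (2 : ℂ) • stripOp V (z + I) ζ, ?_, ?_, ?_⟩
  · obtain ⟨u, hu⟩ := mem_closure_iff_seq_limit.1 (hV.denseRange_orbitSum ζ)
    obtain ⟨hu1, hu2⟩ := hu
    choose F hF using hu1
    have hcl : closure (im ⁻¹' Set.Ioo (-1) 0) = im ⁻¹' Set.Icc (-1) 0 := by
      rw [closure_preimage_im, closure_Ioo (by norm_num)]
    have hunif : TendstoUniformlyOn (fun n z => (2 : ℂ) • (F n).1 (z + I))
        (fun z => (2 : ℂ) • stripOp V (z + I) ζ) atTop (closure (im ⁻¹' Set.Ioo (-1) 0)) := by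
      rw [hcl]
      refine Metric.tendstoUniformlyOn_iff.2 fun ε hε => ?_
      have h2 := Metric.tendsto_atTop.1 hu2 (ε / 2) (by positivity)
      obtain ⟨N, hN⟩ := h2
      filter_upwards [eventually_ge_atTop N] with n hn z hz
      have h0 : 0 ≤ (z + I).im := by simp; linarith [hz.1]
      have h1 : (z + I).im ≤ 1 := by simp; linarith [hz.2]
      rw [← hV.stripOp_orbitSum h0 h1, hF, dist_eq_norm, ← smul_sub, ← map_sub, norm_smul]
      have h3 := hV.norm_stripOp_le h0 h1 (ζ - u n)
      have h4 := hN n hn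
      rw [dist_eq_norm, norm_sub_rev] at h4
      simp only [Complex.norm_ofNat]
      linarith
    have hd : ∀ n, Differentiable ℂ fun z => (2 : ℂ) • (F n).1 (z + I) := fun n =>
      ((F n).2.1.comp (differentiable_id.add_const I)).const_smul (2 : ℂ)
    refine ⟨?_, ?_⟩
    · exact (hunif.mono subset_closure).tendstoLocallyUniformlyOn.differentiableOn
        (Eventually.of_forall fun n => (hd n).differentiableOn) (isOpen_strip _ _)
    · exact hunif.continuousOn (Frequently.of_forall fun n => (hd n).continuous.continuousOn)
  · intro t
    have h0 : (0 : ℝ) ≤ ((t : ℂ) + I).im := by simp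
    have h1 : ((t : ℂ) + I).im ≤ 1 := by simp
    refine hV.denseRange_orbitSum.induction_on (p := fun ζ => (2 : ℂ) • stripOp V (t + I) ζ =
      V t ((2 : ℂ) • ζ - resolventOp V ζ)) ζ ?_ fun F => ?_
    · exact isClosed_eq (by fun_prop) ((V t).continuous.comp (by fun_prop))
    · rw [hV.stripOp_orbitSum h0 h1, hV.resolventOp_orbitSum]
      change _ = V t ((2 : ℂ) • (F.1 0 + F.1 I) - _)
      rw [smul_add, add_sub_cancel_left, map_smul, ← F.2.2, add_comm]
  · change (2 : ℂ) • stripOp V (-I + I) ζ = _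
    rw [neg_add_cancel]
    rfl

/-- The pairing of the graph of the generator with entire orbits. -/
theorem IsUnitaryGroup.inner_analyticPair (hV : IsUnitaryGroup V) {χ η : H}
    (h : IsAnalyticPair V χ η) {F : ℂ → H} (hF : F ∈ entireOrbits V) :
    inner ℂ (F 0) η = inner ℂ (F (-I)) χ := by
  obtain ⟨G, hG, hGt, rfl⟩ := h
  -- This is the holomorphic continuation of t ↦ ⟨F(-t), χ⟩ = ⟨F 0, V_t χ⟩; comparison with ⟨F 0, G
  -- z⟩ at z = -i gives the pairing.
  have hk : Differentiable ℂ fun z => inner ℂ (F (-(starRingEnd ℂ) z)) χ := by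
    have := differentiable_inner_conj (F := fun z => F (-z)) (hF.1.comp differentiable_neg) χ
    exact this
  have hg : DiffContOnCl ℂ (fun z => inner ℂ (F 0) (G z)) (im ⁻¹' Set.Ioo (-1) 0) :=
    (innerSL ℂ (F 0)).differentiable.comp_diffContOnCl hG
  have := eq_zero_of_boundary_zero (hg.sub hk.diffContOnCl) fun t => ?_
  · have h2 := sub_eq_zero.1 this
    simpa using h2
  · have h1 := hF.2 0 (-t)
    rw [zero_add] at h1
    change inner ℂ (F 0) (G t) - inner ℂ (F (-(starRingEnd ℂ) t)) χ = 0
    rw [conj_ofReal, ← ofReal_neg, h1, hGt, hV.inner_neg, sub_self]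

/-- `2 (A⁻¹ + 1)⁻¹` is determined by its pairings with entire orbits. -/
theorem IsUnitaryGroup.eq_of_inner_add_neg (hV : IsUnitaryGroup V) {x y : H}
    (h : ∀ F ∈ entireOrbits V, inner ℂ (F 0 + F (-I)) x = inner ℂ (F 0 + F (-I)) y) : x = y := by
  refine sub_eq_zero.1 (hV.eq_zero_of_inner_add fun F hF => ?_)
  -- Translating the orbit by i replaces the points 0, -i by i, 0.
  have := h _ (entireOrbits.comp_add hF I)
  rw [zero_add, neg_add_cancel] at this
  rw [← inner_conj_symm, add_comm, inner_sub_right, this, sub_self, map_zero]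

theorem IsUnitaryGroup.inner_of_isAnalyticPair (hV : IsUnitaryGroup V) {x ζ : H}
    (h : IsAnalyticPair V ((2 : ℂ) • ζ - x) x) {F : ℂ → H} (hF : F ∈ entireOrbits V) :
    inner ℂ (F 0 + F (-I)) x = 2 * inner ℂ (F (-I)) ζ := by
  have := hV.inner_analyticPair h hF
  rw [inner_sub_right, inner_smul_right] at this
  rw [inner_add_left, this]
  ring

/-- The analytic pair condition fixes all pairings of x with the vectors F 0 + F(-i), and these are
total. -/
theorem IsUnitaryGroup.eq_resolventOp (hV : IsUnitaryGroup V) {x ζ : H}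
    (h : IsAnalyticPair V ((2 : ℂ) • ζ - x) x) : x = resolventOp V ζ :=
  hV.eq_of_inner_add_neg fun F hF => by
    rw [hV.inner_of_isAnalyticPair h hF,
      hV.inner_of_isAnalyticPair (hV.isAnalyticPair_resolventOp ζ) hF]

theorem IsUnitaryGroup.resolventOp_injective (hV : IsUnitaryGroup V) {ζ : H}
    (h : resolventOp V ζ = 0) : ζ = 0 := by
  refine hV.eq_zero_of_inner_orbit fun F hF => ?_
  have := hV.inner_of_isAnalyticPair (hV.isAnalyticPair_resolventOp ζ)
    (entireOrbits.comp_add hF I)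
  rw [h, inner_zero_right, neg_add_cancel] at this
  rw [← inner_conj_symm, (mul_eq_zero.1 this.symm).resolve_left two_ne_zero, map_zero]

/-- A conjugation commuting with `V` intertwines `2 (A⁻¹ + 1)⁻¹` and `2 (A + 1)⁻¹`. -/
theorem IsUnitaryGroup.conj_resolventOp (hV : IsUnitaryGroup V) (J : H →L⋆[ℂ] H)
    (hJ : ∀ x, J (J x) = x) (hJi : ∀ x y, inner ℂ (J x) (J y) = inner ℂ y x)
    (hJV : ∀ t x, J (V t x) = V t (J x)) (ζ : H) :
    J (resolventOp V (J ζ)) = (2 : ℂ) • ζ - resolventOp V ζ := by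
  refine eq_sub_iff_add_eq.2 (Eq.symm (eq_add_of_sub_eq' ?_))
  refine hV.eq_of_inner_add_neg fun F hF => ?_
  rw [hV.inner_of_isAnalyticPair (hV.isAnalyticPair_resolventOp ζ) hF]
  -- Conjugating both the variable and the value keeps an orbit holomorphic and exchanges i with -i,
  -- that is, A with A⁻¹.
  have hFc : (fun z => J (F ((starRingEnd ℂ) z))) ∈ entireOrbits V := by
    refine ⟨fun z => ?_, fun z t => ?_⟩
    · have := (hF.1 ((starRingEnd ℂ) z)).hasDerivAt.comp_semilinear (starRingEnd ℂ) J
      rw [conj_conj] at this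
      exact this.differentiableAt
    · change J (F ((starRingEnd ℂ) (z + t))) = V t (J (F ((starRingEnd ℂ) z)))
      rw [map_add, conj_ofReal, hF.2, hJV]
  have := hV.inner_of_isAnalyticPair (hV.isAnalyticPair_resolventOp (J ζ))
    (entireOrbits.comp_add hFc I)
  simp only [zero_add, neg_add_cancel, conj_I, map_zero] at this
  rw [← hJ (resolventOp V (J ζ)), ← map_add, hJi, hJi] at this
  rw [inner_sub_right, inner_smul_right, ← inner_conj_symm (F 0 + F (-I)) (J _), add_comm (F 0),
    this, inner_add_left, map_mul, inner_conj_symm, map_ofNat]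
  ring

end Resolvent

/-! ### Square roots and reality of inner products -/

section EmbeddingOperator

open Complex

variable {H : Type u} [NormedAddCommGroup H] [InnerProductSpace ℂ H] [CompleteSpace H]

/-- The positive square root of a positive operator. -/
def posSqrt (T : H →L[ℂ] H) : H →L[ℂ] H := CFC.sqrt T

theorem posSqrt_mul_self {T : H →L[ℂ] H} (hT : T.IsPositive) : posSqrt T * posSqrt T = T :=
  CFC.sqrt_mul_sqrt_self _ ((ContinuousLinearMap.nonneg_iff_isPositive T).2 hT)

theorem isPositive_posSqrt (T : H →L[ℂ] H) : (posSqrt T).IsPositive :=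
  (ContinuousLinearMap.nonneg_iff_isPositive _).1 (CFC.sqrt_nonneg T)

theorem posSqrt_commute {T S : H →L[ℂ] H} (h : Commute T S) : Commute (posSqrt T) S :=
  h.cfcₙ_nnreal _

theorem eq_posSqrt {R T : H →L[ℂ] H} (hR : R.IsPositive) (h : R * R = T) : R = posSqrt T :=
  (CFC.sqrt_unique h ((ContinuousLinearMap.nonneg_iff_isPositive R).2 hR)).symm

/-- If `R` is the square root of `T` and a conjugation `J` exchanges `T` and `2 - T`, then the
real subspaces `R (fix J)` and `J R (fix J)` have real inner products. -/
theorem inner_conj_real {R T : H →L[ℂ] H} (hR : R.IsPositive) (hRT : R * R = T) (J : H →L⋆[ℂ] H)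
    (hJ : ∀ x, J (J x) = x) (hJi : ∀ x y, inner ℂ (J x) (J y) = inner ℂ y x)
    (hJT : ∀ ζ, J (T (J ζ)) = (2 : ℂ) • ζ - T ζ) {x y : H} (hx : J x = x) (hy : J y = y) :
    inner ℂ (J (R y)) (R x) = inner ℂ (R x) (J (R y)) := by
  set R' : H →L[ℂ] H := J.comp (R.comp J) with hR'
  have hR'a : ∀ z, R' z = J (R (J z)) := fun _ => rfl
  have hpos : R'.IsPositive := by
    refine (ContinuousLinearMap.isPositive_iff_complex _).2 fun z => ?_
    have h1 : inner ℂ (R' z) z = inner ℂ (J z) (R (J z)) := by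
      conv_lhs => rw [hR'a, ← hJ z, hJi, hJ]
    rw [h1, ← inner_conj_symm]
    have h2 := (ContinuousLinearMap.isPositive_iff_complex _).1 hR (J z)
    rw [← h2.1]
    simpa using h2.2
  have hsq : R' * R' = (2 : ℂ) • 1 - T := by
    ext z
    change J (R (J (J (R (J z))))) = (2 : ℂ) • z - T z
    rw [hJ, ← hJT, ← hRT]
    rfl
  -- R and R' = JRJ are the positive roots of T and 2 - T, which commute, so the roots commute.
  have hcomm : Commute R R' := by
    have hT : Commute T (R' * R') := by
      rw [hsq]
      exact ((Commute.one_right T).smul_right _).sub_right (Commute.refl T)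
    rw [eq_posSqrt hR hRT, eq_posSqrt hpos rfl]
    exact posSqrt_commute (posSqrt_commute hT.symm).symm
  have hJR : J (R y) = R' y := by rw [hR'a, hy]
  have hRs : ∀ u v, inner ℂ (R u) v = inner ℂ u (R v) := fun u v => hR.isSymmetric u v
  have hRs' : ∀ u v, inner ℂ (R' u) v = inner ℂ u (R' v) := fun u v => hpos.isSymmetric u v
  have h3 : inner ℂ (R x) (R' y) = inner ℂ (R' x) (R y) := by
    rw [hRs, hRs']
    exact congrArg (fun A : H →L[ℂ] H => inner ℂ x (A y)) hcomm.eq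
  have h4 : inner ℂ (R' y) (R x) = inner ℂ (R' x) (R y) := by
    rw [hR'a, hR'a, hx, hy, ← hJ (R x), hJi, hJ]
  rw [hJR, h4, h3]

end EmbeddingOperator

namespace Complexification

open Complex

variable {E : Type u} [NormedAddCommGroup E] [InnerProductSpace ℝ E]

@[simp] theorem re_ofReal (x : E) : (ofReal x).re = x := rfl

@[simp] theorem im_ofReal (x : E) : (ofReal x).im = 0 := rfl

@[simp] theorem re_map (V : E ≃ₗᵢ[ℝ] E) (z : Complexification E) : (map V z).re = V z.re := rfl

@[simp] theorem im_map (V : E ≃ₗᵢ[ℝ] E) (z : Complexification E) : (map V z).im = V z.im := rfl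

theorem norm_eq_norm {z w : Complexification E} (h₁ : ‖z.re‖ = ‖w.re‖) (h₂ : ‖z.im‖ = ‖w.im‖) :
    ‖z‖ = ‖w‖ := by
  refine (pow_left_inj₀ (norm_nonneg _) (norm_nonneg _) two_ne_zero).1 ?_
  rw [norm_sq, norm_sq, h₁, h₂]

/-- The complex-linear extension of an orthogonal transformation, as an isometry. -/
def mapₗᵢ (V : E ≃ₗᵢ[ℝ] E) : Complexification E →ₗᵢ[ℂ] Complexification E where
  toFun := map V
  map_add' z w := by ext <;> simp
  map_smul' c z := by ext <;> simp
  norm_map' z := norm_eq_norm (by simp) (by simp)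

/-- The canonical conjugation `x + i y ↦ x - i y`. -/
def conj : Complexification E →L⋆[ℂ] Complexification E :=
  LinearIsometry.toContinuousLinearMap
    { toFun := fun z => mk z.re (-z.im)
      map_add' := fun z w => by ext <;> simp [add_comm]
      map_smul' := fun c z => by ext <;> simp [add_comm]
      norm_map' := fun z => norm_eq_norm (by simp) (by simp) }

@[simp] theorem re_conj (z : Complexification E) : (conj z).re = z.re := rfl

@[simp] theorem im_conj (z : Complexification E) : (conj z).im = -z.im := rfl

@[simp] theorem conj_conj (z : Complexification E) : conj (conj z) = z := by ext <;> simp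

theorem inner_conj_conj (z w : Complexification E) :
    inner ℂ (conj z) (conj w) = inner ℂ w z := by
  rw [inner_def, inner_def]
  apply Complex.ext
  · simp [real_inner_comm]
  · simp [real_inner_comm]
    ring

theorem conj_map (V : E ≃ₗᵢ[ℝ] E) (z : Complexification E) :
    conj (map V z) = map V (conj z) := by ext <;> simp

@[simp] theorem conj_ofReal (x : E) : conj (ofReal x) = ofReal x := by ext <;> simp

theorem eq_ofReal_add (z : Complexification E) : z = ofReal z.re + I • ofReal z.im := by
  ext <;> simp

theorem continuous_mk {X : Type*} [TopologicalSpace X] {f g : X → E} (hf : Continuous f)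
    (hg : Continuous g) : Continuous fun x => mk (f x) (g x) :=
  (WithLp.prod_continuous_toLp 2 E E).comp (hf.prodMk hg)

theorem isUnitaryGroup_map {U : ℝ → E ≃ₗᵢ[ℝ] E} (hU : ∀ s t, U (s + t) = U s * U t)
    (hUc : ∀ x : E, Continuous fun t => U t x) : IsUnitaryGroup fun t => mapₗᵢ (U t) where
  zero_apply x := by
    have h : U 0 = 1 := by
      have := hU 0 0
      rw [add_zero] at this
      exact left_eq_mul.1 this
    change map (U 0) x = x
    rw [h]
    rfl
  add_apply s t x := by
    change map (U (s + t)) x = map (U s) (map (U t) x)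
    rw [hU]
    rfl
  continuous_apply x := continuous_mk (hUc _) (hUc _)

end Complexification

/-! ### The operator defining K_ℝ -/

section Embedding

open Complexification

variable {E : Type u} [NormedAddCommGroup E] [InnerProductSpace ℝ E] [CompleteSpace E]
  {U : ℝ → E ≃ₗᵢ[ℝ] E}

variable (U) in
/-- The operator `(2 / (A⁻¹ + 1))^{1/2}`. -/
def embeddingOp : Complexification E →L[ℂ] Complexification E :=
  posSqrt (resolventOp fun t => mapₗᵢ (U t))

variable (hU : ∀ s t, U (s + t) = U s * U t) (hUc : ∀ x : E, Continuous fun t => U t x)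

theorem isPositive_embeddingOp : (embeddingOp U).IsPositive := isPositive_posSqrt _

include hU hUc

theorem embeddingOp_mul_self :
    embeddingOp U * embeddingOp U = resolventOp fun t => mapₗᵢ (U t) :=
  posSqrt_mul_self (isUnitaryGroup_map hU hUc).isPositive_resolventOp

theorem isEmbeddingOperator_embeddingOp : IsEmbeddingOperator U (embeddingOp U) := by
  refine ⟨isPositive_embeddingOp, fun ζ => ?_⟩
  have h : embeddingOp U (embeddingOp U ζ) = resolventOp (fun t => mapₗᵢ (U t)) ζ := by
    rw [← embeddingOp_mul_self hU hUc]
    rfl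
  rw [h]
  exact (isUnitaryGroup_map hU hUc).isAnalyticPair_resolventOp ζ

/-- The analytic pair condition determines R², and positivity then determines R. So the union over R
in the definition of `KR` reduces to a single operator. -/
theorem isEmbeddingOperator_iff {R : Complexification E →L[ℂ] Complexification E} :
    IsEmbeddingOperator U R ↔ R = embeddingOp U := by
  refine ⟨fun h => eq_posSqrt h.1 ?_, fun h => h ▸ isEmbeddingOperator_embeddingOp hU hUc⟩
  ext1 ζ
  exact (isUnitaryGroup_map hU hUc).eq_resolventOp (h.2 ζ)

theorem mem_KR_iff {ξ : Complexification E} :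
    ξ ∈ KR U ↔ ∃ ζ : E, ξ = embeddingOp U (ofReal ζ) := by
  simp only [KR, Set.mem_ofPred_eq, isEmbeddingOperator_iff hU hUc, exists_eq_left]

theorem mem_KC_iff {ξ : Complexification E} : ξ ∈ KC U ↔ ∃ z, ξ = embeddingOp U z := by
  simp only [KC, Set.mem_ofPred_eq, mem_KR_iff hU hUc]
  constructor
  · rintro ⟨_, ⟨x, rfl⟩, _, ⟨y, rfl⟩, rfl⟩
    exact ⟨ofReal x + Complex.I • ofReal y, by rw [map_add, map_smul]⟩
  · rintro ⟨z, rfl⟩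
    refine ⟨_, ⟨z.re, rfl⟩, _, ⟨z.im, rfl⟩, ?_⟩
    rw [← map_smul, ← map_add, ← eq_ofReal_add]

theorem embeddingOp_injective : Function.Injective (embeddingOp U) := by
  refine (injective_iff_map_eq_zero _).2 fun ζ h => ?_
  refine (isUnitaryGroup_map hU hUc).resolventOp_injective ?_
  rw [← embeddingOp_mul_self hU hUc]
  change embeddingOp U (embeddingOp U ζ) = 0
  rw [h, map_zero]

/-- A self-adjoint injective operator has dense range. -/
theorem denseRange_embeddingOp : DenseRange (embeddingOp U) := by
  have hs : ∀ u v, inner ℂ (embeddingOp U u) v = inner ℂ u (embeddingOp U v) :=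
    fun u v => (isPositive_embeddingOp).isSymmetric u v
  have h : (LinearMap.range (embeddingOp U : Complexification E →ₗ[ℂ] Complexification E))ᗮ = ⊥ := by
    refine (Submodule.eq_bot_iff _).2 fun η hη => ?_
    refine embeddingOp_injective hU hUc ?_
    rw [map_zero]
    refine ext_inner_right ℂ fun v => ?_
    rw [hs, inner_zero_left]
    exact (Submodule.mem_orthogonal' _ _).1 hη _ ⟨v, rfl⟩
  have := Submodule.dense_iff_topologicalClosure_eq_top.2
    (Submodule.topologicalClosure_eq_top_iff.2 h)
  rwa [LinearMap.coe_range] at this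

/-- The subspaces `K_ℝ` and `J K_ℝ` have real inner products. -/
theorem inner_conj_embeddingOp (x y : E) :
    inner ℂ (conj (embeddingOp U (ofReal y))) (embeddingOp U (ofReal x)) =
      inner ℂ (embeddingOp U (ofReal x)) (conj (embeddingOp U (ofReal y))) :=
  inner_conj_real (isPositive_embeddingOp) (embeddingOp_mul_self hU hUc) conj conj_conj
    inner_conj_conj ((isUnitaryGroup_map hU hUc).conj_resolventOp conj conj_conj inner_conj_conj
      fun t x => conj_map (U t) x) (conj_ofReal x) (conj_ofReal y)

end Embedding

end FreeArakiWoods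

end

noncomputable section


namespace FreeArakiWoods

set_option linter.unusedSectionVars false

open ContinuousLinearMap (adjoint)

/-! ### Wick products on the Fock space -/

section Wick

variable {H : Type u} [NormedAddCommGroup H] [InnerProductSpace ℂ H]

/-- The product `ℓ(e₁) ⋯ ℓ(eₙ)`. -/
def creWord : List H → Fock H →L[ℂ] Fock H
  | [] => 1
  | e :: l => creation e * creWord l

/-- The product `ℓ(e₁)* ⋯ ℓ(eₙ)*`. -/
def annWord : List H → Fock H →L[ℂ] Fock H
  | [] => 1
  | e :: l => star (creation e) * annWord l

/-- The Wick product of a word of pairs `(e, ē)`, where `ē` is the image of `e` under the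
involution: `∑ₖ ℓ(e₁) ⋯ ℓ(eₖ) ℓ(ēₖ₊₁)* ⋯ ℓ(ēₙ)*`. -/
def wick : List (H × H) → Fock H →L[ℂ] Fock H
  | [] => 1
  | p :: l => creation p.1 * wick l + annWord ((p :: l).map Prod.snd)

theorem creWord_append (l l' : List H) : creWord (l ++ l') = creWord l * creWord l' := by
  induction l with
  | nil => exact (one_mul _).symm
  | cons e l ih => rw [List.cons_append, creWord, ih, creWord, mul_assoc]

theorem wick_cons (p : H × H) (l : List (H × H)) :
    wick (p :: l) = creation p.1 * wick l + annWord ((p :: l).map Prod.snd) := rfl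

theorem wick_singleton (p : H × H) : wick [p] = creation p.1 + star (creation p.2) := by
  simp [wick, annWord]

/-- The relation ℓ(ξ)*ℓ(η) = ⟨ξ, η⟩ produces the contraction term; the remaining annihilation term
is exactly the last summand of the longer Wick product. -/
theorem wick_singleton_mul (p q : H × H) (l : List (H × H)) :
    wick [p] * wick (q :: l) = wick (p :: q :: l) + inner ℂ p.2 q.1 • wick l := by
  have h := congrArg (fun x => x * wick l) (star_creation_mul_creation p.2 q.1)
  simp only [smul_mul_assoc, one_mul, mul_assoc] at h
  have h1 : wick (p :: q :: l) =
      creation p.1 * wick (q :: l) + star (creation p.2) * annWord ((q :: l).map Prod.snd) := rfl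
  have h2 : star (creation p.2) * wick (q :: l) =
      inner ℂ p.2 q.1 • wick l + star (creation p.2) * annWord ((q :: l).map Prod.snd) := by
    rw [wick_cons q, mul_add, h]
  rw [wick_singleton, add_mul, h1, h2]
  abel

/-- A linear map that is radial on products of creation and annihilation operators is radial on
Wick products. -/
theorem map_creWord_mul_wick (M : (Fock H →L[ℂ] Fock H) →ₗ[ℂ] (Fock H →L[ℂ] Fock H)) (φ : ℕ → ℂ)
    (hM : ∀ a b : List H, M (creWord a * annWord b) =
      φ (a.length + b.length) • (creWord a * annWord b)) (a : List H) (l : List (H × H)) :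
    M (creWord a * wick l) = φ (a.length + l.length) • (creWord a * wick l) := by
  induction l generalizing a with
  | nil => exact hM a []
  | cons p l ih =>
    -- M is only linear, so creation operators cannot be pulled out of it; they are absorbed into
    -- the prefix a, over which the induction is generalised.
    have h1 : creWord a * (creation p.1 * wick l) = creWord (a ++ [p.1]) * wick l := by
      rw [creWord_append, creWord, creWord, mul_one, mul_assoc]
    have h2 := ih (a ++ [p.1])
    have h3 := hM a ((p :: l).map Prod.snd)
    rw [List.length_append, List.length_singleton, add_assoc, add_comm 1] at h2
    rw [List.length_map] at h3
    rw [wick_cons, mul_add, h1, map_add, h2, h3, List.length_cons, smul_add]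

theorem map_wick (M : (Fock H →L[ℂ] Fock H) →ₗ[ℂ] (Fock H →L[ℂ] Fock H)) (φ : ℕ → ℂ)
    (hM : ∀ a b : List H, M (creWord a * annWord b) =
      φ (a.length + b.length) • (creWord a * annWord b)) (l : List (H × H)) :
    M (wick l) = φ l.length • wick l := by
  have := map_creWord_mul_wick M φ hM [] l
  simpa [creWord] using this

theorem star_shiftOp_single_zero {G : ℕ → Type u} [∀ n, NormedAddCommGroup (G n)]
    [∀ n, InnerProductSpace ℂ (G n)] [∀ n, CompleteSpace (G n)] (T : ∀ n, G n →L[ℂ] G (n + 1))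
    (C : ℝ) (hC) (x : G 0) : star (shiftOp T C hC) (lp.single 2 0 x) = 0 := by
  ext m
  refine (star_shiftOp_apply T C hC _ m).trans ?_
  rw [lp.single_apply_ne 2 0 _ (by omega), map_zero]
  rfl

theorem star_shiftOp_single_succ {G : ℕ → Type u} [∀ n, NormedAddCommGroup (G n)]
    [∀ n, InnerProductSpace ℂ (G n)] [∀ n, CompleteSpace (G n)] (T : ∀ n, G n →L[ℂ] G (n + 1))
    (C : ℝ) (hC) (n : ℕ) (x : G (n + 1)) :
    star (shiftOp T C hC) (lp.single 2 (n + 1) x) = lp.single 2 n (adjoint (T n) x) := by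
  ext m
  refine (star_shiftOp_apply T C hC _ m).trans ?_
  by_cases h : m = n
  · subst h
    rw [lp.single_apply_self, lp.single_apply_self]
  · rw [lp.single_apply_ne 2 n _ h, lp.single_apply_ne 2 (n + 1) _ (by omega), map_zero]

theorem star_creation_vacuum (e : H) : star (creation e) (vacuum H) = 0 :=
  star_shiftOp_single_zero _ _ _ _

theorem annWord_vacuum : ∀ l : List H, l ≠ [] → annWord l (vacuum H) = 0
  | [], h => absurd rfl h
  | [e], _ => star_creation_vacuum e
  | e :: f :: l, _ => by
    change star (creation e) (annWord (f :: l) (vacuum H)) = 0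
    rw [annWord_vacuum (f :: l) (by simp), map_zero]

theorem wick_ofFn_vacuum {n : ℕ} (p : Fin n → H × H) :
    wick (List.ofFn p) (vacuum H) = pureTensor fun k => (p k).1 := by
  induction n with
  | zero =>
    rw [List.ofFn_zero]
    change pureTensor _ = _
    congr 1
    exact Subsingleton.elim _ _
  | succ n ih =>
    rw [List.ofFn_succ, wick_cons, _root_.add_apply, annWord_vacuum _ (by simp), add_zero]
    refine (congrArg (creation (p 0).1) (ih fun k => p k.succ)).trans ?_
    rw [creation_pureTensor]
    congr 1
    exact Fin.cons_self_tail fun k => (p k).1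

theorem euclideanSpace_punit_eq (x : EuclideanSpace ℂ PUnit.{u + 1}) :
    x = x PUnit.unit • (EuclideanSpace.single PUnit.unit 1 : EuclideanSpace ℂ PUnit.{u + 1}) := by
  ext i
  simp

theorem exists_smul_vacuum (x : tensorPow H 0) :
    ∃ c : ℂ, (lp.single 2 0 x : Fock H) = c • vacuum H := by
  obtain ⟨c, hc⟩ : ∃ c : ℂ, x = c • tensorVec 0 (Fin.elim0 : Fin 0 → H) :=
    ⟨_, euclideanSpace_punit_eq x⟩
  refine ⟨c, ?_⟩
  rw [hc, lp.single_smul]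
  rfl

/-- A closed subspace of the Fock space that contains the vacuum vector and is invariant under the
right semicircular operators of a total set of vectors is everything. -/
theorem mem_of_rightSemicircular_mem {s : Set H} (hs : Dense (Submodule.span ℂ s : Set H))
    (Z : Submodule ℂ (Fock H)) (hZ : IsClosed (Z : Set (Fock H))) (hΩ : vacuum H ∈ Z)
    (h : ∀ η ∈ s, ∀ v ∈ Z, rightCreation η v + star (rightCreation η) v ∈ Z) (v : Fock H) :
    v ∈ Z := by
  -- The adjoint part of a right semicircular operator lowers the degree, so all degrees up to n are
  -- treated together and the lower term is subtracted.
  have key : ∀ n, ∀ m ≤ n, ∀ x : tensorPow H m, lp.single 2 m x ∈ Z := by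
    intro n
    induction n with
    | zero =>
      intro m hm x
      obtain rfl : m = 0 := by omega
      obtain ⟨c, hc⟩ := exists_smul_vacuum x
      rw [hc]
      exact Z.smul_mem _ hΩ
    | succ n ih =>
      intro m hm x
      rcases hm.lt_or_eq with hm | rfl
      · exact ih m (by omega) x
      let L : tensorPow H (n + 1) →L[ℂ] Fock H :=
        (lp.singleContinuousLinearMap ℂ (fun n => (tensorPow H n).carrier) 2 (n + 1))
      have hL : ∀ y, L y = lp.single 2 (n + 1) y := fun y => rfl
      refine mem_of_tensorRight_mem (Z.comap L.toLinearMap) (hZ.preimage L.continuous)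
        (fun η y => ?_) x
      refine mem_of_mem_dense_submodule hs (L ∘L tensorRightL n y) Z hZ (fun η hη => ?_) η
      change lp.single 2 (n + 1) (tensorRight η n y) ∈ Z
      rw [← rightCreation_single]
      have h1 := h η hη _ (ih n le_rfl y)
      have h2 : star (rightCreation η) (lp.single 2 n y) ∈ Z := by
        cases n with
        | zero =>
          rw [rightCreation, star_shiftOp_single_zero]
          exact Z.zero_mem
        | succ n =>
          rw [rightCreation, star_shiftOp_single_succ]
          exact ih n (by omega) _
      exact (Z.add_mem_iff_left h2).1 h1
  have hv := lp.hasSum_single (p := 2) (by norm_num) v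
  exact hZ.mem_of_tendsto hv (Filter.Eventually.of_forall fun t =>
    Z.sum_mem fun n _ => key n n le_rfl _)

/-- Left and right semicircular operators with a real inner product commute. -/
theorem semicircular_commute_right {ξ η : H} (h : inner ℂ ξ η = inner ℂ η ξ) :
    semicircular ξ * (rightCreation η + star (rightCreation η)) =
      (rightCreation η + star (rightCreation η)) * semicircular ξ := by
  have h1 := creation_mul_rightCreation ξ η
  have h2 := star_creation_mul_rightCreation ξ η
  have h3 := congrArg star h1
  have h4 := congrArg star h2
  simp only [star_mul, star_star, star_add, star_smul, isSelfAdjoint_vacuumProj] at h3 h4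
  have h5 : star (inner ℂ ξ η) = inner ℂ ξ η := by
    rw [h]
    exact (inner_conj_symm ξ η).trans h
  rw [h5] at h4
  unfold semicircular
  rw [smul_mul_assoc, mul_smul_comm]
  congr 1
  -- The two vacuum terms in the commutator have coefficients ⟨ξ, η⟩ and its conjugate with opposite
  -- signs, and they cancel because the inner product is real.
  rw [add_mul, mul_add, mul_add, add_mul, mul_add, mul_add, h1, h2, h4, ← h3]
  abel

end Wick

/-! ### Wick products in the free Araki–Woods algebras; the separating vacuum -/

section Algebra

open Complexification

variable {E : Type u} [NormedAddCommGroup E] [InnerProductSpace ℝ E] [CompleteSpace E]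
  {U : ℝ → E ≃ₗᵢ[ℝ] E}

variable (U) in
/-- The pair `(R z, R z̄)`. -/
def wickPair (z : Complexification E) : Complexification E × Complexification E :=
  (embeddingOp U z, embeddingOp U (conj z))

theorem star_semicircular {H : Type u} [NormedAddCommGroup H] [InnerProductSpace ℂ H] (ξ : H) :
    star (semicircular ξ) = semicircular ξ := by
  unfold semicircular
  rw [star_smul, star_add, star_star, add_comm]
  simp

theorem wick_wickPair (z : Complexification E) :
    wick [wickPair U z] = (2 : ℂ) • semicircular (embeddingOp U (ofReal z.re)) +
      (2 * Complex.I) • semicircular (embeddingOp U (ofReal z.im)) := by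
  have h2 : conj z = ofReal z.re + (-Complex.I) • ofReal z.im := by
    conv_lhs => rw [eq_ofReal_add z]
    rw [map_add, map_smulₛₗ, conj_ofReal, conj_ofReal, Complex.conj_I]
  rw [wick_singleton]
  change creation (embeddingOp U z) + star (creation (embeddingOp U (conj z))) = _
  conv_lhs => rw [h2, eq_ofReal_add z]
  simp only [map_add, map_smul, creation_add, creation_smul, semicircular, star_add, star_smul,
    re_add, im_add, re_ofReal, im_ofReal, re_smul, im_smul]
  simp only [smul_smul, smul_add, Complex.star_def, map_neg, Complex.conj_I, neg_neg]
  norm_num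
  have : (2 : ℂ) * Complex.I * (1 / 2) = Complex.I := by ring
  rw [this]
  abel

variable (hU : ∀ s t, U (s + t) = U s * U t) (hUc : ∀ x : E, Continuous fun t => U t x)

include hU hUc

theorem semicircular_mem_generators (x : E) :
    semicircular (embeddingOp U (ofReal x)) ∈ generators U :=
  ⟨_, (mem_KR_iff hU hUc).2 ⟨x, rfl⟩, rfl⟩

theorem mem_generators_iff {y : Fock (Complexification E) →L[ℂ] Fock (Complexification E)} :
    y ∈ generators U ↔ ∃ x : E, y = semicircular (embeddingOp U (ofReal x)) := by
  constructor
  · rintro ⟨ξ, hξ, rfl⟩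
    obtain ⟨x, rfl⟩ := (mem_KR_iff hU hUc).1 hξ
    exact ⟨x, rfl⟩
  · rintro ⟨x, rfl⟩
    exact semicircular_mem_generators hU hUc x

theorem wick_wickPair_mem (z : Complexification E) :
    wick [wickPair U z] ∈ StarAlgebra.adjoin ℂ (generators U) := by
  rw [wick_wickPair]
  exact add_mem
    (SMulMemClass.smul_mem _ (StarAlgebra.subset_adjoin ℂ _ (semicircular_mem_generators hU hUc _)))
    (SMulMemClass.smul_mem _ (StarAlgebra.subset_adjoin ℂ _ (semicircular_mem_generators hU hUc _)))

/-- `wick_singleton_mul` is solved for the longest word, which expresses it through words shorter by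
one and by two letters. -/
theorem wick_mem_adjoin : ∀ l : List (Complexification E),
    wick (l.map (wickPair U)) ∈ StarAlgebra.adjoin ℂ (generators U)
  | [] => one_mem _
  | [z] => wick_wickPair_mem hU hUc z
  | z :: w :: l => by
    have h := wick_singleton_mul (wickPair U z) (wickPair U w) (l.map (wickPair U))
    have h2 := eq_sub_of_add_eq h.symm
    rw [List.map_cons, List.map_cons, h2]
    exact sub_mem (mul_mem (wick_wickPair_mem hU hUc z) (wick_mem_adjoin (w :: l)))
      (SMulMemClass.smul_mem _ (wick_mem_adjoin l))

/-- The Wick products span the algebra generated by the semicircular operators. -/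
theorem mem_span_wick {y : Fock (Complexification E) →L[ℂ] Fock (Complexification E)}
    (hy : y ∈ StarAlgebra.adjoin ℂ (generators U)) :
    y ∈ Submodule.span ℂ (Set.range fun l : List (Complexification E) =>
      wick (l.map (wickPair U))) := by
  set W := Submodule.span ℂ (Set.range fun l : List (Complexification E) =>
      wick (l.map (wickPair U))) with hW
  have hw : ∀ l : List (Complexification E), wick (l.map (wickPair U)) ∈ W := fun l =>
    Submodule.subset_span ⟨l, rfl⟩
  have hstar : star (generators U) = generators U := by
    ext y
    rw [Set.mem_star, mem_generators_iff hU hUc, mem_generators_iff hU hUc]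
    refine exists_congr fun x => ?_
    rw [star_eq_iff_star_eq, star_semicircular, eq_comm]
  have hy' : y ∈ Algebra.adjoin ℂ (generators U) := by
    rw [← StarSubalgebra.mem_toSubalgebra, StarAlgebra.adjoin_toSubalgebra, hstar,
      Set.union_self] at hy
    exact hy
  clear hy
  -- It is easier to show that W is a left ideal for the whole algebra, generator by generator, and
  -- to apply this to 1 ∈ W.
  have key : ∀ w ∈ W, y * w ∈ W := by
    induction hy' using Algebra.adjoin_induction with
    | mem y hy =>
      obtain ⟨x, rfl⟩ := (mem_generators_iff hU hUc).1 hy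
      have hs : semicircular (embeddingOp U (ofReal x)) =
          (2⁻¹ : ℂ) • wick [wickPair U (ofReal x)] := by
        rw [wick_singleton, semicircular]
        simp [wickPair]
      intro w hw'
      rw [hs]
      induction hw' using Submodule.span_induction with
      | mem w hw' =>
        obtain ⟨l, rfl⟩ := hw'
        rw [smul_mul_assoc]
        refine W.smul_mem _ ?_
        cases l with
        | nil =>
          change _ * 1 ∈ W
          rw [mul_one]
          exact hw [ofReal x]
        | cons z l =>
          change wick [_] * wick (wickPair U z :: l.map (wickPair U)) ∈ W
          rw [wick_singleton_mul]
          exact W.add_mem (hw (ofReal x :: z :: l)) (W.smul_mem _ (hw l))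
      | zero => rw [mul_zero]; exact W.zero_mem
      | add a b _ _ ha hb => rw [mul_add]; exact W.add_mem ha hb
      | smul c a _ ha => rw [mul_smul_comm]; exact W.smul_mem _ ha
    | algebraMap c =>
      intro w hw'
      rw [Algebra.algebraMap_eq_smul_one, smul_mul_assoc, one_mul]
      exact W.smul_mem _ hw'
    | add a b _ _ ha hb =>
      intro w hw'
      rw [add_mul]
      exact W.add_mem (ha w hw') (hb w hw')
    | mul a b _ _ ha hb =>
      intro w hw'
      rw [mul_assoc]
      exact ha _ (hb w hw')
  have := key 1 (hw [])
  rwa [mul_one] at this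

theorem generators_centralizer {x : Fock (Complexification E) →L[ℂ] Fock (Complexification E)} :
    x ∈ GamVN U ↔ ∀ p, (∀ g ∈ generators U, g * p = p * g) → p * x = x * p := by
  change x ∈ StarSubalgebra.centralizer ℂ
    (StarSubalgebra.centralizer ℂ (generators U) : Set _) ↔ _
  rw [StarSubalgebra.mem_centralizer_iff]
  have hs : ∀ g ∈ generators U, star g = g := by
    rintro _ ⟨ξ, _, rfl⟩
    exact star_semicircular ξ
  have hc : ∀ p : Fock (Complexification E) →L[ℂ] Fock (Complexification E),
      p ∈ StarSubalgebra.centralizer ℂ (generators U) ↔ ∀ g ∈ generators U, g * p = p * g := by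
    intro p
    rw [StarSubalgebra.mem_centralizer_iff]
    refine forall₂_congr fun g hg => ?_
    rw [hs g hg, and_self]
  constructor
  · intro h p hp
    exact (h p ((hc p).2 hp)).1
  · intro h p hp
    exact ⟨h p ((hc p).1 hp), h _ ((hc _).1 (star_mem hp))⟩

/-- The vacuum vector is separating for the free Araki–Woods von Neumann algebra. -/
theorem eq_zero_of_vacuum {x : Fock (Complexification E) →L[ℂ] Fock (Complexification E)}
    (hx : x ∈ GamVN U) (h : x (vacuum (Complexification E)) = 0) : x = 0 := by
  -- Right semicircular operators over these conjugate vectors commute with all generators, hence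
  -- preserve the kernel of x, and the vectors are total; so the kernel contains every vector once
  -- it contains the vacuum.
  set s : Set (Complexification E) := Set.range fun y : E => conj (embeddingOp U (ofReal y))
  have hs : Dense (Submodule.span ℂ s : Set (Complexification E)) := by
    have h1 : DenseRange fun z => conj (embeddingOp U z) :=
      DenseRange.comp (g := conj) (Function.Surjective.denseRange fun z => ⟨conj z, conj_conj z⟩)
        (denseRange_embeddingOp hU hUc) conj.continuous
    refine Dense.mono ?_ h1
    rintro _ ⟨z, rfl⟩
    change conj (embeddingOp U z) ∈ Submodule.span ℂ s
    rw [eq_ofReal_add z, map_add, map_smul, map_add, map_smulₛₗ]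
    exact add_mem (Submodule.subset_span ⟨_, rfl⟩)
      (Submodule.smul_mem _ _ (Submodule.subset_span ⟨_, rfl⟩))
  have key := mem_of_rightSemicircular_mem hs (LinearMap.ker x.toLinearMap)
    (isClosed_singleton.preimage x.continuous) h ?_
  · ext1 v
    exact key v
  · rintro _ ⟨y, rfl⟩ v hv
    have hcomm := (generators_centralizer hU hUc).1 hx (rightCreation (conj (embeddingOp U (ofReal y))) +
      star (rightCreation (conj (embeddingOp U (ofReal y))))) ?_
    · have h2 := congrArg (fun T => T v) hcomm
      refine h2.symm.trans ?_
      exact (congrArg (rightCreation (conj (embeddingOp U (ofReal y))) +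
        star (rightCreation (conj (embeddingOp U (ofReal y))))) hv).trans (map_zero _)
    · intro g hg
      obtain ⟨x, rfl⟩ := (mem_generators_iff hU hUc).1 hg
      exact semicircular_commute_right (inner_conj_embeddingOp hU hUc x y).symm

omit hU hUc in
theorem adjoin_le_Gam : StarAlgebra.adjoin ℂ (generators U) ≤ Gam U :=
  StarSubalgebra.le_topologicalClosure _

theorem adjoin_le_GamVN : StarAlgebra.adjoin ℂ (generators U) ≤ (GamVN U).toStarSubalgebra := by
  refine StarAlgebra.adjoin_le fun g hg => ?_
  exact (generators_centralizer hU hUc).2 fun p hp => (hp g hg).symm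

theorem adjoin_commute {p : Fock (Complexification E) →L[ℂ] Fock (Complexification E)} :
    (∀ y ∈ StarAlgebra.adjoin ℂ (generators U), y * p = p * y) ↔
      ∀ g ∈ generators U, g * p = p * g := by
  refine ⟨fun h g hg => h g (StarAlgebra.subset_adjoin ℂ _ hg), fun h y hy => ?_⟩
  exact ((generators_centralizer hU hUc).1 (adjoin_le_GamVN hU hUc hy) p h).symm

theorem Gam_le_GamVN : Gam U ≤ (GamVN U).toStarSubalgebra := by
  refine StarSubalgebra.topologicalClosure_minimal (adjoin_le_GamVN hU hUc) ?_
  have : ((GamVN U).toStarSubalgebra : Set _) = ⋂ p ∈ {p | ∀ g ∈ generators U, g * p = p * g},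
      {x : Fock (Complexification E) →L[ℂ] Fock (Complexification E) | p * x = x * p} := by
    ext x
    simp only [Set.mem_iInter]
    exact generators_centralizer hU hUc
  rw [this]
  exact isClosed_biInter fun p _ => isClosed_eq (by fun_prop) (by fun_prop)

/-- An element of the von Neumann algebra that sends the vacuum to an elementary tensor is the
corresponding Wick product. -/
theorem eq_wick_of_vacuum {x : Fock (Complexification E) →L[ℂ] Fock (Complexification E)}
    (hx : x ∈ GamVN U) {n : ℕ} {e : Fin n → Complexification E} (he : ∀ k, e k ∈ KC U)
    (h : x (vacuum (Complexification E)) = pureTensor e) :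
    ∃ l : List (Complexification E), l.length = n ∧ x = wick (l.map (wickPair U)) := by
  choose z hz using fun k => (mem_KC_iff hU hUc).1 (he k)
  refine ⟨List.ofFn z, List.length_ofFn, sub_eq_zero.1 (eq_zero_of_vacuum hU hUc
    (sub_mem hx (adjoin_le_GamVN hU hUc (wick_mem_adjoin hU hUc _))) ?_)⟩
  rw [List.map_ofFn, _root_.sub_apply, wick_ofFn_vacuum, h, sub_eq_zero]
  congr 1
  ext1 k
  exact hz k

end Algebra

end FreeArakiWoods

end

noncomputable section


namespace FreeArakiWoods

set_option linter.unusedSectionVars false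

open ContinuousLinearMap (adjoint)

/-! ### The spatial multiplier of a radial functional -/

section RadialFamily

variable {H : Type u} [NormedAddCommGroup H] [InnerProductSpace ℂ H]
  {ι : Type*} (b : HilbertBasis ι ℂ H)

/-- The parity operator `(-1)ⁿ` on the Fock space. -/
def parityOp : Fock H →L[ℂ] Fock H := diagOp (fun n => (-1) ^ n) 1 (fun n => by simp)

theorem enorm_parityOp (v : Fock H) : ‖parityOp v‖ₑ = ‖v‖ₑ := by
  have h : ‖parityOp v‖ₑ ^ 2 = ‖v‖ₑ ^ 2 := by
    rw [lp_enorm_sq, lp_enorm_sq]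
    refine tsum_congr fun n => ?_
    change ‖((-1 : ℂ) ^ n) • v n‖ₑ ^ 2 = _
    rw [enorm_smul, enorm_pow, enorm_neg, enorm_one, one_pow, one_mul]
  exact (ENNReal.pow_right_strictMono two_ne_zero).injective h

theorem inner_parityOp (w v : Fock H) : inner ℂ (parityOp w) (parityOp v) = inner ℂ w v := by
  rw [lp.inner_eq_tsum, lp.inner_eq_tsum]
  refine tsum_congr fun n => ?_
  change inner ℂ (((-1 : ℂ) ^ n) • w n) (((-1 : ℂ) ^ n) • v n) = _
  rw [inner_smul_left, inner_smul_right, ← mul_assoc, map_pow, map_neg, map_one, ← mul_pow]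
  simp

theorem star_creation_parityOp (ξ : H) (v : Fock H) :
    star (creation ξ) (parityOp v) = -parityOp (star (creation ξ) v) := by
  refine (star_shiftOp_diagOp _ _ _ _ _ _ v).trans ?_
  ext n
  change ((-1 : ℂ) ^ (n + 1)) • (star (creation ξ) v) n = -(((-1 : ℂ) ^ n) • (star (creation ξ) v) n)
  rw [pow_succ, mul_neg_one, neg_smul]

/-- The coefficients of a radial multiplier: two scalars and a sequence in `ℓ²`. -/
def radialFamily (p₁ p₂ : ℂ) (β : ℕ → ellTwo) :
    Bool ⊕ (ℕ × ((Σ d, (Fin d → ι)) ⊕ ℕ)) → Fock H →L[ℂ] Fock H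
  | Sum.inl true => p₁ • 1
  | Sum.inl false => p₂ • parityOp
  | Sum.inr (k, i) => coactionComp b (β k) i

theorem tsum_enorm_sq_radialFamily (p₁ p₂ : ℂ) (β : ℕ → ellTwo) (v : Fock H) :
    ∑' i, ‖radialFamily b p₁ p₂ β i v‖ₑ ^ 2 =
      (‖p₁‖ₑ ^ 2 + ‖p₂‖ₑ ^ 2 + ∑' k, ‖β k‖ₑ ^ 2) * ‖v‖ₑ ^ 2 := by
  rw [Summable.tsum_sum ENNReal.summable ENNReal.summable, tsum_bool, add_mul, add_mul]
  congr 1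
  · change ‖p₂ • parityOp v‖ₑ ^ 2 + ‖p₁ • v‖ₑ ^ 2 = _
    rw [enorm_smul, enorm_smul, enorm_parityOp, mul_pow, mul_pow, add_comm]
  · refine (ENNReal.tsum_prod (f := fun k i => ‖coactionComp b (β k) i v‖ₑ ^ 2)).trans ?_
    simp_rw [tsum_enorm_sq_coactionComp]
    rw [ENNReal.tsum_mul_right]

theorem radialFamily_bound {p₁ p₂ : ℂ} {β : ℕ → ellTwo} {N : ℝ}
    (hβ : Summable fun k => ‖β k‖ ^ 2) (hN : ‖p₁‖ ^ 2 + ‖p₂‖ ^ 2 + ∑' k, ‖β k‖ ^ 2 ≤ N)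
    (v : Fock H) :
    ∑' i, ‖radialFamily b p₁ p₂ β i v‖ₑ ^ 2 ≤ ENNReal.ofReal (Real.sqrt N) ^ 2 * ‖v‖ₑ ^ 2 := by
  rw [tsum_enorm_sq_radialFamily]
  refine mul_le_mul_left ?_ _
  have h0 : 0 ≤ ∑' k, ‖β k‖ ^ 2 := tsum_nonneg fun k => by positivity
  have hN0 : 0 ≤ N := le_trans (by positivity) hN
  rw [← ENNReal.ofReal_pow (Real.sqrt_nonneg N), Real.sq_sqrt hN0]
  have hs : ∑' k, ‖β k‖ₑ ^ 2 = ENNReal.ofReal (∑' k, ‖β k‖ ^ 2) := by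
    rw [ENNReal.ofReal_tsum_of_nonneg (fun k => by positivity) hβ]
    refine tsum_congr fun k => ?_
    rw [ENNReal.ofReal_pow (norm_nonneg _), ofReal_norm]
  rw [hs, ← ofReal_norm p₁, ← ofReal_norm p₂, ← ENNReal.ofReal_pow (norm_nonneg _),
    ← ENNReal.ofReal_pow (norm_nonneg _), ← ENNReal.ofReal_add (by positivity) (by positivity),
    ← ENNReal.ofReal_add (by positivity) h0]
  exact ENNReal.ofReal_le_ofReal hN

/-- Each annihilation operator passes through the three kinds of components: freely for the
identity, with a sign for the parity, with a factor S* on the ℓ² coefficient for the coaction. -/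
theorem annWord_radialFamily (p₁ p₂ : ℂ) (β : ℕ → ellTwo) (c : List H) (i) (v : Fock H) :
    annWord c (radialFamily b p₁ p₂ β i v) =
      radialFamily b p₁ ((-1) ^ c.length * p₂)
        (fun k => (star unilateralShift ^ c.length) (β k)) i (annWord c v) := by
  induction c with
  | nil =>
    simp only [annWord, List.length_nil, pow_zero, one_mul]
    rfl
  | cons e l ih =>
    change star (creation e) (annWord l (radialFamily b p₁ p₂ β i v)) = _
    rw [ih]
    rcases i with (_ | _) | ⟨k, i⟩
    · change star (creation e) (((-1) ^ l.length * p₂) • parityOp (annWord l v)) =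
        ((-1) ^ (l.length + 1) * p₂) • parityOp (star (creation e) (annWord l v))
      rw [map_smul, star_creation_parityOp, smul_neg, pow_succ, ← neg_smul]
      congr 1
      ring
    · exact map_smul (star (creation e)) p₁ (annWord l v)
    · have hp : (star unilateralShift ^ (l.length + 1)) (β k) =
          star unilateralShift ((star unilateralShift ^ l.length) (β k)) := by
        rw [pow_succ']
        rfl
      change star (creation e) (coactionComp b _ i (annWord l v)) =
        coactionComp b ((star unilateralShift ^ (l.length + 1)) (β k)) i
          (star (creation e) (annWord l v))
      rw [star_creation_coactionComp, hp]

/-- The two scalar components give the character terms, and the isometry property of the coaction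
turns the k-th block into ⟨βₖ, αₖ⟩⟨w, v⟩. -/
theorem hasSum_inner_radialFamily {p₁ p₂ q₁ q₂ : ℂ} {α β : ℕ → ellTwo} {v w : Fock H} {S s : ℂ}
    (hS : HasSum (fun i => inner ℂ (radialFamily b p₁ p₂ β i w) (radialFamily b q₁ q₂ α i v)) S)
    (hs : HasSum (fun k => inner ℂ (β k) (α k)) s) :
    S = ((starRingEnd ℂ) p₁ * q₁ + (starRingEnd ℂ) p₂ * q₂ + s) * inner ℂ w v := by
  obtain ⟨T, hT⟩ := hS.summable.comp_injective (i := Sum.inr) Sum.inr_injective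
  have hT' : T = s * inner ℂ w v :=
    (hT.prod_fiberwise fun k => hasSum_inner_coactionComp b (β k) (α k) v w).unique
      (hs.mul_right _)
  have hB : HasSum ((fun i => inner ℂ (radialFamily b p₁ p₂ β i w) (radialFamily b q₁ q₂ α i v)) ∘
      Sum.inl) (((starRingEnd ℂ) p₁ * q₁ + (starRingEnd ℂ) p₂ * q₂) * inner ℂ w v) := by
    have h := hasSum_fintype ((fun i => inner ℂ (radialFamily b p₁ p₂ β i w)
      (radialFamily b q₁ q₂ α i v)) ∘ Sum.inl)
    rw [Fintype.sum_bool] at h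
    convert h using 1
    change _ = inner ℂ (p₁ • w) (q₁ • v) + inner ℂ (p₂ • parityOp w) (q₂ • parityOp v)
    rw [inner_smul_left, inner_smul_right, inner_smul_left, inner_smul_right, inner_parityOp]
    ring
  rw [hS.unique (hB.sum hT), hT', add_mul _ s]

/-- The multiplier built from a decomposition of a radial functional is radial on products of
creation and annihilation operators. -/
theorem ampConj_creWord_annWord [CompleteSpace H] {φ : ℕ → ℂ} {c₁ c₂ p₁ p₂ q₁ q₂ : ℂ}
    {α β : ℕ → ellTwo} (h1 : (starRingEnd ℂ) p₁ * q₁ = c₁) (h2 : (starRingEnd ℂ) p₂ * q₂ = c₂)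
    (hφ : ∀ i j, HasSum (fun k => inner ℂ ((star unilateralShift ^ i) (β k))
      ((star unilateralShift ^ j) (α k))) (φ (i + j) - (c₁ + c₂ * (-1) ^ (i + j))))
    (P Q : Fock H →L[ℂ] lp (fun _ : Bool ⊕ (ℕ × ((Σ d, (Fin d → ι)) ⊕ ℕ)) => Fock H) 2)
    (hP : ∀ v i, P v i = radialFamily b p₁ p₂ β i v)
    (hQ : ∀ v i, Q v i = radialFamily b q₁ q₂ α i v) (a c : List H) :
    ampConj P Q (creWord a * annWord c) =
      φ (a.length + c.length) • (creWord a * annWord c) := by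
  have hstar : ∀ a : List H, star (creWord a) = annWord a.reverse := by
    intro a
    have happ : ∀ l l' : List H, annWord (l ++ l') = annWord l * annWord l' := by
      intro l l'
      induction l with
      | nil => exact (one_mul _).symm
      | cons e l ih => rw [List.cons_append, annWord, ih, annWord, mul_assoc]
    induction a with
    | nil => exact star_one _
    | cons e l ih =>
      rw [creWord, star_mul, ih, List.reverse_cons, happ]
      simp [annWord]
  ext1 v
  refine ext_inner_left ℂ fun w => ?_
  have hsum := hasSum_inner_ampConj P Q (creWord a * annWord c) v w
  have hcre : ∀ x y, inner ℂ x (creWord a y) = inner ℂ (annWord a.reverse x) y := fun x y => by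
    rw [← hstar, ContinuousLinearMap.star_eq_adjoint, ContinuousLinearMap.adjoint_inner_left]
  have hterm : (fun i => inner ℂ (P w i) ((creWord a * annWord c) (Q v i))) = fun i =>
      inner ℂ (radialFamily b p₁ ((-1) ^ a.length * p₂)
        (fun k => (star unilateralShift ^ a.length) (β k)) i (annWord a.reverse w))
      (radialFamily b q₁ ((-1) ^ c.length * q₂)
        (fun k => (star unilateralShift ^ c.length) (α k)) i (annWord c v)) := by
    ext1 i
    have e1 := annWord_radialFamily b p₁ p₂ β a.reverse i w
    rw [List.length_reverse] at e1
    rw [hP, hQ, ← e1, ← annWord_radialFamily]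
    exact hcre _ _
  rw [hterm] at hsum
  rw [hasSum_inner_radialFamily b hsum (hφ a.length c.length)]
  change _ = inner ℂ w (φ (a.length + c.length) • creWord a (annWord c v))
  rw [inner_smul_right, hcre]
  congr 1
  rw [← h1, ← h2, pow_add, map_mul, map_pow, map_neg, map_one]
  ring

/-- A balanced factorisation: the weight |c| enters both columns equally, so the product of their
norms does not exceed |c₁| + |c₂| + τ. -/
theorem exists_conj_mul_eq (c : ℂ) :
    ∃ p q : ℂ, (starRingEnd ℂ) p * q = c ∧ ‖p‖ ^ 2 = ‖c‖ ∧ ‖q‖ ^ 2 = ‖c‖ := by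
  refine ⟨(Real.sqrt ‖c‖ : ℝ), c / (Real.sqrt ‖c‖ : ℝ), ?_, ?_, ?_⟩
  · rw [Complex.conj_ofReal]
    rcases eq_or_ne c 0 with rfl | hc
    · simp
    · refine mul_div_cancel₀ _ ?_
      exact_mod_cast (Real.sqrt_pos.2 (norm_pos_iff.2 hc)).ne'
  · rw [Complex.norm_real, Real.norm_of_nonneg (Real.sqrt_nonneg _), Real.sq_sqrt (norm_nonneg _)]
  · rw [norm_div, Complex.norm_real, Real.norm_of_nonneg (Real.sqrt_nonneg _), Real.div_sqrt,
      Real.sq_sqrt (norm_nonneg _)]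

/-- Hahn–Banach; on all of B(ℓ²) the functional may be evaluated on arbitrary rank one operators and
limits of contractions without checking membership in the Toeplitz algebra. -/
theorem IsRadialFunctional.exists_extension {φ : ℕ → ℂ} {γ : toeplitz →L[ℂ] ℂ}
    (hγ : IsRadialFunctional φ γ) : ∃ g : (ellTwo →L[ℂ] ellTwo) →L[ℂ] ℂ,
      (∀ i j, g (unilateralShift ^ i * star unilateralShift ^ j) = φ (i + j)) ∧ ‖g‖ = ‖γ‖ := by
  obtain ⟨g, hg, hgn⟩ := exists_extension_norm_eq toeplitz.toSubalgebra.toSubmodule γ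
  exact ⟨g, fun i j => (hg (toeplitzShift ^ i * star toeplitzShift ^ j)).trans (hγ i j), hgn⟩

/-- A bounded radial functional on the Toeplitz algebra gives a spatially implemented radial
multiplier on the operators on the Fock space. -/
theorem exists_ampConj_of_radialFunctional {H : Type u} [NormedAddCommGroup H]
    [InnerProductSpace ℂ H] [CompleteSpace H] {φ : ℕ → ℂ} {γ : toeplitz →L[ℂ] ℂ}
    (hγ : IsRadialFunctional φ γ) :
    ∃ (κ : Type u) (P Q : Fock H →L[ℂ] lp (fun _ : κ => Fock H) 2), ‖P‖ * ‖Q‖ ≤ ‖γ‖ ∧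
      ∀ a c : List H, ampConj P Q (creWord a * annWord c) =
        φ (a.length + c.length) • (creWord a * annWord c) := by
  obtain ⟨g, hg, hgn⟩ := hγ.exists_extension
  obtain ⟨c₁, c₂, α, β, τ, -, hα, hβ, hα', hβ', hn, hφ⟩ := exists_radial_decomposition hg
  obtain ⟨p₁, q₁, h1, hp₁, hq₁⟩ := exists_conj_mul_eq c₁
  obtain ⟨p₂, q₂, h2, hp₂, hq₂⟩ := exists_conj_mul_eq c₂
  obtain ⟨s, b, -⟩ := exists_hilbertBasis ℂ H
  set N := ‖c₁‖ + ‖c₂‖ + τ with hN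
  have hP := radialFamily_bound b (p₁ := p₁) (p₂ := p₂) hβ (N := N)
    (by rw [hp₁, hp₂]; linarith)
  have hQ := radialFamily_bound b (p₁ := q₁) (p₂ := q₂) hα (N := N)
    (by rw [hq₁, hq₂]; linarith)
  have hN0 : 0 ≤ N := by
    have : 0 ≤ ∑' k, ‖β k‖ ^ 2 := tsum_nonneg fun k => by positivity
    have := norm_nonneg c₁
    have := norm_nonneg c₂
    linarith
  refine ⟨Bool ⊕ (ℕ × ((Σ d, (Fin d → s)) ⊕ ℕ)),
    columnOp (radialFamily b p₁ p₂ β) _ (Real.sqrt_nonneg N) hP,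
    columnOp (radialFamily b q₁ q₂ α) _ (Real.sqrt_nonneg N) hQ, ?_,
    ampConj_creWord_annWord b h1 h2 hφ _ _ (fun v i => rfl) (fun v i => rfl)⟩
  calc _ ≤ Real.sqrt N * Real.sqrt N :=
        mul_le_mul (norm_columnOp_le _ _ _ _) (norm_columnOp_le _ _ _ _)
          (ContinuousLinearMap.opNorm_nonneg _)
          (Real.sqrt_nonneg _)
    _ = N := Real.mul_self_sqrt hN0
    _ ≤ ‖g‖ := hn
    _ = ‖γ‖ := hgn

end RadialFamily

/-! ### Rigidity of normal and of completely bounded maps -/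

section Bicommutant

variable {K : Type u} [NormedAddCommGroup K] [InnerProductSpace ℂ K] [CompleteSpace K]
  {κ κ' : Type*}

/-- Two ultraweakly continuous functionals that agree on a star algebra agree on its
bicommutant. -/
theorem eq_of_hasSum_of_bicommutant (D : StarSubalgebra ℂ (K →L[ℂ] K)) {ξ η : κ → K} {ξ' η' : κ' → K}
    (hξ : Summable fun i => ‖ξ i‖ ^ 2) (hη : Summable fun i => ‖η i‖ ^ 2)
    (hξ' : Summable fun i => ‖ξ' i‖ ^ 2) (hη' : Summable fun i => ‖η' i‖ ^ 2)
    (h : ∀ y ∈ D, ∃ a, HasSum (fun i => inner ℂ (ξ i) (y (η i))) a ∧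
      HasSum (fun i => inner ℂ (ξ' i) (y (η' i))) a) {x : K →L[ℂ] K}
    (hx : ∀ p : K →L[ℂ] K, (∀ y ∈ D, y * p = p * y) → x * p = p * x) {a a' : ℂ}
    (ha : HasSum (fun i => inner ℂ (ξ i) (x (η i))) a)
    (ha' : HasSum (fun i => inner ℂ (ξ' i) (x (η' i))) a') : a = a' := by
  have hsum : ∀ (y : K →L[ℂ] K) (b b' : ℂ), HasSum (fun i => inner ℂ (ξ i) (y (η i))) b →
      HasSum (fun i => inner ℂ (ξ' i) (y (η' i))) b' →
      HasSum (fun i => inner ℂ (Sum.elim ξ (fun i => -ξ' i) i) (y (Sum.elim η η' i))) (b - b') := by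
    intro y b b' hb hb'
    rw [sub_eq_add_neg]
    refine HasSum.sum hb ?_
    simpa [Function.comp_def] using hb'.neg
  have h1 : Summable fun i => ‖Sum.elim ξ (fun i => -ξ' i) i‖ ^ 2 :=
    (HasSum.sum (f := fun i => ‖Sum.elim ξ (fun i => -ξ' i) i‖ ^ 2) hξ.hasSum
      (by simpa [Function.comp_def] using hξ'.hasSum)).summable
  have h2 : Summable fun i => ‖Sum.elim η η' i‖ ^ 2 :=
    (HasSum.sum (f := fun i => ‖Sum.elim η η' i‖ ^ 2) hη.hasSum hη'.hasSum).summable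
  -- The difference of the two functionals is one functional over the disjoint union of the index
  -- sets, with a sign on the second family.
  have h0 := eq_zero_of_hasSum_of_bicommutant D _ _ h1 h2 (fun y hy => by
    obtain ⟨b, hb, hb'⟩ := h y hy
    simpa using hsum y b b hb hb') x hx
  exact sub_eq_zero.1 ((hsum x a a' ha ha').unique h0)

/-- A spatially implemented map that sends a star algebra into a set commuting with `p` does so for
its bicommutant. -/
theorem ampConj_commute_of_bicommutant (D : StarSubalgebra ℂ (K →L[ℂ] K))
    (P Q : K →L[ℂ] lp (fun _ : κ => K) 2) {p : K →L[ℂ] K}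
    (h : ∀ y ∈ D, p * ampConj P Q y = ampConj P Q y * p) {x : K →L[ℂ] K}
    (hx : ∀ p : K →L[ℂ] K, (∀ y ∈ D, y * p = p * y) → x * p = p * x) :
    p * ampConj P Q x = ampConj P Q x * p := by
  ext1 v
  refine ext_inner_left ℂ fun w => ?_
  have hp : ∀ y, inner ℂ w ((p * ampConj P Q y) v) = inner ℂ (adjoint p w) (ampConj P Q y v) :=
    fun y => (ContinuousLinearMap.adjoint_inner_left p _ _).symm
  rw [hp]
  refine eq_of_hasSum_of_bicommutant D (lp_summable_norm_sq (P (adjoint p w)))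
    (lp_summable_norm_sq (Q v)) (lp_summable_norm_sq (P w)) (lp_summable_norm_sq (Q (p v)))
    (fun y hy => ?_) hx (hasSum_inner_ampConj P Q x v (adjoint p w))
    (hasSum_inner_ampConj P Q x (p v) w)
  refine ⟨_, hasSum_inner_ampConj P Q y v (adjoint p w), ?_⟩
  rw [← hp, h y hy]
  exact hasSum_inner_ampConj P Q y (p v) w

/-- A normal map on the bicommutant of a star algebra that agrees there with a spatially
implemented map is spatially implemented. -/
theorem eq_ampConj_of_isNormalMap (D A : StarSubalgebra ℂ (K →L[ℂ] K)) (hDA : D ≤ A)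
    (hA : ∀ x ∈ A, ∀ p : K →L[ℂ] K, (∀ y ∈ D, y * p = p * y) → x * p = p * x)
    (m : A →ₗ[ℂ] A) (hm : IsNormalMap m) (P Q : K →L[ℂ] lp (fun _ : κ => K) 2)
    (h : ∀ y (hy : y ∈ D), (m ⟨y, hDA hy⟩ : K →L[ℂ] K) = ampConj P Q y) (x : A) :
    (m x : K →L[ℂ] K) = ampConj P Q x := by
  ext1 v
  refine ext_inner_left ℂ fun w => ?_
  let ω : A →ₗ[ℂ] ℂ :=
    { toFun := fun x => inner ℂ w ((x : K →L[ℂ] K) v)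
      map_add' := fun x y => inner_add_right _ _ _
      map_smul' := fun c x => inner_smul_right _ _ _ }
  have hω : IsNormalFunctional ω := by
    refine isNormalFunctional_of_hasSum (ι := Unit) ω (fun _ => w) (fun _ => v)
      (hasSum_fintype _).summable (hasSum_fintype _).summable fun x => ?_
    have h := hasSum_fintype (fun _ : Unit => inner ℂ w ((x : K →L[ℂ] K) v))
    rw [Finset.univ_unique, Finset.sum_singleton] at h
    exact h
  obtain ⟨ξ, η, hξ, hη, hs⟩ := hm ω hω
  refine eq_of_hasSum_of_bicommutant D hξ hη (lp_summable_norm_sq (P w))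
    (lp_summable_norm_sq (Q v)) (fun y hy => ?_) (hA x x.2) (hs x)
    (hasSum_inner_ampConj P Q x v w)
  refine ⟨_, hs ⟨y, hDA hy⟩, ?_⟩
  have h1 : (ω ∘ₗ m) ⟨y, hDA hy⟩ = inner ℂ w (ampConj P Q y v) := by
    rw [← h y hy]
    rfl
  rw [h1]
  exact hasSum_inner_ampConj P Q y v w

/-- The restriction of a spatially implemented map to an invariant algebra. -/
def ampConjRestrict (P Q : K →L[ℂ] lp (fun _ : κ => K) 2) (A : StarSubalgebra ℂ (K →L[ℂ] K))
    (h : ∀ x ∈ A, ampConj P Q x ∈ A) : A →ₗ[ℂ] A where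
  toFun x := ⟨ampConj P Q x, h x x.2⟩
  map_add' x y := Subtype.ext (map_add (ampConj P Q) (x : K →L[ℂ] K) y)
  map_smul' c x := Subtype.ext (map_smul (ampConj P Q) c (x : K →L[ℂ] K))

theorem continuous_ampConj (P Q : K →L[ℂ] lp (fun _ : κ => K) 2) : Continuous (ampConj P Q) :=
  (LinearMap.mkContinuous (ampConj P Q) (‖P‖ * ‖Q‖) (norm_ampConj_le P Q)).continuous

theorem CBBound.norm_apply_le {A B : StarSubalgebra ℂ (K →L[ℂ] K)} {m : A →ₗ[ℂ] B} {C : ℝ}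
    (h : CBBound m C) (x : A) : ‖m x‖ ≤ |C| * ‖x‖ := by
  have h1 := h 1 fun _ _ => x
  have h2 : ‖(m x : K →L[ℂ] K)‖ ≤
      ‖CStarMatrix.ofMatrix (Matrix.of fun _ _ : Fin 1 => (m x : K →L[ℂ] K))‖ :=
    CStarMatrix.norm_entry_le_norm
      (M := CStarMatrix.ofMatrix (Matrix.of fun _ _ : Fin 1 => (m x : K →L[ℂ] K))) (i := 0) (j := 0)
  have h3 : ‖CStarMatrix.ofMatrix (Matrix.of fun _ _ : Fin 1 => (x : K →L[ℂ] K))‖ ≤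
      ‖(x : K →L[ℂ] K)‖ := by
    refine norm_le_of_inner_matrixOp_le _ (norm_nonneg _) fun f g => ?_
    rw [inner_matrixOp, Fin.sum_univ_one, Fin.sum_univ_one]
    change ‖inner ℂ (g 0) ((x : K →L[ℂ] K) (f 0))‖ ≤ _
    calc _ ≤ ‖g 0‖ * ‖(x : K →L[ℂ] K) (f 0)‖ := norm_inner_le_norm _ _
      _ ≤ ‖g‖ * (‖(x : K →L[ℂ] K)‖ * ‖f‖) := by
        gcongr
        · exact PiLp.norm_apply_le g 0
        · exact ((x : K →L[ℂ] K).le_opNorm _).trans (by gcongr; exact PiLp.norm_apply_le f 0)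
      _ = _ := by ring
  calc ‖m x‖ ≤ _ := h2
    _ ≤ _ := h1
    _ ≤ |C| * ‖CStarMatrix.ofMatrix (Matrix.of fun _ _ : Fin 1 => (x : K →L[ℂ] K))‖ := by
      gcongr
      exact le_abs_self C
    _ ≤ |C| * ‖x‖ := by gcongr; exact h3

/-- A completely bounded map on the closure of a star algebra that agrees on the latter with a
spatially implemented map is spatially implemented. -/
theorem eq_ampConj_of_isCompletelyBounded (D A : StarSubalgebra ℂ (K →L[ℂ] K)) (hDA : D ≤ A)
    (hA : ∀ x ∈ A, x ∈ closure (D : Set (K →L[ℂ] K)))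
    (m : A →ₗ[ℂ] A) (hm : IsCompletelyBounded m) (P Q : K →L[ℂ] lp (fun _ : κ => K) 2)
    (h : ∀ y (hy : y ∈ D), (m ⟨y, hDA hy⟩ : K →L[ℂ] K) = ampConj P Q y) (x : A) :
    (m x : K →L[ℂ] K) = ampConj P Q x := by
  obtain ⟨C, hC⟩ := hm
  have hcont : Continuous m := (LinearMap.mkContinuous m |C| hC.norm_apply_le).continuous
  obtain ⟨y, hy, hlim⟩ := mem_closure_iff_seq_limit.1 (hA x x.2)
  have h1 : Filter.Tendsto (fun n => (⟨y n, hDA (hy n)⟩ : A)) Filter.atTop (nhds x) :=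
    tendsto_subtype_rng.2 hlim
  have h2 := ((continuous_subtype_val.comp hcont).tendsto x).comp h1
  have h3 := ((continuous_ampConj P Q).tendsto (x : K →L[ℂ] K)).comp hlim
  exact tendsto_nhds_unique h2 (h3.congr fun n => (h (y n) (hy n)).symm)

end Bicommutant

/-! ### Identification of radial maps with the spatial multiplier -/

section Multiplier

open Complexification

variable {E : Type u} [NormedAddCommGroup E] [InnerProductSpace ℝ E] [CompleteSpace E]
  {U : ℝ → E ≃ₗᵢ[ℝ] E} {κ : Type*}
  {P Q : Fock (Complexification E) →L[ℂ] lp (fun _ : κ => Fock (Complexification E)) 2}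
  {φ : ℕ → ℂ}
  {A : StarSubalgebra ℂ (Fock (Complexification E) →L[ℂ] Fock (Complexification E))}

variable (hU : ∀ s t, U (s + t) = U s * U t) (hUc : ∀ x : E, Continuous fun t => U t x)

include hU hUc

theorem wick_vacuum (l : List (Complexification E)) :
    wick (l.map (wickPair U)) (vacuum (Complexification E)) =
      pureTensor fun k : Fin l.length => embeddingOp U (l.get k) := by
  have := wick_ofFn_vacuum fun k : Fin l.length => wickPair U (l.get k)
  conv_lhs => rw [← List.ofFn_get l, List.map_ofFn]
  exact this

theorem IsRadialMap.apply_wick (hA : StarAlgebra.adjoin ℂ (generators U) ≤ A) {m : A →ₗ[ℂ] A}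
    (hm : IsRadialMap U φ m) (l : List (Complexification E)) :
    m ⟨wick (l.map (wickPair U)), hA (wick_mem_adjoin hU hUc l)⟩ =
      φ l.length • ⟨wick (l.map (wickPair U)), hA (wick_mem_adjoin hU hUc l)⟩ :=
  hm l.length _ (fun k => (mem_KC_iff hU hUc).2 ⟨l.get k, rfl⟩) _ (wick_vacuum hU hUc l)

variable (hPQ : ∀ a c : List (Complexification E), ampConj P Q (creWord a * annWord c) =
        φ (a.length + c.length) • (creWord a * annWord c))

include hPQ

theorem ampConj_mem_adjoin {y : Fock (Complexification E) →L[ℂ] Fock (Complexification E)}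
    (hy : y ∈ StarAlgebra.adjoin ℂ (generators U)) :
    ampConj P Q y ∈ StarAlgebra.adjoin ℂ (generators U) := by
  have h := mem_span_wick hU hUc hy
  clear hy
  induction h using Submodule.span_induction with
  | mem w hw =>
    obtain ⟨l, rfl⟩ := hw
    change ampConj P Q (wick (l.map (wickPair U))) ∈ _
    rw [map_wick _ φ hPQ]
    exact SMulMemClass.smul_mem _ (wick_mem_adjoin hU hUc l)
  | zero => rw [map_zero]; exact zero_mem _
  | add a b _ _ ha hb => rw [map_add]; exact add_mem ha hb
  | smul c a _ ha => rw [map_smul]; exact SMulMemClass.smul_mem _ ha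

theorem IsRadialMap.eq_ampConj_of_mem_adjoin (hA : StarAlgebra.adjoin ℂ (generators U) ≤ A)
    {m : A →ₗ[ℂ] A} (hm : IsRadialMap U φ m)
    (y : Fock (Complexification E) →L[ℂ] Fock (Complexification E))
    (hy : y ∈ StarAlgebra.adjoin ℂ (generators U)) :
    (m ⟨y, hA hy⟩ : Fock (Complexification E) →L[ℂ] Fock (Complexification E)) =
      ampConj P Q y := by
  have h := mem_span_wick hU hUc hy
  suffices ∃ hy : y ∈ A, (m ⟨y, hy⟩ : Fock (Complexification E) →L[ℂ] Fock (Complexification E)) =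
      ampConj P Q y from this.2
  clear hy
  induction h using Submodule.span_induction with
  | mem w hw =>
    obtain ⟨l, rfl⟩ := hw
    refine ⟨hA (wick_mem_adjoin hU hUc l), ?_⟩
    have h1 := hm.apply_wick hU hUc hA l
    change (m ⟨wick (l.map (wickPair U)), _⟩ : _ →L[ℂ] _) = ampConj P Q (wick (l.map (wickPair U)))
    rw [map_wick _ φ hPQ, h1, List.length_map]
    rfl
  | zero => exact ⟨zero_mem _, by rw [map_zero]; exact congrArg Subtype.val (map_zero m)⟩
  | add a b _ _ ha hb =>
    obtain ⟨ha, ha'⟩ := ha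
    obtain ⟨hb, hb'⟩ := hb
    refine ⟨add_mem ha hb, ?_⟩
    rw [map_add, ← ha', ← hb']
    exact congrArg Subtype.val (map_add m ⟨a, ha⟩ ⟨b, hb⟩)
  | smul c a _ ha =>
    obtain ⟨ha, ha'⟩ := ha
    refine ⟨SMulMemClass.smul_mem _ ha, ?_⟩
    rw [map_smul, ← ha']
    exact congrArg Subtype.val (map_smul m c ⟨a, ha⟩)

theorem ampConj_mem_Gam {x : Fock (Complexification E) →L[ℂ] Fock (Complexification E)}
    (hx : x ∈ Gam U) : ampConj P Q x ∈ Gam U := by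
  have hx' : x ∈ closure (StarAlgebra.adjoin ℂ (generators U) : Set _) := hx
  exact map_mem_closure (continuous_ampConj P Q) hx' fun y hy => ampConj_mem_adjoin hU hUc hPQ hy

omit hPQ in
theorem GamVN_bicommutant {x : Fock (Complexification E) →L[ℂ] Fock (Complexification E)}
    (hx : x ∈ GamVN U) (p : Fock (Complexification E) →L[ℂ] Fock (Complexification E))
    (hp : ∀ y ∈ StarAlgebra.adjoin ℂ (generators U), y * p = p * y) : x * p = p * x :=
  ((generators_centralizer hU hUc).1 hx p ((adjoin_commute hU hUc).1 hp)).symm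

theorem ampConj_mem_GamVN {x : Fock (Complexification E) →L[ℂ] Fock (Complexification E)}
    (hx : x ∈ GamVN U) : ampConj P Q x ∈ GamVN U := by
  refine (generators_centralizer hU hUc).2 fun p hp => ?_
  exact ampConj_commute_of_bicommutant _ P Q
    (fun y hy => ((adjoin_commute hU hUc).2 hp _ (ampConj_mem_adjoin hU hUc hPQ hy)).symm)
    (GamVN_bicommutant hU hUc hx)

theorem isRadialMap_ampConjRestrict (h : ∀ x ∈ A, ampConj P Q x ∈ A)
    (hA : A ≤ (GamVN U).toStarSubalgebra) : IsRadialMap U φ (ampConjRestrict P Q A h) := by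
  intro n e he x hx
  obtain ⟨l, hl, hxl⟩ := eq_wick_of_vacuum hU hUc (hA x.2) he hx
  refine Subtype.ext ?_
  change ampConj P Q x = φ n • (x : Fock (Complexification E) →L[ℂ] Fock (Complexification E))
  rw [hxl, map_wick _ φ hPQ, List.length_map, hl]

theorem IsRadialMap.eq_ampConj_of_Gam {m : Gam U →ₗ[ℂ] Gam U} (hm : IsRadialMap U φ m)
    (hcb : IsCompletelyBounded m) (x : Gam U) :
    (m x : Fock (Complexification E) →L[ℂ] Fock (Complexification E)) = ampConj P Q x :=
  eq_ampConj_of_isCompletelyBounded _ _ adjoin_le_Gam (fun _ hx => hx) m hcb P Q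
    (hm.eq_ampConj_of_mem_adjoin hU hUc hPQ adjoin_le_Gam) x

theorem IsRadialMap.eq_ampConj_of_GamVN
    {m : (GamVN U).toStarSubalgebra →ₗ[ℂ] (GamVN U).toStarSubalgebra} (hm : IsRadialMap U φ m)
    (hn : IsNormalMap m) (x : (GamVN U).toStarSubalgebra) :
    (m x : Fock (Complexification E) →L[ℂ] Fock (Complexification E)) = ampConj P Q x :=
  eq_ampConj_of_isNormalMap _ _ (adjoin_le_GamVN hU hUc)
    (fun _ hx => GamVN_bicommutant hU hUc hx) m hn P Q
    (hm.eq_ampConj_of_mem_adjoin hU hUc hPQ (adjoin_le_GamVN hU hUc)) x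

end Multiplier

end FreeArakiWoods

end

noncomputable section


namespace FreeArakiWoods

set_option linter.unusedSectionVars false

open ContinuousLinearMap (adjoint)
open Filter Topology

/-! ### Wold decomposition of pure isometries -/

section PureIsometry

variable {L : Type u} [NormedAddCommGroup L] [InnerProductSpace ℂ L] [CompleteSpace L]
  {V : L →L[ℂ] L}

theorem inner_star_left (T : L →L[ℂ] L) (x y : L) : inner ℂ (star T x) y = inner ℂ x (T y) := by
  rw [ContinuousLinearMap.star_eq_adjoint, ContinuousLinearMap.adjoint_inner_left]

theorem inner_star_right (T : L →L[ℂ] L) (x y : L) : inner ℂ x (star T y) = inner ℂ (T x) y := by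
  rw [ContinuousLinearMap.star_eq_adjoint, ContinuousLinearMap.adjoint_inner_right]

theorem star_apply_self_of_isometry (hV : star V * V = 1) (x : L) : star V (V x) = x :=
  congrArg (fun T : L →L[ℂ] L => T x) hV

theorem norm_apply_of_isometry (hV : star V * V = 1) (x : L) : ‖V x‖ = ‖x‖ := by
  have h : inner ℂ (V x) (V x) = inner ℂ x x := by
    rw [← inner_star_right, star_apply_self_of_isometry hV]
  rw [inner_self_eq_norm_sq_to_K, inner_self_eq_norm_sq_to_K] at h
  have h' : ‖V x‖ ^ 2 = ‖x‖ ^ 2 := by exact_mod_cast h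
  exact (pow_left_inj₀ (norm_nonneg _) (norm_nonneg _) two_ne_zero).1 h'

theorem norm_star_apply_le_of_isometry (hV : star V * V = 1) (x : L) : ‖star V x‖ ≤ ‖x‖ := by
  have h : ‖V‖ ≤ 1 :=
    ContinuousLinearMap.opNorm_le_bound _ zero_le_one fun x => by
      rw [one_mul, norm_apply_of_isometry hV]
  have h2 : ‖star V‖ ≤ 1 := (norm_star V).trans_le h
  simpa using (star V).le_of_opNorm_le h2 x

theorem norm_wandering_sq (hV : star V * V = 1) (x : L) :
    ‖x - V (star V x)‖ ^ 2 = ‖x‖ ^ 2 - ‖star V x‖ ^ 2 := by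
  rw [norm_sub_sq (𝕜 := ℂ), norm_apply_of_isometry hV, ← inner_star_left,
    inner_self_eq_norm_sq (𝕜 := ℂ)]
  ring

/-- The terms telescope to ‖x‖² - ‖V*^m x‖², and purity removes the remainder. -/
theorem hasSum_norm_wandering_sq (hV : star V * V = 1)
    (hp : ∀ x, Tendsto (fun n => (star V ^ n) x) atTop (𝓝 0)) (x : L) :
    HasSum (fun n => ‖(star V ^ n) x - V (star V ((star V ^ n) x))‖ ^ 2) (‖x‖ ^ 2) := by
  rw [hasSum_iff_tendsto_nat_of_nonneg fun n => by positivity]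
  have h : ∀ m, ∑ n ∈ Finset.range m, ‖(star V ^ n) x - V (star V ((star V ^ n) x))‖ ^ 2 =
      ‖x‖ ^ 2 - ‖(star V ^ m) x‖ ^ 2 := by
    intro m
    induction m with
    | zero => simp
    | succ m ih =>
      have hs : (star V ^ (m + 1)) x = star V ((star V ^ m) x) := by
        rw [pow_succ']
        rfl
      rw [Finset.sum_range_succ, ih, norm_wandering_sq hV, hs]
      ring
  simp_rw [h]
  simpa using tendsto_const_nhds.sub ((hp x).norm.pow 2)

/-- The component of the Wold decomposition of a pure isometry along a vector. -/
def woldOp (hV : star V * V = 1) (hp : ∀ x, Tendsto (fun n => (star V ^ n) x) atTop (𝓝 0))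
    (e : L) : L →L[ℂ] ellTwo :=
  columnOp (fun n => innerSL ℂ e ∘L (1 - V * star V) ∘L (star V ^ n)) ‖e‖ (norm_nonneg _) (by
    intro v
    have h1 : ∑' n, ‖(star V ^ n) v - V (star V ((star V ^ n) v))‖ₑ ^ 2 = ‖v‖ₑ ^ 2 := by
      have h := hasSum_norm_wandering_sq hV hp v
      have h2 := ENNReal.ofReal_tsum_of_nonneg (fun n => by positivity) h.summable
      rw [h.tsum_eq] at h2
      simpa [ENNReal.ofReal_pow, ofReal_norm] using h2.symm
    rw [← h1, ← ENNReal.tsum_mul_left]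
    refine ENNReal.tsum_le_tsum fun n => ?_
    rw [← mul_pow, ofReal_norm]
    refine pow_le_pow_left₀ zero_le ?_ 2
    change ‖inner ℂ e ((star V ^ n) v - V (star V ((star V ^ n) v)))‖ₑ ≤ _
    rw [← ofReal_norm, ← ofReal_norm, ← ofReal_norm, ← ENNReal.ofReal_mul (norm_nonneg _)]
    exact ENNReal.ofReal_le_ofReal (norm_inner_le_norm _ _))

theorem woldOp_apply (hV : star V * V = 1) (hp) (e x : L) (n : ℕ) :
    woldOp hV hp e x n = inner ℂ e ((star V ^ n) x - V (star V ((star V ^ n) x))) := rfl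

theorem woldOp_isometry (hV : star V * V = 1) (hp) (e x : L) :
    woldOp hV hp e (V x) = unilateralShift (woldOp hV hp e x) := by
  ext n
  cases n with
  | zero =>
    rw [woldOp_apply, pow_zero]
    change inner ℂ e (V x - V (star V (V x))) = 0
    rw [star_apply_self_of_isometry hV, sub_self, inner_zero_right]
  | succ n =>
    change _ = woldOp hV hp e x n
    rw [woldOp_apply, woldOp_apply, pow_succ]
    change inner ℂ e ((star V ^ n) (star V (V x)) - V (star V ((star V ^ n) (star V (V x))))) = _
    rw [star_apply_self_of_isometry hV]

theorem woldOp_star (hV : star V * V = 1) (hp) (e x : L) :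
    woldOp hV hp e (star V x) = star unilateralShift (woldOp hV hp e x) := by
  ext n
  refine Eq.trans ?_ (star_unilateralShift_apply _ n).symm
  rw [woldOp_apply, woldOp_apply, pow_succ]
  rfl

theorem enorm_sq_eq_tsum_woldOp {ι : Type*} (b : HilbertBasis ι ℂ L) (hV : star V * V = 1) (hp)
    (x : L) : ∑' i, ‖woldOp hV hp (b i) x‖ₑ ^ 2 = ‖x‖ₑ ^ 2 := by
  have hpars : ∀ y : L, ∑' i, ‖inner ℂ (b i) y‖ₑ ^ 2 = ‖y‖ₑ ^ 2 := fun y => by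
    have h := lp_enorm_sq (b.repr y)
    have h2 : ‖b.repr y‖ₑ = ‖y‖ₑ := by rw [← ofReal_norm, b.repr.norm_map, ofReal_norm]
    rw [h2] at h
    rw [h]
    exact tsum_congr fun i => by rw [b.repr_apply_apply]
  have h := hasSum_norm_wandering_sq hV hp x
  have h2 := ENNReal.ofReal_tsum_of_nonneg (fun n => by positivity) h.summable
  rw [h.tsum_eq] at h2
  simp_rw [lp_enorm_sq, woldOp_apply]
  rw [ENNReal.tsum_comm]
  simp_rw [hpars]
  simpa [ENNReal.ofReal_pow, ofReal_norm] using h2.symm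

/-- The von Neumann inequality for the Toeplitz operators of a pure isometry. -/
theorem norm_sum_isometry_le (hV : star V * V = 1)
    (hp : ∀ x, Tendsto (fun n => (star V ^ n) x) atTop (𝓝 0)) (s : Finset (ℕ × ℕ))
    (c : ℕ × ℕ → ℂ) :
    ‖∑ p ∈ s, c p • (V ^ p.1 * star V ^ p.2)‖ ≤
      ‖∑ p ∈ s, c p • (unilateralShift ^ p.1 * star unilateralShift ^ p.2)‖ := by
  set T := ∑ p ∈ s, c p • (unilateralShift ^ p.1 * star unilateralShift ^ p.2) with hT
  obtain ⟨w, b, -⟩ := exists_hilbertBasis ℂ L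
  have hstar : ∀ (n : ℕ) (e x : L), woldOp hV hp e ((star V ^ n) x) =
      (star unilateralShift ^ n) (woldOp hV hp e x) := by
    intro n e x
    induction n with
    | zero => rfl
    | succ n ih =>
      rw [pow_succ', pow_succ']
      change woldOp hV hp e (star V ((star V ^ n) x)) =
        star unilateralShift ((star unilateralShift ^ n) _)
      rw [woldOp_star, ih]
  have hpow : ∀ (n : ℕ) (e x : L), woldOp hV hp e ((V ^ n) x) =
      (unilateralShift ^ n) (woldOp hV hp e x) := by
    intro n e x
    induction n with
    | zero => rfl
    | succ n ih =>
      rw [pow_succ', pow_succ']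
      change woldOp hV hp e (V ((V ^ n) x)) = unilateralShift ((unilateralShift ^ n) _)
      rw [woldOp_isometry, ih]
  -- Each Wold component intertwines V and V* with S and S*. Summing the squares over an orthonormal
  -- basis of vectors e recovers norms, so the bound for S passes to V.
  have hint : ∀ e x, woldOp hV hp e ((∑ p ∈ s, c p • (V ^ p.1 * star V ^ p.2)) x) =
      T (woldOp hV hp e x) := by
    intro e x
    rw [hT, _root_.sum_apply, _root_.sum_apply, map_sum]
    refine Finset.sum_congr rfl fun p _ => ?_
    change woldOp hV hp e (c p • (V ^ p.1) ((star V ^ p.2) x)) =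
      c p • (unilateralShift ^ p.1) ((star unilateralShift ^ p.2) (woldOp hV hp e x))
    rw [map_smul, hpow, hstar]
  refine ContinuousLinearMap.opNorm_le_bound _ (norm_nonneg T) fun x => ?_
  have h : ‖(∑ p ∈ s, c p • (V ^ p.1 * star V ^ p.2)) x‖ₑ ^ 2 ≤ (‖T‖ₑ * ‖x‖ₑ) ^ 2 := by
    rw [← enorm_sq_eq_tsum_woldOp b hV hp, mul_pow, ← enorm_sq_eq_tsum_woldOp b hV hp x,
      ← ENNReal.tsum_mul_left]
    refine ENNReal.tsum_le_tsum fun i => ?_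
    rw [hint, ← mul_pow]
    exact pow_le_pow_left₀ zero_le (ContinuousLinearMap.le_opENorm T _) 2
  have h2 := (ENNReal.pow_le_pow_left_iff two_ne_zero).1 h
  rw [← ofReal_norm, ← ofReal_norm, ← ofReal_norm, ← ENNReal.ofReal_mul (norm_nonneg _)] at h2
  exact (ENNReal.ofReal_le_ofReal_iff (by positivity)).1 h2

/-- The partial sums of the orbit of a wandering vector. -/
def orbitVec (V : L →L[ℂ] L) (x : L) (M : ℕ) : L := ∑ m ∈ Finset.range M, (V ^ m) x

/-- A unit vector in the kernel of V* generates an orthonormal orbit, on which V acts as the shift.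
-/
theorem inner_pow_wandering (hV : star V * V = 1) {x : L} (hx : star V x = 0) (hx1 : ‖x‖ = 1)
    (m n : ℕ) : inner ℂ ((V ^ m) x) ((V ^ n) x) = if m = n then 1 else 0 := by
  have hstep : ∀ y z, inner ℂ (V y) (V z) = inner ℂ y z := fun y z => by
    rw [← inner_star_right, star_apply_self_of_isometry hV]
  induction m generalizing n with
  | zero =>
    cases n with
    | zero => simp [hx1]
    | succ n =>
      rw [pow_succ']
      change inner ℂ x (V ((V ^ n) x)) = _
      rw [← inner_star_left, hx, inner_zero_left, if_neg (by omega)]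
  | succ m ih =>
    cases n with
    | zero =>
      rw [pow_succ']
      change inner ℂ (V ((V ^ m) x)) x = _
      rw [← inner_star_right, hx, inner_zero_right, if_neg (by omega)]
    | succ n =>
      rw [pow_succ', pow_succ']
      change inner ℂ (V ((V ^ m) x)) (V ((V ^ n) x)) = _
      rw [hstep, ih]
      simp

theorem inner_orbitVec (hV : star V * V = 1) {x : L} (hx : star V x = 0) (hx1 : ‖x‖ = 1)
    (m n : ℕ) : inner ℂ (orbitVec V x m) (orbitVec V x n) = ((min m n : ℕ) : ℂ) := by
  unfold orbitVec
  simp_rw [sum_inner, inner_sum, inner_pow_wandering hV hx hx1]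
  simp only [Finset.sum_ite_eq, Finset.mem_range]
  rw [Finset.sum_ite, Finset.sum_const_zero, add_zero, Finset.sum_const, nsmul_eq_mul, mul_one]
  congr 1
  have : {k ∈ Finset.range m | k < n} = Finset.range (min m n) := by
    ext k
    simp
  rw [this, Finset.card_range]

theorem star_pow_orbitVec (hV : star V * V = 1) {x : L} (hx : star V x = 0) (M j : ℕ) :
    (star V ^ j) (orbitVec V x M) = orbitVec V x (M - j) := by
  have h1 : ∀ M, star V (orbitVec V x M) = orbitVec V x (M - 1) := by
    intro M
    cases M with
    | zero => simp [orbitVec]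
    | succ M =>
      rw [orbitVec, Finset.sum_range_succ', map_add, map_sum]
      simp only [pow_zero]
      rw [show star V ((1 : L →L[ℂ] L) x) = 0 from hx, add_zero]
      refine Finset.sum_congr rfl fun m _ => ?_
      rw [pow_succ']
      exact star_apply_self_of_isometry hV _
  induction j with
  | zero => rfl
  | succ j ih =>
    rw [pow_succ']
    change star V ((star V ^ j) _) = _
    rw [ih, h1, Nat.sub_sub]

end PureIsometry

/-! ### Infinite matrices over the algebra, tested on finite vectors -/

section MatrixTest

variable {K : Type u} [NormedAddCommGroup K] [InnerProductSpace ℂ K] [CompleteSpace K]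

/-- The finitely supported sequence with the given entries. -/
def finSeq {n : ℕ} (f : PiLp 2 (fun _ : Fin n => K)) : lp (fun _ : ℕ => K) 2 :=
  ∑ q : Fin n, lp.single 2 (q : ℕ) (f q)

theorem inner_finSeq_left {n : ℕ} (g : PiLp 2 (fun _ : Fin n => K)) (f : lp (fun _ : ℕ => K) 2) :
    inner ℂ (finSeq g) f = ∑ q : Fin n, inner ℂ (g q) (f q) := by
  rw [finSeq, sum_inner]
  exact Finset.sum_congr rfl fun q _ => lp.inner_single_left _ _ _

theorem finSeq_apply {n : ℕ} (f : PiLp 2 (fun _ : Fin n => K)) (q : Fin n) :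
    finSeq f q = f q := by
  refine ext_inner_left ℂ fun x : K => ?_
  refine (lp.inner_single_left (𝕜 := ℂ) (G := fun _ : ℕ => K) (q : ℕ) x (finSeq f)).symm.trans ?_
  rw [finSeq, inner_sum, Finset.sum_eq_single q]
  · rw [lp.inner_single_left, lp.single_apply_self]
  · intro q' _ h
    rw [lp.inner_single_left, lp.single_apply_ne, inner_zero_right]
    exact fun h' => h (Fin.ext h').symm
  · simp

theorem norm_finSeq {n : ℕ} (f : PiLp 2 (fun _ : Fin n => K)) : ‖finSeq f‖ = ‖f‖ := by
  have h : inner ℂ (finSeq f) (finSeq f) = inner ℂ f f := by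
    rw [inner_finSeq_left, PiLp.inner_apply]
    simp_rw [finSeq_apply]
  rw [inner_self_eq_norm_sq_to_K, inner_self_eq_norm_sq_to_K] at h
  have h' : ‖finSeq f‖ ^ 2 = ‖f‖ ^ 2 := by exact_mod_cast h
  exact (pow_left_inj₀ (norm_nonneg _) (norm_nonneg _) two_ne_zero).1 h'

theorem exists_finSeq_eq {f : lp (fun _ : ℕ => K) 2} {n : ℕ} (h : ∀ q, n ≤ q → f q = 0) :
    ∃ f' : PiLp 2 (fun _ : Fin n => K), finSeq f' = f := by
  refine ⟨WithLp.toLp 2 fun q : Fin n => f q, ?_⟩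
  have := lp.hasSum_single (p := 2) (by norm_num) f
  refine Eq.trans ?_ (this.unique (hasSum_sum_of_ne_finset_zero (s := Finset.range n) ?_)).symm
  · exact (Finset.sum_range (fun q => (lp.single 2 q (f q) : lp (fun _ : ℕ => K) 2))).symm
  · intro q hq
    rw [h q (by simpa using hq)]
    exact lp.single_zero _ _

theorem inner_finSeq_apply_finSeq {n : ℕ} (X : lp (fun _ : ℕ => K) 2 →L[ℂ] lp (fun _ : ℕ => K) 2)
    (a : Fin n → Fin n → K →L[ℂ] K)
    (ha : ∀ (q q' : Fin n) x, X (lp.single 2 (q' : ℕ) x) (q : ℕ) = a q q' x)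
    (f g : PiLp 2 (fun _ : Fin n => K)) :
    inner ℂ (finSeq g) (X (finSeq f)) =
      inner ℂ g (matrixOp (CStarMatrix.ofMatrix (Matrix.of a)) f) := by
  rw [inner_finSeq_left, inner_matrixOp]
  refine Finset.sum_congr rfl fun q _ => ?_
  rw [finSeq, map_sum, ← inner_sum]
  congr 1
  refine (congrFun (lp.coeFn_sum _ _) (q : ℕ)).trans ?_
  rw [Finset.sum_apply]
  exact Finset.sum_congr rfl fun q' _ => ha q q' _

/-- Completely bounded maps act boundedly on operators on `ℓ²(ℕ, K)` with entries in the algebra,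
as long as they are tested on finitely supported vectors. -/
theorem CBBound.norm_inner_le {A : StarSubalgebra ℂ (K →L[ℂ] K)} {m : A →ₗ[ℂ] A} {C : ℝ}
    (hC : 0 ≤ C) (hm : CBBound m C)
    (X Y : lp (fun _ : ℕ => K) 2 →L[ℂ] lp (fun _ : ℕ => K) 2)
    (h : ∀ q q' : ℕ, ∃ a : A, (∀ x, X (lp.single 2 q' x) q = (a : K →L[ℂ] K) x) ∧
      ∀ x, Y (lp.single 2 q' x) q = (m a : K →L[ℂ] K) x)
    {f : lp (fun _ : ℕ => K) 2} {n : ℕ} (hf : ∀ q, n ≤ q → f q = 0) :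
    ‖inner ℂ f (Y f)‖ ≤ C * ‖X‖ * ‖f‖ * ‖f‖ := by
  obtain ⟨f, rfl⟩ := exists_finSeq_eq hf
  choose a ha ha' using h
  -- A finite corner of X has norm at most that of X, so the complete bound at level n applies with
  -- a constant independent of n.
  have hX : ‖CStarMatrix.ofMatrix
      (Matrix.of fun q q' : Fin n => (a q q' : K →L[ℂ] K))‖ ≤ ‖X‖ := by
    refine norm_le_of_inner_matrixOp_le _ (norm_nonneg _) fun f g => ?_
    rw [← inner_finSeq_apply_finSeq X _ (fun q q' x => ha q q' x), ← norm_finSeq f,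
      ← norm_finSeq g, mul_comm ‖X‖, mul_assoc]
    exact (norm_inner_le_norm _ _).trans (by gcongr; exact X.le_opNorm _)
  rw [inner_finSeq_apply_finSeq Y _ (fun q q' x => ha' q q' x), norm_finSeq]
  refine (norm_inner_matrixOp_le _ _ _).trans ?_
  gcongr
  exact (hm n fun q q' => a q q').trans (by gcongr)

end MatrixTest

/-! ### Operators ∑ aₖ ⊗ Bₖ with isometries aₖ of orthogonal ranges -/

section Branch

variable {K : Type u} [NormedAddCommGroup K] [InnerProductSpace ℂ K] [CompleteSpace K]
  {N : ℕ} [NeZero N]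

/-- The operator on `ℓ²(ℕ, K)` given by `f ↦ (B_k (f q))` at the place `q N + k`. -/
def branchOp (B : Fin N → K →L[ℂ] K) : lp (fun _ : ℕ => K) 2 →L[ℂ] lp (fun _ : ℕ => K) 2 :=
  columnOp (fun n => B (Nat.divModEquiv N n).2 ∘L
      lp.evalCLM ℂ (fun _ : ℕ => K) 2 (Nat.divModEquiv N n).1)
    (Real.sqrt (∑ k, ‖B k‖ ^ 2)) (Real.sqrt_nonneg _) (by
    intro v
    have hC : ENNReal.ofReal (Real.sqrt (∑ k, ‖B k‖ ^ 2)) ^ 2 = ∑ k, ‖B k‖ₑ ^ 2 := by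
      rw [← ENNReal.ofReal_pow (Real.sqrt_nonneg _), Real.sq_sqrt (by positivity),
        ENNReal.ofReal_sum_of_nonneg fun k _ => by positivity]
      exact Finset.sum_congr rfl fun k _ => by
        rw [ENNReal.ofReal_pow (norm_nonneg _), ofReal_norm]
    rw [hC, lp_enorm_sq, ← ENNReal.tsum_mul_left]
    refine ((Nat.divModEquiv N).tsum_eq (fun p : ℕ × Fin N => ‖B p.2 (v p.1)‖ₑ ^ 2)).trans_le ?_
    rw [ENNReal.tsum_prod (f := fun q k => ‖B k (v q)‖ₑ ^ 2)]
    refine ENNReal.tsum_le_tsum fun q => ?_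
    rw [tsum_fintype, Finset.sum_mul]
    refine Finset.sum_le_sum fun k _ => ?_
    rw [← mul_pow]
    exact pow_le_pow_left₀ zero_le (ContinuousLinearMap.le_opENorm _ _) 2)

theorem branchOp_apply (B : Fin N → K →L[ℂ] K) (f : lp (fun _ : ℕ => K) 2) (n : ℕ) :
    branchOp B f n = B (Nat.divModEquiv N n).2 (f (Nat.divModEquiv N n).1) := rfl

theorem star_branchOp_apply (B : Fin N → K →L[ℂ] K) (g : lp (fun _ : ℕ => K) 2) (q : ℕ) :
    star (branchOp B) g q = ∑ k, star (B k) (g ((Nat.divModEquiv N).symm (q, k))) := by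
  refine ext_inner_left ℂ fun x : K => ?_
  refine (lp.inner_single_left (𝕜 := ℂ) (G := fun _ : ℕ => K) q x _).symm.trans ?_
  rw [inner_star_right, lp.inner_eq_tsum, inner_sum]
  simp_rw [branchOp_apply]
  rw [← (Nat.divModEquiv N).symm.tsum_eq]
  simp_rw [Equiv.apply_symm_apply]
  rw [tsum_eq_sum (s := {q} ×ˢ Finset.univ)]
  · rw [Finset.sum_product, Finset.sum_singleton]
    refine Finset.sum_congr rfl fun k _ => ?_
    rw [inner_star_right, lp.single_apply_self]
  · rintro ⟨q', k⟩ h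
    have hne : q' ≠ q := by simpa [eq_comm] using h
    have h0 : (lp.single 2 q x : lp (fun _ : ℕ => K) 2) q' = 0 :=
      lp.single_apply_ne (E := fun _ : ℕ => K) 2 q x hne
    refine (congrArg (fun y => inner ℂ (B k y) (g ((Nat.divModEquiv N).symm (q', k)))) h0).trans ?_
    rw [map_zero, inner_zero_left]

theorem star_branchOp_mul_branchOp (B B' : Fin N → K →L[ℂ] K) {c : ℂ}
    (h : ∑ k, star (B k) * B' k = c • 1) : star (branchOp B) * branchOp B' = c • 1 := by
  ext f q
  refine (star_branchOp_apply B (branchOp B' f) q).trans ?_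
  simp_rw [branchOp_apply, Equiv.apply_symm_apply]
  have := congrArg (fun T : K →L[ℂ] K => T (f q)) h
  simp only [_root_.sum_apply] at this
  exact this

theorem branchOp_mul_star_branchOp (B B' : Fin N → K →L[ℂ] K) {c : ℂ}
    (h : ∀ k l, B k * star (B' l) = if k = l then c • 1 else 0) :
    branchOp B * star (branchOp B') = c • 1 := by
  ext f n
  change B _ (star (branchOp B') f _) = c • f n
  rw [star_branchOp_apply, map_sum, Finset.sum_eq_single (Nat.divModEquiv N n).2]
  · have := congrArg (fun T : K →L[ℂ] K => T (f n))
      (h (Nat.divModEquiv N n).2 (Nat.divModEquiv N n).2)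
    rw [if_pos rfl] at this
    rw [Prod.mk.eta, Equiv.symm_apply_apply]
    exact this
  · intro l _ hl
    have := congrArg (fun T : K →L[ℂ] K =>
      T (f ((Nat.divModEquiv N).symm ((Nat.divModEquiv N n).1, l)))) (h (Nat.divModEquiv N n).2 l)
    rw [if_neg hl.symm] at this
    exact this
  · simp

theorem branchOp_finite_support (B : Fin N → K →L[ℂ] K) {f : lp (fun _ : ℕ => K) 2}
    (hf : ∃ n, ∀ q, n ≤ q → f q = 0) : ∃ n, ∀ q, n ≤ q → branchOp B f q = 0 := by
  obtain ⟨n, hn⟩ := hf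
  refine ⟨n * N, fun q hq => ?_⟩
  have h0 : f (Nat.divModEquiv N q).1 = 0 := hn _ ((Nat.le_div_iff_mul_le (NeZero.pos N)).2 hq)
  exact (congrArg (B (Nat.divModEquiv N q).2) h0).trans (map_zero _)

/-- The hypothesis makes the product of the operator with its adjoint equal to r², and the
C*-identity does the rest. -/
theorem norm_branchOp_le_of_mul_star {B : Fin N → K →L[ℂ] K} {r : ℝ} (hr : 0 ≤ r)
    (h : ∀ k l, B k * star (B l) = if k = l then ((r ^ 2 : ℝ) : ℂ) • 1 else 0) :
    ‖branchOp B‖ ≤ r := by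
  have h1 := branchOp_mul_star_branchOp B B h
  have h2 : ‖branchOp B‖ * ‖branchOp B‖ ≤ r ^ 2 := by
    rw [← CStarRing.norm_self_mul_star, h1, norm_smul, Complex.norm_real,
      Real.norm_of_nonneg (sq_nonneg r)]
    exact mul_le_of_le_one_right (sq_nonneg r) ContinuousLinearMap.norm_id_le
  exact abs_le_of_sq_le_sq' (by rwa [sq]) hr |>.2

end Branch

end FreeArakiWoods

end

noncomputable section


namespace FreeArakiWoods

set_option linter.unusedSectionVars false

open ContinuousLinearMap (adjoint)
open Filter Topology

section Entries

variable {K : Type u} [NormedAddCommGroup K] [InnerProductSpace ℂ K] [CompleteSpace K]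

/-- The matrix entries of an operator on `ℓ²(ℕ, K)`. -/
def entry (q q' : ℕ) :
    (lp (fun _ : ℕ => K) 2 →L[ℂ] lp (fun _ : ℕ => K) 2) →ₗ[ℂ] (K →L[ℂ] K) where
  toFun X := lp.evalCLM ℂ (fun _ : ℕ => K) 2 q ∘L X ∘L
    lp.singleContinuousLinearMap ℂ (fun _ : ℕ => K) 2 q'
  map_add' _ _ := rfl
  map_smul' _ _ := rfl

theorem entry_apply (q q' : ℕ) (X : lp (fun _ : ℕ => K) 2 →L[ℂ] lp (fun _ : ℕ => K) 2) (x : K) :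
    entry q q' X x = X (lp.single 2 q' x) q := rfl

theorem entry_one (q q' : ℕ) :
    entry q q' (1 : lp (fun _ : ℕ => K) 2 →L[ℂ] lp (fun _ : ℕ => K) 2) =
      if q = q' then 1 else 0 := by
  ext1 x
  refine (entry_apply q q' 1 x).trans ?_
  split_ifs with h
  · subst h
    exact lp.single_apply_self (E := fun _ : ℕ => K) 2 q x
  · exact lp.single_apply_ne (E := fun _ : ℕ => K) 2 q' x h

variable {N : ℕ} [NeZero N]

theorem entry_branchOp_mul (B : Fin N → K →L[ℂ] K) (q q' : ℕ)
    (X : lp (fun _ : ℕ => K) 2 →L[ℂ] lp (fun _ : ℕ => K) 2) :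
    entry q q' (branchOp B * X) =
      B (Nat.divModEquiv N q).2 * entry (Nat.divModEquiv N q).1 q' X := rfl

theorem entry_star_branchOp_mul (B : Fin N → K →L[ℂ] K) (q q' : ℕ)
    (X : lp (fun _ : ℕ => K) 2 →L[ℂ] lp (fun _ : ℕ => K) 2) :
    entry q q' (star (branchOp B) * X) =
      ∑ k, star (B k) * entry ((Nat.divModEquiv N).symm (q, k)) q' X := by
  ext1 x
  rw [_root_.sum_apply]
  exact star_branchOp_apply B _ q

end Entries

/-! ### Products of V, V* perturbed by D, D* -/

section MixedProducts

variable {L : Type u} [NormedAddCommGroup L] [InnerProductSpace ℂ L] [CompleteSpace L]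

/-- The perturbation of `V^i V*^j` obtained by expanding Wick products. -/
def mixedProd (V D : L →L[ℂ] L) : ℕ → ℕ → L →L[ℂ] L
  | 0, 0 => 1
  | 0, j + 1 => star D * mixedProd V D 0 j + star V ^ (j + 1)
  | i + 1, j => V * mixedProd V D i j + D ^ (i + 1) * star V ^ j

theorem norm_pow_le_one {T : L →L[ℂ] L} (h : ‖T‖ ≤ 1) (n : ℕ) : ‖T ^ n‖ ≤ 1 := by
  induction n with
  | zero => exact ContinuousLinearMap.norm_id_le
  | succ n ih =>
    rw [pow_succ]
    exact (norm_mul_le _ _).trans (mul_le_one₀ ih (norm_nonneg _) h)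

/-- Apart from V^i V*^j, the expansion has i + j terms, each with at least one factor D or D* and
otherwise contractions. -/
theorem norm_mixedProd_sub_le {V D : L →L[ℂ] L} {r : ℝ} (hr : r ≤ 1) (hV : ‖V‖ ≤ 1) (hD : ‖D‖ ≤ r)
    (i j : ℕ) : ‖mixedProd V D i j - V ^ i * star V ^ j‖ ≤ (i + j) * r := by
  have hV' : ∀ n, ‖star V ^ n‖ ≤ 1 := norm_pow_le_one ((norm_star V).trans_le hV)
  have hr0 : 0 ≤ r := (norm_nonneg D).trans hD
  have hzero : ∀ j : ℕ, ‖mixedProd V D 0 j - star V ^ j‖ ≤ j * r := by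
    intro j
    induction j with
    | zero => simp [mixedProd]
    | succ j ih =>
      have h : mixedProd V D 0 (j + 1) - star V ^ (j + 1) =
          star D * (mixedProd V D 0 j - star V ^ j) + star D * star V ^ j := by
        rw [mixedProd, mul_sub]
        abel
      rw [h]
      have hD' : ‖star D‖ ≤ r := (norm_star D).trans_le hD
      have h1 : ‖star D * (mixedProd V D 0 j - star V ^ j)‖ ≤ 1 * (j * r) :=
        (norm_mul_le _ _).trans (mul_le_mul (hD'.trans hr) ih (norm_nonneg _) zero_le_one)
      have h2 : ‖star D * star V ^ j‖ ≤ r * 1 :=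
        (norm_mul_le _ _).trans (mul_le_mul hD' (hV' j) (norm_nonneg _) hr0)
      refine (norm_add_le _ _).trans ((add_le_add h1 h2).trans_eq ?_)
      push_cast
      ring
  induction i with
  | zero => simpa using hzero j
  | succ i ih =>
    have h : mixedProd V D (i + 1) j - V ^ (i + 1) * star V ^ j =
        V * (mixedProd V D i j - V ^ i * star V ^ j) + D * (D ^ i * star V ^ j) := by
      rw [mixedProd, mul_sub, pow_succ' D, pow_succ' V, mul_assoc, mul_assoc]
      abel
    rw [h]
    have h1 : ‖V * (mixedProd V D i j - V ^ i * star V ^ j)‖ ≤ 1 * ((i + j) * r) :=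
      (norm_mul_le _ _).trans (mul_le_mul hV ih (norm_nonneg _) zero_le_one)
    have h3 : ‖D ^ i * star V ^ j‖ ≤ 1 :=
      (norm_mul_le _ _).trans (mul_le_one₀ (norm_pow_le_one (hD.trans hr) i) (norm_nonneg _) (hV' j))
    have h2 : ‖D * (D ^ i * star V ^ j)‖ ≤ r * 1 :=
      (norm_mul_le _ _).trans (mul_le_mul hD h3 (norm_nonneg _) hr0)
    refine (norm_add_le _ _).trans ((add_le_add h1 h2).trans_eq ?_)
    push_cast
    ring

end MixedProducts

/-! ### The approximating pure isometry -/

section BranchCreation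

variable {H : Type u} [NormedAddCommGroup H] [InnerProductSpace ℂ H] {N : ℕ} [NeZero N]

/-- The normalisation constant `N^{-1/2}`. -/
def branchScale (N : ℕ) : ℝ := (Real.sqrt N)⁻¹

theorem branchScale_nonneg (N : ℕ) : 0 ≤ branchScale N := inv_nonneg.2 (Real.sqrt_nonneg _)

theorem branchScale_sq (N : ℕ) : branchScale N ^ 2 = (N : ℝ)⁻¹ := by
  rw [branchScale, inv_pow, Real.sq_sqrt (Nat.cast_nonneg N)]

theorem branchScale_le_one (N : ℕ) [NeZero N] : branchScale N ≤ 1 := by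
  refine inv_le_one_of_one_le₀ (Real.one_le_sqrt.2 ?_)
  exact_mod_cast NeZero.one_le

/-- The operator `N^{-1/2} ∑ a_k ⊗ ℓ(e_k)`. -/
def branchCreation (e : Fin N → H) : lp (fun _ : ℕ => Fock H) 2 →L[ℂ] lp (fun _ : ℕ => Fock H) 2 :=
  branchOp fun k => (branchScale N : ℂ) • creation (e k)

/-- The operator `N^{-1/2} ∑ a_k ⊗ ℓ(e_k)*`. -/
def branchAnnihilation (e : Fin N → H) :
    lp (fun _ : ℕ => Fock H) 2 →L[ℂ] lp (fun _ : ℕ => Fock H) 2 :=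
  branchOp fun k => (branchScale N : ℂ) • star (creation (e k))

theorem star_branchCreation_mul_self {e : Fin N → H} (he : Orthonormal ℂ e) :
    star (branchCreation e) * branchCreation e = 1 := by
  have h := star_branchOp_mul_branchOp (c := 1) (fun k => (branchScale N : ℂ) • creation (e k))
    (fun k => (branchScale N : ℂ) • creation (e k)) ?_
  · rwa [one_smul] at h
  · have hk : ∀ k, star ((branchScale N : ℂ) • creation (e k)) *
        ((branchScale N : ℂ) • creation (e k)) = ((branchScale N ^ 2 : ℝ) : ℂ) • 1 := by
      intro k
      rw [star_smul, smul_mul_smul_comm, star_creation_mul_creation, orthonormal_iff_ite.1 he k k,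
        if_pos rfl, one_smul, Complex.star_def, Complex.conj_ofReal, sq]
      push_cast
      rfl
    simp_rw [hk]
    rw [Finset.sum_const, Finset.card_univ, Fintype.card_fin, ← Nat.cast_smul_eq_nsmul ℂ, smul_smul,
      branchScale_sq]
    congr 1
    have : (N : ℂ) ≠ 0 := Nat.cast_ne_zero.2 (NeZero.ne N)
    push_cast
    exact mul_inv_cancel₀ this

/-- Orthonormality makes the operators ℓ(eₖ)* satisfy the row relation ℓ(eₖ)*ℓ(eₗ) = δₖₗ, so D D* =
1/N. The same N summands add up to 1 for the creation operators, where the column relation is used.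
-/
theorem norm_branchAnnihilation_le {e : Fin N → H} (he : Orthonormal ℂ e) :
    ‖branchAnnihilation e‖ ≤ branchScale N := by
  refine norm_branchOp_le_of_mul_star (branchScale_nonneg N) fun k l => ?_
  rw [star_smul, star_star, smul_mul_smul_comm, star_creation_mul_creation,
    orthonormal_iff_ite.1 he k l, Complex.star_def, Complex.conj_ofReal, sq]
  split_ifs
  · rw [one_smul]
    push_cast
    rfl
  · rw [zero_smul, smul_zero]

theorem star_branchCreation_apply (e : Fin N → H) (f : lp (fun _ : ℕ => Fock H) 2) (q : ℕ) :
    star (branchCreation e) f q = ∑ k, (branchScale N : ℂ) •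
      star (creation (e k)) (f ((Nat.divModEquiv N).symm (q, k))) := by
  refine (star_branchOp_apply _ f q).trans (Finset.sum_congr rfl fun k _ => ?_)
  rw [star_smul, Complex.star_def, Complex.conj_ofReal]
  rfl

theorem norm_vacuum : ‖vacuum H‖ = 1 := by
  have h : ‖tensorVec 0 (Fin.elim0 : Fin 0 → H)‖ = 1 := by
    change ‖(EuclideanSpace.single PUnit.unit 1 : EuclideanSpace ℂ PUnit.{u + 1})‖ = 1
    simp
  exact (lp.norm_single (p := 2) (by norm_num) 0 _).trans h

theorem star_branchCreation_single_vacuum (e : Fin N → H) :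
    star (branchCreation e) (lp.single 2 0 (vacuum H)) = 0 := by
  ext1
  funext q
  refine (star_branchCreation_apply e _ q).trans (Finset.sum_eq_zero fun k _ => ?_)
  by_cases h : (Nat.divModEquiv N).symm (q, k) = 0
  · rw [h, lp.single_apply_self, star_creation_vacuum, smul_zero]
  · have h0 : (lp.single 2 0 (vacuum H) : lp (fun _ : ℕ => Fock H) 2)
        ((Nat.divModEquiv N).symm (q, k)) = 0 :=
      lp.single_apply_ne (E := fun _ : ℕ => Fock H) 2 0 (vacuum H) h
    refine (congrArg (fun y => (branchScale N : ℂ) • star (creation (e k)) y) h0).trans ?_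
    rw [map_zero, smul_zero]

/-- The isometry `N^{-1/2} ∑ a_k ⊗ ℓ(e_k)` is pure. -/
theorem tendsto_star_branchCreation_pow {e : Fin N → H} (he : Orthonormal ℂ e)
    (f : lp (fun _ : ℕ => Fock H) 2) :
    Tendsto (fun n => (star (branchCreation e) ^ n) f) atTop (𝓝 0) := by
  set T := star (branchCreation e) with hT
  have hT1 : ∀ n f, ‖(T ^ n) f‖ ≤ ‖f‖ := by
    intro n f
    induction n with
    | zero => exact le_rfl
    | succ n ih =>
      rw [pow_succ']
      exact (norm_star_apply_le_of_isometry (star_branchCreation_mul_self he) _).trans ih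
  -- T lowers the Fock degree by one in every entry, so d applications annihilate vectors of degree
  -- below d.
  have hdeg : ∀ (d : ℕ) (f : lp (fun _ : ℕ => Fock H) 2), (∀ q d', d ≤ d' → f q d' = 0) →
      (T ^ d) f = 0 := by
    intro d
    induction d with
    | zero =>
      intro f hf
      change f = 0
      ext1
      funext q
      ext1
      funext d'
      exact hf q d' (Nat.zero_le _)
    | succ d ih =>
      intro f hf
      rw [pow_succ]
      refine ih (T f) fun q d' hd' => ?_
      have h1 := congrArg (fun v : Fock H => v d') (star_branchCreation_apply e f q)
      refine h1.trans ?_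
      change (∑ k, (branchScale N : ℂ) •
        star (creation (e k)) (f ((Nat.divModEquiv N).symm (q, k))) : Fock H) d' = 0
      refine (congrFun (lp.coeFn_sum _ _) d').trans ?_
      rw [Finset.sum_apply]
      refine Finset.sum_eq_zero fun k _ => ?_
      change (branchScale N : ℂ) • (star (creation (e k)) (f ((Nat.divModEquiv N).symm (q, k)))) d' = 0
      rw [star_creation_apply, hf _ _ (by omega), map_zero, smul_zero]
  let Z : Submodule ℂ (lp (fun _ : ℕ => Fock H) 2) :=
    { carrier := {f | Tendsto (fun n => (T ^ n) f) atTop (𝓝 0)}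
      add_mem' := fun {f g} hf hg => by
        have := Tendsto.add (f := fun n => (T ^ n) f) (g := fun n => (T ^ n) g) hf hg
        rw [add_zero] at this
        exact this.congr fun n => (map_add (T ^ n) f g).symm
      zero_mem' := by
        refine tendsto_const_nhds.congr fun n => (map_zero (T ^ n)).symm
      smul_mem' := fun c f hf => by
        have := Tendsto.const_smul (f := fun n => (T ^ n) f) hf c
        rw [smul_zero] at this
        exact this.congr fun n => (map_smul (T ^ n) c f).symm }
  -- Closedness uses only that the powers of T are contractions; it reduces purity to vectors of a
  -- single entry and degree.
  have hZ : IsClosed (Z : Set (lp (fun _ : ℕ => Fock H) 2)) := by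
    refine isClosed_of_closure_subset fun f hf => ?_
    change Tendsto (fun n => (T ^ n) f) atTop (𝓝 0)
    refine Metric.tendsto_atTop.2 fun ε hε => ?_
    obtain ⟨g, hg, hfg⟩ := Metric.mem_closure_iff.1 hf (ε / 2) (by positivity)
    obtain ⟨n₀, hn₀⟩ := Metric.tendsto_atTop.1
      (show Tendsto (fun n => (T ^ n) g) atTop (𝓝 0) from hg) (ε / 2) (by positivity)
    refine ⟨n₀, fun n hn => ?_⟩
    have h1 := hn₀ n hn
    rw [dist_zero_right] at h1 ⊢
    rw [dist_eq_norm] at hfg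
    have h2 := hT1 n (f - g)
    rw [map_sub] at h2
    have h3 := norm_le_norm_add_norm_sub' ((T ^ n) f) ((T ^ n) g)
    linarith
  have hsing : ∀ (q d : ℕ) (y : tensorPow H d),
      (lp.single 2 q (lp.single 2 d y : Fock H) : lp (fun _ : ℕ => Fock H) 2) ∈ Z := by
    intro q d y
    refine tendsto_atTop_of_eventually_const (i₀ := d + 1) fun n hn => ?_
    have h0 := hdeg n (lp.single 2 q (lp.single 2 d y : Fock H)) fun q' d' hd' => ?_
    · exact h0
    · by_cases hq : q' = q
      · subst hq
        rw [lp.single_apply_self]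
        exact lp.single_apply_ne (E := fun n => (tensorPow H n).carrier) 2 d y (by omega)
      · have h1 : (lp.single 2 q (lp.single 2 d y : Fock H) : lp (fun _ : ℕ => Fock H) 2) q' = 0 :=
          lp.single_apply_ne (E := fun _ : ℕ => Fock H) 2 q _ hq
        exact congrArg (fun v : Fock H => v d') h1
  have hsing' : ∀ (q : ℕ) (v : Fock H), (lp.single 2 q v : lp (fun _ : ℕ => Fock H) 2) ∈ Z := by
    intro q v
    let S := lp.singleContinuousLinearMap ℂ (fun _ : ℕ => Fock H) 2 q
    have hv := (lp.hasSum_single (p := 2) (by norm_num) v).mapL S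
    exact hZ.mem_of_tendsto hv (Eventually.of_forall fun t => Z.sum_mem fun d _ => hsing q d _)
  have hf := lp.hasSum_single (p := 2) (by norm_num) f
  exact hZ.mem_of_tendsto hf (Eventually.of_forall fun t => Z.sum_mem fun q _ => hsing' q _)

theorem orbitVec_finite_support (e : Fin N → H) (M : ℕ) : ∃ n, ∀ q, n ≤ q →
    orbitVec (branchCreation e) (lp.single 2 0 (vacuum H)) M q = 0 := by
  have hpow : ∀ m, ∃ n, ∀ q, n ≤ q →
      ((branchCreation e ^ m) (lp.single 2 0 (vacuum H))) q = 0 := by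
    intro m
    induction m with
    | zero => exact ⟨1, fun q hq => lp.single_apply_ne (E := fun _ : ℕ => Fock H) 2 0 _ (by omega)⟩
    | succ m ih =>
      rw [pow_succ']
      exact branchOp_finite_support (fun k => (branchScale N : ℂ) • creation (e k)) ih
  induction M with
  | zero => exact ⟨0, fun q _ => rfl⟩
  | succ M ih =>
    obtain ⟨n, hn⟩ := ih
    obtain ⟨n', hn'⟩ := hpow M
    refine ⟨max n n', fun q hq => ?_⟩
    rw [orbitVec, Finset.sum_range_succ]
    change orbitVec (branchCreation e) (lp.single 2 0 (vacuum H)) M q +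
      ((branchCreation e ^ M) (lp.single 2 0 (vacuum H))) q = 0
    have h1 := hn q ((le_max_left _ _).trans hq)
    have h2 := hn' q ((le_max_right _ _).trans hq)
    exact (congrArg₂ (· + ·) h1 h2).trans (add_zero _)

end BranchCreation

end FreeArakiWoods

end

noncomputable section


namespace FreeArakiWoods

set_option linter.unusedSectionVars false

open ContinuousLinearMap (adjoint)
open Filter Topology

/-! Shortcut instances that speed up elaboration. -/

local instance {K : Type*} [NormedAddCommGroup K] [InnerProductSpace ℂ K] :
    SeminormedRing (K →L[ℂ] K) := inferInstance
local instance {K : Type*} [NormedAddCommGroup K] [InnerProductSpace ℂ K] :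
    SeminormedAddCommGroup (K →L[ℂ] K) := inferInstance
local instance {K : Type*} [NormedAddCommGroup K] [InnerProductSpace ℂ K] :
    AddCommMonoid (K →L[ℂ] K) := inferInstance
local instance {K : Type*} [NormedAddCommGroup K] [InnerProductSpace ℂ K] :
    Module ℂ (K →L[ℂ] K) := inferInstance
local instance {K : Type*} [NormedAddCommGroup K] [InnerProductSpace ℂ K] :
    Mul (K →L[ℂ] K) := inferInstance
local instance {K : Type*} [NormedAddCommGroup K] [InnerProductSpace ℂ K] :
    SMul ℂ (K →L[ℂ] K) := inferInstance
local instance {K : Type*} [NormedAddCommGroup K] [InnerProductSpace ℂ K] :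
    Monoid (K →L[ℂ] K) := inferInstance
local instance {K : Type*} [NormedAddCommGroup K] [InnerProductSpace ℂ K]
    [CompleteSpace K] : Star (K →L[ℂ] K) := inferInstance
local instance {K : Type*} [NormedAddCommGroup K] [InnerProductSpace ℂ K]
    [CompleteSpace K] : StarRing (K →L[ℂ] K) := inferInstance

local instance : NormedRing toeplitz := inferInstance
local instance : SeminormedAddCommGroup toeplitz := inferInstance
local instance : AddCommMonoid toeplitz := inferInstance
local instance : Module ℂ toeplitz := inferInstance
local instance : Mul toeplitz := inferInstance
local instance : Star toeplitz := inferInstance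
local instance : NormedSpace ℂ toeplitz := inferInstance

/-! ### From completely bounded radial maps to estimates on φ -/

section PairSpan

open Complexification

variable {E : Type u} [NormedAddCommGroup E] [InnerProductSpace ℝ E] [CompleteSpace E]
  {U : ℝ → E ≃ₗᵢ[ℝ] E}

variable (U) in
/-- The span of the pairs formed by a Wick product and its purely annihilating part, over words of
length `n`. -/
def pairSpan (n : ℕ) : Submodule ℂ
    ((Fock (Complexification E) →L[ℂ] Fock (Complexification E)) ×
      (Fock (Complexification E) →L[ℂ] Fock (Complexification E))) :=
  Submodule.span ℂ {u | ∃ l : List (Complexification E), l.length = n ∧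
    u = (wick (l.map (wickPair U)), annWord ((l.map (wickPair U)).map Prod.snd))}

theorem one_mem_pairSpan : ((1, 1) : (Fock (Complexification E) →L[ℂ] Fock (Complexification E)) ×
    (Fock (Complexification E) →L[ℂ] Fock (Complexification E))) ∈ pairSpan U 0 :=
  Submodule.subset_span ⟨[], rfl, rfl⟩

/-- Prepending a letter to a Wick product adds its purely annihilating part, which must therefore be
carried along with the same coefficients. A real vector is its own conjugate, so a single vector
serves both operators. -/
theorem step_mem_pairSpan (x : E) {n : ℕ}
    {u : (Fock (Complexification E) →L[ℂ] Fock (Complexification E)) ×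
      (Fock (Complexification E) →L[ℂ] Fock (Complexification E))} (hu : u ∈ pairSpan U n) :
    (creation (embeddingOp U (ofReal x)) * u.1 + star (creation (embeddingOp U (ofReal x))) * u.2,
      star (creation (embeddingOp U (ofReal x))) * u.2) ∈ pairSpan U (n + 1) := by
  induction hu using Submodule.span_induction with
  | mem u hu =>
    obtain ⟨l, hl, rfl⟩ := hu
    refine Submodule.subset_span ⟨ofReal x :: l, by simp [hl], ?_⟩
    have h : (wickPair U (ofReal x)).2 = embeddingOp U (ofReal x) := by simp [wickPair]
    rw [List.map_cons, wick_cons, List.map_cons, annWord, h]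
    rfl
  | zero =>
    simp only [Prod.fst_zero, Prod.snd_zero, mul_zero, add_zero]
    exact (pairSpan U (n + 1)).zero_mem
  | add a b _ _ ha hb =>
    have := (pairSpan U (n + 1)).add_mem ha hb
    simp only [Prod.mk_add_mk] at this
    simp only [Prod.fst_add, Prod.snd_add, mul_add]
    convert this using 2
    abel
  | smul c a _ ha =>
    have := (pairSpan U (n + 1)).smul_mem c ha
    simp only [Prod.smul_mk, smul_add] at this
    simpa only [Prod.smul_fst, Prod.smul_snd, mul_smul_comm] using this

variable {N : ℕ} [NeZero N]

/-- The entries of a pair of operators lie in `pairSpan U n`. -/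
def HasPairEntries (U : ℝ → E ≃ₗᵢ[ℝ] E) (n : ℕ)
    (P Q : lp (fun _ : ℕ => Fock (Complexification E)) 2 →L[ℂ]
      lp (fun _ : ℕ => Fock (Complexification E)) 2) : Prop :=
  ∀ q q', (entry q q' P, entry q q' Q) ∈ pairSpan U n

theorem hasPairEntries_one : HasPairEntries U 0 1 1 := by
  intro q q'
  rw [entry_one]
  split_ifs
  · exact one_mem_pairSpan
  · exact (pairSpan U 0).zero_mem

theorem HasPairEntries.branch {n : ℕ} {P Q} (h : HasPairEntries U n P Q) (ζ : Fin N → E) :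
    HasPairEntries U (n + 1)
      (branchCreation (fun k => embeddingOp U (ofReal (ζ k))) * P +
        branchAnnihilation (fun k => embeddingOp U (ofReal (ζ k))) * Q)
      (branchAnnihilation (fun k => embeddingOp U (ofReal (ζ k))) * Q) := by
  intro q q'
  rw [map_add]
  unfold branchCreation branchAnnihilation
  rw [entry_branchOp_mul, entry_branchOp_mul]
  have := (pairSpan U (n + 1)).smul_mem (branchScale N : ℂ)
    (step_mem_pairSpan (ζ (Nat.divModEquiv N q).2) (h (Nat.divModEquiv N q).1 q'))
  simpa only [Prod.smul_mk, smul_add, smul_mul_assoc] using this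

/-- After taking adjoints the roles are exchanged: D* contains the creation operators and V* the
annihilation operators. -/
theorem HasPairEntries.star_branch {n : ℕ} {P Q} (h : HasPairEntries U n P Q) (ζ : Fin N → E) :
    HasPairEntries U (n + 1)
      (star (branchAnnihilation (fun k => embeddingOp U (ofReal (ζ k)))) * P +
        star (branchCreation (fun k => embeddingOp U (ofReal (ζ k)))) * Q)
      (star (branchCreation (fun k => embeddingOp U (ofReal (ζ k)))) * Q) := by
  intro q q'
  rw [map_add]
  unfold branchCreation branchAnnihilation
  rw [entry_star_branchOp_mul, entry_star_branchOp_mul, ← Finset.sum_add_distrib]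
  have h1 := (pairSpan U (n + 1)).sum_mem (t := Finset.univ) fun k _ =>
    (pairSpan U (n + 1)).smul_mem (branchScale N : ℂ)
      (step_mem_pairSpan (ζ k) (h ((Nat.divModEquiv N).symm (q, k)) q'))
  have h2 : ∀ f : Fin N → (Fock (Complexification E) →L[ℂ] Fock (Complexification E)) ×
      (Fock (Complexification E) →L[ℂ] Fock (Complexification E)),
      ∑ k, f k = (∑ k, (f k).1, ∑ k, (f k).2) := fun f => Prod.ext Prod.fst_sum Prod.snd_sum
  rw [h2] at h1
  simpa only [Prod.smul_mk, smul_add, smul_mul_assoc, star_smul, star_star, Complex.star_def,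
    Complex.conj_ofReal] using h1

theorem hasPairEntries_mixedProd (ζ : Fin N → E) (i j : ℕ) :
    HasPairEntries U (i + j)
      (mixedProd (branchCreation (fun k => embeddingOp U (ofReal (ζ k))))
        (branchAnnihilation (fun k => embeddingOp U (ofReal (ζ k)))) i j)
      (branchAnnihilation (fun k => embeddingOp U (ofReal (ζ k))) ^ i *
        star (branchCreation (fun k => embeddingOp U (ofReal (ζ k)))) ^ j) := by
  induction i with
  | zero =>
    rw [zero_add, pow_zero, one_mul]
    induction j with
    | zero =>
      rw [mixedProd, pow_zero]
      exact hasPairEntries_one (U := U)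
    | succ j ih =>
      rw [mixedProd, pow_succ']
      exact ih.star_branch ζ
  | succ i ih =>
    rw [mixedProd, pow_succ', mul_assoc, add_right_comm]
    exact ih.branch ζ

variable {φ : ℕ → ℂ}
  {A : StarSubalgebra ℂ (Fock (Complexification E) →L[ℂ] Fock (Complexification E))}
variable (hU : ∀ s t, U (s + t) = U s * U t) (hUc : ∀ x : E, Continuous fun t => U t x)

include hU hUc

theorem IsRadialMap.apply_pairSpan (hA : StarAlgebra.adjoin ℂ (generators U) ≤ A) {m : A →ₗ[ℂ] A}
    (hm : IsRadialMap U φ m) {n : ℕ}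
    {u : (Fock (Complexification E) →L[ℂ] Fock (Complexification E)) ×
      (Fock (Complexification E) →L[ℂ] Fock (Complexification E))} (hu : u ∈ pairSpan U n) :
    ∃ a : A, (a : Fock (Complexification E) →L[ℂ] Fock (Complexification E)) = u.1 ∧
      m a = φ n • a := by
  induction hu using Submodule.span_induction with
  | mem u hu =>
    obtain ⟨l, rfl, rfl⟩ := hu
    exact ⟨⟨wick (l.map (wickPair U)), hA (wick_mem_adjoin hU hUc l)⟩, rfl,
      hm.apply_wick hU hUc hA l⟩
  | zero => exact ⟨0, rfl, by rw [map_zero, smul_zero]⟩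
  | add u v _ _ hu hv =>
    obtain ⟨a, ha, ha'⟩ := hu
    obtain ⟨b, hb, hb'⟩ := hv
    exact ⟨a + b, by rw [Prod.fst_add, ← ha, ← hb]; rfl, by rw [map_add, ha', hb', smul_add]⟩
  | smul c u _ hu =>
    obtain ⟨a, ha, ha'⟩ := hu
    exact ⟨c • a, by rw [Prod.smul_fst, ← ha]; rfl, by rw [map_smul, ha', smul_comm]⟩

omit hU hUc in
theorem Complexification.ofReal_smul (c : ℝ) (x : E) :
    (ofReal (c • x) : Complexification E) = (c : ℂ) • ofReal x := by
  refine Complexification.ext ?_ ?_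
  · rw [re_smul, re_ofReal, re_ofReal, im_ofReal, Complex.ofReal_re, smul_zero, sub_zero]
  · rw [im_smul, im_ofReal, im_ofReal, Complex.ofReal_im, smul_zero, zero_smul, zero_add]

/-- In the infinite-dimensional case `K_ℝ` contains orthonormal families of any finite size. -/
theorem exists_orthonormal_embedding (hE : ¬ FiniteDimensional ℝ E) (N : ℕ) :
    ∃ ζ : Fin N → E, Orthonormal ℂ fun k => embeddingOp U (ofReal (ζ k)) := by
  induction N with
  | zero => exact ⟨Fin.elim0, ⟨fun k => k.elim0, fun k => k.elim0⟩⟩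
  | succ N ih =>
    obtain ⟨ζ, hζ⟩ := ih
    let T : E →ₗ[ℝ] (Fin N → ℂ) :=
      { toFun := fun x k => inner ℂ (embeddingOp U (ofReal (ζ k))) (embeddingOp U (ofReal x))
        map_add' := fun x y => by
          ext k
          have : (ofReal (x + y) : Complexification E) = ofReal x + ofReal y := by ext <;> simp
          simp only [this, map_add, inner_add_right, Pi.add_apply]
        map_smul' := fun c x => by
          ext k
          simp only [ofReal_smul, map_smul, inner_smul_right, Pi.smul_apply, RingHom.id_apply,
            Complex.real_smul] }
    -- A real-linear map from an infinite-dimensional space to ℂ^N has a kernel, which consists of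
    -- the vectors whose images are orthogonal to those already chosen.
    have hT : ¬ Function.Injective T := fun h => hE (FiniteDimensional.of_injective T h)
    obtain ⟨x, hx, hx0⟩ : ∃ x, T x = 0 ∧ x ≠ 0 := by
      by_contra! hcon
      exact hT ((injective_iff_map_eq_zero T).2 hcon)
    have hR0 : embeddingOp U (ofReal x) ≠ 0 := by
      intro h
      have h1 := embeddingOp_injective hU hUc (h.trans (map_zero _).symm)
      exact hx0 (congrArg Complexification.re h1)
    set r : ℝ := ‖embeddingOp U (ofReal x)‖⁻¹ with hr
    have hscale : embeddingOp U (ofReal (r • x)) = (r : ℂ) • embeddingOp U (ofReal x) := by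
      rw [ofReal_smul, map_smul]
    have hnorm : ‖embeddingOp U (ofReal (r • x))‖ = 1 := by
      rw [hscale, norm_smul, Complex.norm_real, Real.norm_of_nonneg (by positivity), hr]
      exact inv_mul_cancel₀ (norm_ne_zero_iff.2 hR0)
    have horth : ∀ k, inner ℂ (embeddingOp U (ofReal (ζ k))) (embeddingOp U (ofReal (r • x))) = 0 :=
      fun k => by
        rw [hscale, inner_smul_right]
        rw [show inner ℂ (embeddingOp U (ofReal (ζ k))) (embeddingOp U (ofReal x)) = 0 from
          congrFun hx k, mul_zero]
    refine ⟨Fin.cons (r • x) ζ, ?_, ?_⟩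
    · intro k
      refine Fin.cases ?_ (fun k => ?_) k
      · exact hnorm
      · exact hζ.1 k
    · intro k l
      refine Fin.cases ?_ (fun k => ?_) k <;> refine Fin.cases ?_ (fun l => ?_) l
      · intro h
        exact absurd rfl h
      · intro _
        exact inner_eq_zero_symm.1 (horth l)
      · intro _
        exact horth k
      · intro h
        exact hζ.2 (i := k) (j := l) fun h' => h (congrArg Fin.succ h')

/-- The estimate for completely bounded radial maps at a finite stage. -/
theorem IsRadialMap.norm_sum_le_stage (hE : ¬ FiniteDimensional ℝ E)
    (hA : StarAlgebra.adjoin ℂ (generators U) ≤ A) {m : A →ₗ[ℂ] A} (hm : IsRadialMap U φ m)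
    {C : ℝ} (hC : 0 ≤ C) (hcb : CBBound m C) (s : Finset (ℕ × ℕ)) (c : ℕ × ℕ → ℂ) (M N : ℕ)
    [NeZero N] :
    ‖∑ p ∈ s, c p * φ (p.1 + p.2) * ((min (M - p.1) (M - p.2) : ℕ) : ℂ)‖ ≤
      (C * ‖∑ p ∈ s, c p • (unilateralShift ^ p.1 * star unilateralShift ^ p.2)‖ +
        (C * (∑ p ∈ s, ‖c p‖ * (p.1 + p.2)) +
          ∑ p ∈ s, ‖c p * φ (p.1 + p.2)‖ * (p.1 + p.2)) * branchScale N) * M := by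
  obtain ⟨ζ, hζ⟩ := exists_orthonormal_embedding hU hUc hE N
  set V := branchCreation (fun k => embeddingOp U (ofReal (ζ k))) with hV
  set D := branchAnnihilation (fun k => embeddingOp U (ofReal (ζ k))) with hD
  set x₀ : lp (fun _ : ℕ => Fock (Complexification E)) 2 :=
    lp.single 2 0 (vacuum (Complexification E)) with hx₀
  set η := orbitVec V x₀ M with hη
  have hVV : star V * V = 1 := star_branchCreation_mul_self hζ
  have hx0 : star V x₀ = 0 := star_branchCreation_single_vacuum _
  have hx1 : ‖x₀‖ = 1 := (lp.norm_single (p := 2) (by norm_num) 0 _).trans norm_vacuum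
  have hV1 : ‖V‖ ≤ 1 := ContinuousLinearMap.opNorm_le_bound _ zero_le_one fun x => by
    rw [one_mul, norm_apply_of_isometry hVV]
  have hD1 : ‖D‖ ≤ branchScale N := norm_branchAnnihilation_le hζ
  have hΔ := norm_mixedProd_sub_le (branchScale_le_one N) hV1 hD1
  have hηsq : ‖η‖ * ‖η‖ = M := by
    have h := inner_orbitVec hVV hx0 hx1 M M
    rw [inner_self_eq_norm_sq_to_K, min_self, sq] at h
    exact Complex.ofReal_injective ((Complex.ofReal_mul _ _).trans
      (h.trans (Complex.ofReal_natCast M).symm))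
  set X := ∑ p ∈ s, c p • mixedProd V D p.1 p.2 with hX
  set Y := ∑ p ∈ s, (c p * φ (p.1 + p.2)) • mixedProd V D p.1 p.2 with hY
  -- X is a combination of V^i V*^j, controlled by the shift through the von Neumann inequality,
  -- plus an error of order N^(-1/2).
  have hXn : ‖X‖ ≤ ‖∑ p ∈ s, c p • (unilateralShift ^ p.1 * star unilateralShift ^ p.2)‖ +
      (∑ p ∈ s, ‖c p‖ * (p.1 + p.2)) * branchScale N := by
    have h1 : X = ∑ p ∈ s, c p • (V ^ p.1 * star V ^ p.2) +
        ∑ p ∈ s, c p • (mixedProd V D p.1 p.2 - V ^ p.1 * star V ^ p.2) := by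
      rw [← Finset.sum_add_distrib]
      refine Finset.sum_congr rfl fun p _ => ?_
      rw [← smul_add, add_sub_cancel]
    rw [h1]
    refine (norm_add_le _ _).trans (add_le_add
      (norm_sum_isometry_le hVV (tendsto_star_branchCreation_pow hζ) s c) ?_)
    refine (norm_sum_le _ _).trans ?_
    rw [Finset.sum_mul]
    refine Finset.sum_le_sum fun p _ => ?_
    rw [norm_smul, mul_assoc]
    exact mul_le_mul_of_nonneg_left (hΔ p.1 p.2) (norm_nonneg _)
  have hentry : ∀ q q' : ℕ, ∃ a : A,
      (∀ x, X (lp.single 2 q' x) q =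
        (a : Fock (Complexification E) →L[ℂ] Fock (Complexification E)) x) ∧
      ∀ x, Y (lp.single 2 q' x) q =
        (m a : Fock (Complexification E) →L[ℂ] Fock (Complexification E)) x := by
    intro q q'
    have h := fun p : ℕ × ℕ => hm.apply_pairSpan hU hUc hA
      (hasPairEntries_mixedProd (U := U) ζ p.1 p.2 q q')
    choose a ha ha' using h
    have hsum : ∀ d : ℕ × ℕ → ℂ, ((∑ p ∈ s, d p • a p : A) :
        Fock (Complexification E) →L[ℂ] Fock (Complexification E)) =
          entry q q' (∑ p ∈ s, d p • mixedProd V D p.1 p.2) := by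
      intro d
      rw [map_sum, AddSubmonoidClass.coe_finsetSum]
      refine Finset.sum_congr rfl fun p _ => ?_
      have h : (a p : Fock (Complexification E) →L[ℂ] Fock (Complexification E)) =
        entry q q' (mixedProd V D p.1 p.2) := ha p
      rw [map_smul, ← h]
      rfl
    refine ⟨∑ p ∈ s, c p • a p, fun x => ?_, fun x => ?_⟩
    · rw [hsum]
      rfl
    · have hma : m (∑ p ∈ s, c p • a p) = ∑ p ∈ s, (c p * φ (p.1 + p.2)) • a p := by
        rw [map_sum]
        refine Finset.sum_congr rfl fun p _ => ?_
        rw [map_smul, ha', smul_smul]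
      rw [hma, hsum]
      rfl
  obtain ⟨n, hn⟩ := orbitVec_finite_support (fun k => embeddingOp U (ofReal (ζ k))) M
  have hmain := hcb.norm_inner_le hC X Y hentry hn
  change ‖inner ℂ η (Y η)‖ ≤ C * ‖X‖ * ‖η‖ * ‖η‖ at hmain
  rw [mul_assoc, hηsq] at hmain
  -- V*^j shortens the orbit sum to its first M - j terms, so the inner product counts the terms
  -- common to two shortened sums.
  have hVinner : ∀ i j : ℕ, inner ℂ η ((V ^ i * star V ^ j) η) =
      ((min (M - i) (M - j) : ℕ) : ℂ) := by
    intro i j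
    have h : star V ^ i = star (V ^ i) := (star_pow V i).symm
    rw [← inner_orbitVec hVV hx0 hx1, ← star_pow_orbitVec hVV hx0 M i,
      ← star_pow_orbitVec hVV hx0 M j, h, inner_star_left]
    rfl
  have hYη : inner ℂ η (Y η) =
      ∑ p ∈ s, c p * φ (p.1 + p.2) * ((min (M - p.1) (M - p.2) : ℕ) : ℂ) +
      ∑ p ∈ s, c p * φ (p.1 + p.2) *
        inner ℂ η ((mixedProd V D p.1 p.2 - V ^ p.1 * star V ^ p.2) η) := by
    rw [hY, _root_.sum_apply, inner_sum, ← Finset.sum_add_distrib]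
    refine Finset.sum_congr rfl fun p _ => ?_
    rw [← hVinner, ← mul_add, ← inner_add_right, ← _root_.add_apply, add_sub_cancel,
      _root_.smul_apply, inner_smul_right]
  have hrest : ‖∑ p ∈ s, c p * φ (p.1 + p.2) *
      inner ℂ η ((mixedProd V D p.1 p.2 - V ^ p.1 * star V ^ p.2) η)‖ ≤
      (∑ p ∈ s, ‖c p * φ (p.1 + p.2)‖ * (p.1 + p.2)) * branchScale N * M := by
    refine (norm_sum_le _ _).trans ?_
    rw [Finset.sum_mul, Finset.sum_mul]
    refine Finset.sum_le_sum fun p _ => ?_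
    rw [norm_mul, mul_assoc, mul_assoc, ← hηsq]
    refine mul_le_mul_of_nonneg_left ?_ (norm_nonneg _)
    calc ‖inner ℂ η ((mixedProd V D p.1 p.2 - V ^ p.1 * star V ^ p.2) η)‖
        ≤ ‖η‖ * ‖(mixedProd V D p.1 p.2 - V ^ p.1 * star V ^ p.2) η‖ := norm_inner_le_norm _ _
      _ ≤ ‖η‖ * (((p.1 + p.2) * branchScale N) * ‖η‖) := by
        gcongr
        exact ContinuousLinearMap.le_of_opNorm_le _ (hΔ p.1 p.2) η
      _ = _ := by ring
  rw [eq_sub_of_add_eq hYη.symm]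
  have hCX := mul_le_mul_of_nonneg_right (mul_le_mul_of_nonneg_left hXn hC) (Nat.cast_nonneg (α := ℝ) M)
  calc _ ≤ _ := norm_sub_le _ _
    _ ≤ _ := add_le_add (hmain.trans hCX) hrest
    _ = _ := by ring

/-- The finite stage estimate is divided by M and both parameters are sent to infinity: min(M-i,
M-j)/M tends to 1 and the error N^(-1/2) vanishes. -/
theorem IsRadialMap.norm_sum_le (hE : ¬ FiniteDimensional ℝ E)
    (hA : StarAlgebra.adjoin ℂ (generators U) ≤ A) {m : A →ₗ[ℂ] A} (hm : IsRadialMap U φ m)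
    {C : ℝ} (hC : 0 ≤ C) (hcb : CBBound m C) (s : Finset (ℕ × ℕ)) (c : ℕ × ℕ → ℂ) :
    ‖∑ p ∈ s, c p * φ (p.1 + p.2)‖ ≤
      C * ‖∑ p ∈ s, c p • (unilateralShift ^ p.1 * star unilateralShift ^ p.2)‖ := by
  set κ := C * (∑ p ∈ s, ‖c p‖ * (p.1 + p.2)) + ∑ p ∈ s, ‖c p * φ (p.1 + p.2)‖ * (p.1 + p.2)
    with hκ
  have hstage : ∀ n : ℕ, ‖∑ p ∈ s, c p * φ (p.1 + p.2) *
      (((min (n + 1 - p.1) (n + 1 - p.2) : ℕ) : ℝ) / ((n : ℝ) + 1) : ℝ)‖ ≤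
      C * ‖∑ p ∈ s, c p • (unilateralShift ^ p.1 * star unilateralShift ^ p.2)‖ +
        κ * branchScale (n + 1) := by
    intro n
    -- A single parameter n + 1 serves as M and N; it is nonzero, as both the division and the
    -- branching require.
    have h := hm.norm_sum_le_stage hU hUc hE hA hC hcb s c (n + 1) (n + 1)
    have hpos : (0 : ℝ) < (n : ℝ) + 1 := by positivity
    have h2 : ∑ p ∈ s, c p * φ (p.1 + p.2) *
        ((((min (n + 1 - p.1) (n + 1 - p.2) : ℕ) : ℝ) / ((n : ℝ) + 1) : ℝ) : ℂ) =
        (∑ p ∈ s, c p * φ (p.1 + p.2) * ((min (n + 1 - p.1) (n + 1 - p.2) : ℕ) : ℂ)) /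
          (((n : ℝ) + 1 : ℝ) : ℂ) := by
      rw [Finset.sum_div]
      refine Finset.sum_congr rfl fun p _ => ?_
      rw [Complex.ofReal_div, mul_div_assoc, Complex.ofReal_natCast]
    rw [h2, norm_div, Complex.norm_real, Real.norm_of_nonneg hpos.le, div_le_iff₀ hpos]
    rw [Nat.cast_add_one] at h
    exact h
  have hlim : Tendsto (fun n : ℕ => ‖∑ p ∈ s, c p * φ (p.1 + p.2) *
      (((min (n + 1 - p.1) (n + 1 - p.2) : ℕ) : ℝ) / ((n : ℝ) + 1) : ℝ)‖) atTop
      (𝓝 ‖∑ p ∈ s, c p * φ (p.1 + p.2) * ((1 : ℝ) : ℂ)‖) := by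
    refine (tendsto_finsetSum _ fun p _ => ?_).norm
    refine tendsto_const_nhds.mul ((Complex.continuous_ofReal.tendsto 1).comp ?_)
    have hlow : Tendsto (fun n : ℕ => 1 - ((p.1 + p.2 : ℕ) : ℝ) * (1 / ((n : ℝ) + 1))) atTop
        (𝓝 1) := by
      simpa using tendsto_const_nhds.sub
        ((tendsto_one_div_add_atTop_nhds_zero_nat (𝕜 := ℝ)).const_mul ((p.1 + p.2 : ℕ) : ℝ))
    refine tendsto_of_tendsto_of_tendsto_of_le_of_le hlow tendsto_const_nhds (fun n => ?_)
      fun n => ?_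
    · have hpos : (0 : ℝ) < (n : ℝ) + 1 := by positivity
      have h : n + 1 ≤ min (n + 1 - p.1) (n + 1 - p.2) + (p.1 + p.2) := by omega
      have h' : (n : ℝ) + 1 ≤ ((min (n + 1 - p.1) (n + 1 - p.2) : ℕ) : ℝ) + ((p.1 + p.2 : ℕ) : ℝ) := by
        exact_mod_cast h
      change 1 - ((p.1 + p.2 : ℕ) : ℝ) * (1 / ((n : ℝ) + 1)) ≤ _ / _
      rw [le_div_iff₀ hpos, sub_mul, one_mul, mul_assoc, one_div, inv_mul_cancel₀ hpos.ne', mul_one]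
      linarith
    · have hpos : (0 : ℝ) < (n : ℝ) + 1 := by positivity
      have h : min (n + 1 - p.1) (n + 1 - p.2) ≤ n + 1 := by omega
      change _ / _ ≤ (1 : ℝ)
      rw [div_le_one hpos]
      exact_mod_cast h
  have hscale : Tendsto (fun n : ℕ => C * ‖∑ p ∈ s, c p • (unilateralShift ^ p.1 *
      star unilateralShift ^ p.2)‖ + κ * branchScale (n + 1)) atTop
      (𝓝 (C * ‖∑ p ∈ s, c p • (unilateralShift ^ p.1 * star unilateralShift ^ p.2)‖ + κ * 0)) := by
    refine tendsto_const_nhds.add (Tendsto.const_mul κ ?_)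
    have h := (tendsto_one_div_add_atTop_nhds_zero_nat (𝕜 := ℝ)).sqrt
    rw [Real.sqrt_zero] at h
    refine h.congr fun n => ?_
    rw [branchScale, one_div, Real.sqrt_inv]
    push_cast
    rfl
  have := le_of_tendsto_of_tendsto' hlim hscale hstage
  simpa using this

end PairSpan

/-! ### Bounded functionals on the Toeplitz algebra from estimates -/

section ToeplitzDensity

/-- S*S = 1 brings every word in S and S* into the order S^i S*^j. -/
theorem mem_span_of_mem_adjoin_shift {y : ellTwo →L[ℂ] ellTwo}
    (hy : y ∈ StarAlgebra.adjoin ℂ {unilateralShift}) :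
    y ∈ Submodule.span ℂ (Set.range fun p : ℕ × ℕ =>
      unilateralShift ^ p.1 * star unilateralShift ^ p.2) := by
  set W := Submodule.span ℂ (Set.range fun p : ℕ × ℕ =>
      unilateralShift ^ p.1 * star unilateralShift ^ p.2) with hW
  have hw : ∀ i j : ℕ, unilateralShift ^ i * star unilateralShift ^ j ∈ W := fun i j =>
    Submodule.subset_span ⟨(i, j), rfl⟩
  have hy' : y ∈ Algebra.adjoin ℂ ({unilateralShift} ∪ star {unilateralShift}) := by
    rw [← StarSubalgebra.mem_toSubalgebra, StarAlgebra.adjoin_toSubalgebra] at hy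
    exact hy
  clear hy
  have key : ∀ w ∈ W, y * w ∈ W := by
    induction hy' using Algebra.adjoin_induction with
    | mem y hy =>
      intro w hw'
      induction hw' using Submodule.span_induction with
      | mem w hw' =>
        obtain ⟨⟨i, j⟩, rfl⟩ := hw'
        rw [Set.star_singleton] at hy
        rcases hy with rfl | rfl
        · change unilateralShift * (unilateralShift ^ i * star unilateralShift ^ j) ∈ W
          rw [← mul_assoc, ← pow_succ']
          exact hw (i + 1) j
        · change star unilateralShift * (unilateralShift ^ i * star unilateralShift ^ j) ∈ W
          cases i with
          | zero =>
            rw [pow_zero, one_mul, ← pow_succ']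
            simpa using hw 0 (j + 1)
          | succ i =>
            rw [pow_succ', mul_assoc, ← mul_assoc (star _), star_shift_mul_shift, one_mul]
            exact hw i j
      | zero => rw [mul_zero]; exact W.zero_mem
      | add a b _ _ ha hb => rw [mul_add]; exact W.add_mem ha hb
      | smul c a _ ha => rw [mul_smul_comm]; exact W.smul_mem _ ha
    | algebraMap c =>
      intro w hw'
      rw [Algebra.algebraMap_eq_smul_one, smul_mul_assoc, one_mul]
      exact W.smul_mem _ hw'
    | add a b _ _ ha hb =>
      intro w hw'
      rw [add_mul]
      exact W.add_mem (ha w hw') (hb w hw')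
    | mul a b _ _ ha hb =>
      intro w hw'
      rw [mul_assoc]
      exact ha _ (hb w hw')
  have h1 : (1 : ellTwo →L[ℂ] ellTwo) ∈ W := by simpa using hw 0 0
  have := key 1 h1
  rwa [mul_one] at this

theorem map_linearCombination_eq_sum {M ι : Type*} [NormedAddCommGroup M] [NormedSpace ℂ M]
    (γ : M →L[ℂ] ℂ) (v : ι → M) (c : ι →₀ ℂ) :
    γ (Finsupp.linearCombination ℂ v c) = ∑ p ∈ c.support, c p * γ (v p) := by
  rw [Finsupp.linearCombination_apply, Finsupp.sum, map_sum]
  exact Finset.sum_congr rfl fun p _ => map_smul γ (c p) (v p)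

theorem linearCombination_single_one {M ι : Type*} [NormedAddCommGroup M] [NormedSpace ℂ M]
    (v : ι → M) (p : ι) : Finsupp.linearCombination ℂ v (Finsupp.single p 1) = v p := by
  rw [Finsupp.linearCombination_single, one_smul]

/-- Linear combinations of the elements `S^i S*^j` of the Toeplitz algebra. -/
def toeplitzCombination : (ℕ × ℕ →₀ ℂ) →ₗ[ℂ] toeplitz :=
  Finsupp.linearCombination ℂ fun p => toeplitzShift ^ p.1 * star toeplitzShift ^ p.2

theorem coe_toeplitzCombination (c : ℕ × ℕ →₀ ℂ) :
    (toeplitzCombination c : ellTwo →L[ℂ] ellTwo) =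
      ∑ p ∈ c.support, c p • (unilateralShift ^ p.1 * star unilateralShift ^ p.2) := by
  rw [toeplitzCombination, Finsupp.linearCombination_apply, Finsupp.sum,
    AddSubmonoidClass.coe_finsetSum]
  rfl

theorem denseRange_toeplitzCombination : DenseRange toeplitzCombination := by
  intro y
  rw [closure_subtype]
  have hy : (y : ellTwo →L[ℂ] ellTwo) ∈
      closure (StarAlgebra.adjoin ℂ {unilateralShift} : Set (ellTwo →L[ℂ] ellTwo)) := y.2
  refine closure_mono ?_ hy
  intro z hz
  obtain ⟨c, hc⟩ := (Finsupp.mem_span_range_iff_exists_finsupp).1 (mem_span_of_mem_adjoin_shift hz)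
  refine ⟨toeplitzCombination c, ⟨c, rfl⟩, ?_⟩
  rw [coe_toeplitzCombination, ← hc]
  rfl

variable {φ : ℕ → ℂ}

/-- The functional is defined on formal combinations of the S^i S*^j; the estimate makes it factor
through the operators they represent and extend by density, without any linear independence. -/
theorem exists_radialFunctional_of_bound {C : ℝ}
    (h : ∀ (s : Finset (ℕ × ℕ)) (c : ℕ × ℕ → ℂ), ‖∑ p ∈ s, c p * φ (p.1 + p.2)‖ ≤
      C * ‖∑ p ∈ s, c p • (unilateralShift ^ p.1 * star unilateralShift ^ p.2)‖) :
    ∃ γ : toeplitz →L[ℂ] ℂ, IsRadialFunctional φ γ := by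
  let f : (ℕ × ℕ →₀ ℂ) →ₗ[ℂ] ℂ := Finsupp.linearCombination ℂ fun p => φ (p.1 + p.2)
  have hf : ∀ c, ‖f c‖ ≤ C * ‖toeplitzCombination c‖ := by
    intro c
    have h1 : f c = ∑ p ∈ c.support, c p * φ (p.1 + p.2) := rfl
    have h2 : ‖toeplitzCombination c‖ = ‖(toeplitzCombination c : ellTwo →L[ℂ] ellTwo)‖ := rfl
    rw [h1, h2, coe_toeplitzCombination]
    exact h _ _
  refine ⟨f.extendOfNorm toeplitzCombination, fun i j => ?_⟩
  have h1 := LinearMap.extendOfNorm_eq denseRange_toeplitzCombination ⟨C, hf⟩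
    (Finsupp.single (i, j) 1)
  have h2 : toeplitzCombination (Finsupp.single (i, j) 1) =
      toeplitzShift ^ i * star toeplitzShift ^ j := by
    exact linearCombination_single_one _ (i, j)
  have h3 : f (Finsupp.single (i, j) 1) = φ (i + j) := by
    simp [f]
  rw [h2, h3] at h1
  exact h1

theorem IsRadialFunctional.norm_le_of_bound {γ : toeplitz →L[ℂ] ℂ} (hγ : IsRadialFunctional φ γ)
    {C : ℝ} (hC : 0 ≤ C)
    (h : ∀ (s : Finset (ℕ × ℕ)) (c : ℕ × ℕ → ℂ), ‖∑ p ∈ s, c p * φ (p.1 + p.2)‖ ≤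
      C * ‖∑ p ∈ s, c p • (unilateralShift ^ p.1 * star unilateralShift ^ p.2)‖) :
    ‖γ‖ ≤ C := by
  refine ContinuousLinearMap.opNorm_le_bound _ hC fun y => ?_
  refine denseRange_toeplitzCombination.induction_on (p := fun y => ‖γ y‖ ≤ C * ‖y‖) y ?_
    fun c => ?_
  · exact isClosed_le (by fun_prop) (by fun_prop)
  · have h1 : γ (toeplitzCombination c) = ∑ p ∈ c.support, c p * φ (p.1 + p.2) := by
      refine (map_linearCombination_eq_sum γ _ c).trans (Finset.sum_congr rfl fun p _ => ?_)
      exact congrArg (c p * ·) (hγ p.1 p.2)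
    have h2 : ‖toeplitzCombination c‖ = ‖(toeplitzCombination c : ellTwo →L[ℂ] ellTwo)‖ := rfl
    rw [h1, h2, coe_toeplitzCombination]
    exact h _ _

end ToeplitzDensity

end FreeArakiWoods

end

noncomputable section


namespace FreeArakiWoods

/-! ### Comparison of the norms -/

section Norms

variable {K : Type u} [NormedAddCommGroup K] [InnerProductSpace ℂ K] [CompleteSpace K]
  {A B : StarSubalgebra ℂ (K →L[ℂ] K)}

theorem CBBound.mono {m : A →ₗ[ℂ] B} {C C' : ℝ} (h : CBBound m C) (hC : C ≤ C') : CBBound m C' :=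
  fun n x => (h n x).trans (mul_le_mul_of_nonneg_right hC (norm_nonneg _))

theorem IsCompletelyBounded.exists_nonneg {m : A →ₗ[ℂ] B} (h : IsCompletelyBounded m) :
    ∃ C, 0 ≤ C ∧ CBBound m C :=
  h.elim fun C hC => ⟨|C|, abs_nonneg C, hC.mono (le_abs_self C)⟩

theorem cbNorm_eq_of_isLeast {m : A →ₗ[ℂ] B} {C : ℝ} (hC : 0 ≤ C) (h : CBBound m C)
    (hmin : ∀ C', 0 ≤ C' → CBBound m C' → C ≤ C') : cbNorm m = C :=
  IsLeast.csInf_eq ⟨⟨hC, h⟩, fun C' hC' => hmin C' hC'.1 hC'.2⟩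

end Norms

section RadialMultipliers

variable {E : Type u} [NormedAddCommGroup E] [InnerProductSpace ℝ E] [CompleteSpace E]
  {U : ℝ → E ≃ₗᵢ[ℝ] E} {φ : ℕ → ℂ}
  {A : StarSubalgebra ℂ (Fock (Complexification E) →L[ℂ] Fock (Complexification E))}
  (hU : ∀ s t, U (s + t) = U s * U t) (hUc : ∀ x : E, Continuous fun t => U t x)
  (hE : ¬ FiniteDimensional ℝ E)

include hU hUc hE

theorem IsRadialMap.exists_radialFunctional (hA : StarAlgebra.adjoin ℂ (generators U) ≤ A)
    {m : A →ₗ[ℂ] A} (hm : IsRadialMap U φ m) (hcb : IsCompletelyBounded m) :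
    ∃ γ : toeplitz →L[ℂ] ℂ, IsRadialFunctional φ γ :=
  let ⟨_, hC, h⟩ := hcb.exists_nonneg
  exists_radialFunctional_of_bound (hm.norm_sum_le hU hUc hE hA hC h)

theorem IsRadialMap.cbNorm_eq (hA : StarAlgebra.adjoin ℂ (generators U) ≤ A)
    {m : A →ₗ[ℂ] A} (hm : IsRadialMap U φ m) {γ : toeplitz →L[ℂ] ℂ} (hγ : IsRadialFunctional φ γ)
    (h : CBBound m ‖γ‖) : cbNorm m = ‖γ‖ :=
  cbNorm_eq_of_isLeast γ.opNorm_nonneg h fun _ hC hb =>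
    hγ.norm_le_of_bound hC (hm.norm_sum_le hU hUc hE hA hC hb)

end RadialMultipliers

end FreeArakiWoods

end

open FreeArakiWoods in
theorem theorem3 {E : Type*} [NormedAddCommGroup E] [InnerProductSpace ℝ E] [CompleteSpace E]
    (hE : ¬ FiniteDimensional ℝ E)
    (U : ℝ → E ≃ₗᵢ[ℝ] E) (hU : ∀ s t, U (s + t) = U s * U t)
    (hUc : ∀ x : E, Continuous fun t => U t x) (φ : ℕ → ℂ) :
    -- `m_φ` is completely bounded on the C*-algebra iff `γ` is bounded
    ((∃ m : Gam U →ₗ[ℂ] Gam U, IsRadialMap U φ m ∧ IsCompletelyBounded m) ↔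
        ∃ γ : toeplitz →L[ℂ] ℂ, IsRadialFunctional φ γ) ∧
    -- `m_φ` is a normal completely bounded map on the von Neumann algebra iff `γ` is bounded
    ((∃ m : (GamVN U).toStarSubalgebra →ₗ[ℂ] (GamVN U).toStarSubalgebra,
        IsRadialMap U φ m ∧ IsCompletelyBounded m ∧ IsNormalMap m) ↔
        ∃ γ : toeplitz →L[ℂ] ℂ, IsRadialFunctional φ γ) ∧
    -- in that case the norms coincide
    ∀ γ : toeplitz →L[ℂ] ℂ, IsRadialFunctional φ γ →
      (∀ m : Gam U →ₗ[ℂ] Gam U, IsRadialMap U φ m → IsCompletelyBounded m →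
        cbNorm m = ‖γ‖) ∧
      (∀ m : (GamVN U).toStarSubalgebra →ₗ[ℂ] (GamVN U).toStarSubalgebra,
        IsRadialMap U φ m → IsCompletelyBounded m → IsNormalMap m → cbNorm m = ‖γ‖) := by
  refine ⟨⟨?_, ?_⟩, ⟨?_, ?_⟩, ?_⟩
  · rintro ⟨m, hm, hcb⟩
    exact hm.exists_radialFunctional hU hUc hE adjoin_le_Gam hcb
  · rintro ⟨γ, hγ⟩
    obtain ⟨κ, P, Q, -, hPQ⟩ := exists_ampConj_of_radialFunctional (H := Complexification E) hγ
    have h : ∀ x ∈ Gam U, ampConj P Q x ∈ Gam U := fun x hx => ampConj_mem_Gam hU hUc hPQ hx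
    exact ⟨ampConjRestrict P Q _ h,
      isRadialMap_ampConjRestrict hU hUc hPQ h (Gam_le_GamVN hU hUc),
      _, cbBound_of_eq_ampConj _ P Q fun _ => rfl⟩
  · rintro ⟨m, hm, hcb, -⟩
    exact hm.exists_radialFunctional hU hUc hE (adjoin_le_GamVN hU hUc) hcb
  · rintro ⟨γ, hγ⟩
    obtain ⟨κ, P, Q, -, hPQ⟩ := exists_ampConj_of_radialFunctional (H := Complexification E) hγ
    have h : ∀ x ∈ (GamVN U).toStarSubalgebra, ampConj P Q x ∈ (GamVN U).toStarSubalgebra :=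
      fun x hx => ampConj_mem_GamVN hU hUc hPQ hx
    exact ⟨ampConjRestrict P Q _ h, isRadialMap_ampConjRestrict hU hUc hPQ h le_rfl,
      ⟨_, cbBound_of_eq_ampConj _ P Q fun _ => rfl⟩, isNormalMap_of_eq_ampConj _ P Q fun _ => rfl⟩
  -- An arbitrary admissible m is identified with the spatial map, which gives the upper bound ‖γ‖;
  -- the lower bound is the estimate of φ by any complete bound.
  · intro γ hγ
    obtain ⟨κ, P, Q, hn, hPQ⟩ := exists_ampConj_of_radialFunctional (H := Complexification E) hγ
    refine ⟨fun m hm hcb => ?_, fun m hm hcb hnm => ?_⟩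
    · exact hm.cbNorm_eq hU hUc hE adjoin_le_Gam hγ
        ((cbBound_of_eq_ampConj m P Q (hm.eq_ampConj_of_Gam hU hUc hPQ hcb)).mono hn)
    · exact hm.cbNorm_eq hU hUc hE (adjoin_le_GamVN hU hUc) hγ
        ((cbBound_of_eq_ampConj m P Q (hm.eq_ampConj_of_GamVN hU hUc hPQ hnm)).mono hn)
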